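/- Let $(M,\omega)$ be a connected symplectic manifold (finite-dimensional, Hausdorff, second countable), and write $C^\infty(M)$ for the smooth complex-valued functions. For a smooth real $H$ let $X_H$ be given by $i_{X_H}\omega=dH$, and let $\{f,H\}=df(X_H)$, extended complex bilinearly. Let $$f*g=\sum_{r\ge 0}\lambda^r M_r(f,g)$$ be a star product, i.e. an associative $\mathbb C[[\lambda]]$-bilinear product on $C^\infty(M)[[\lambda]]$ such that all $M_r$ are bidifferential operators, $M_0(f,g)=fg$, $M_1(f,g)-M_1(g,f)=\mathrm i\{f,g\}$, and $M_r(1,\cdot)=M_r(\cdot,1)=0$ for $r\ge1$. Assume $\overline{f*g}=\overline g*\overline f$ for all $f,g\in C^\infty(M)[[\lambda]]$, where $\overline\lambda:=\lambda$. Let $C_0^\infty(M)[[\lambda]]$ be the formal series whose coefficients are smooth functions with compact support. An element $a\in\mathbb R[[\lambda]]$ is called positive if its lowest nonvanishing coefficient is positive. A $\mathbb C[[\lambda]]$-linear functional $\mu:C_0^\infty(M)[[\lambda]]\to\mathbb C[[\lambda]]$ is called positive if for all $f$ the series $\mu(\overline f*f)$ lies in $\mathbb R[[\lambda]]$ and is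 zero or positive; it is called a trace if $\mu(f*g-g*f)=0$ for all $f,g$, and real if $\mu(\overline f)=\overline{\mu(f)}$ for all $f$. (1) Let $\mathrm{tr}$ be a real nonzero trace. Then $\mathrm{tr}$ or $-\mathrm{tr}$ is a positive functional, and the Gel'fand ideal $\{f\in C_0^\infty(M)[[\lambda]] : \mathrm{tr}(\overline f*f)=0\}$ is $\{0\}$. (2) Let $X$ be a symplectic vector field (that is, $i_X\omega$ is closed) and $\beta\in\mathbb R$. Let $\delta_X$ be the map on $C^\infty(M)[[\lambda]]$ that is given locally by $\delta_X f=H*f-f*H$ for any local Hamiltonian $H$ of $X$ (that is, $i_X\omega=dH$), and let $e^{\beta\delta_X}=\sum_{r\ge0}\frac{\beta^r}{r!}\delta_X^r$. Let the $\mathbb C[[\lambda]]$-linear functional $\mu$ on $C_0^\infty(M)[[\lambda]]$ satisfy the static formal KMS condition $$\mu(f*g)=\mu\bigl(g*e^{\beta\delta_X}(f)\bigr)\qquad\text{for all } f,g\in C_0^\infty(M)[[\lambda]].$$ Then there is an invertible $c\in\mathbb C[[\lambda]]$ such that $c\mu$, which satisfies the same condition, is a positive functional. (3) Suppose in addition that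 $X$ has a complete flow, and let $A_t$ be its time development operator: $t\mapsto A_tf$ is the solution of $\frac{d}{dt}f(t)=\frac{\mathrm i}{\lambda}\delta_Xf(t)$, $f(0)=f$. If $\mu$ satisfies the dynamic formal KMS condition $$\mu(A_t(f)*g)=\mu\bigl(g*A_te^{\beta\delta_X}(f)\bigr)\qquad\text{for all } t\in\mathbb R,\ f,g\in C_0^\infty(M)[[\lambda]],$$ then there is an invertible $c\in\mathbb C[[\lambda]]$ such that $c\mu$, which satisfies the same condition, is a positive functional. -/

import Mathlib

open scoped Manifold ContDiff Topology PowerSeries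

noncomputable section

namespace DQ

/-! ### Differential forms, symplectic forms, Poisson bracket -/

section Forms

variable {m : ℕ} {M : Type*} [TopologicalSpace M] [ChartedSpace (EuclideanSpace ℝ (Fin m)) M]

/-- The expression of a differential `n`-form `η` on `M` in the preferred chart at `p`
(the pullback of `η` along the inverse of the chart, a form on the target of the chart). -/
def localForm {n : ℕ} (η : ∀ q : M, TangentSpace (𝓡 m) q [⋀^Fin n]→L[ℝ] ℝ) (p : M)
    (y : EuclideanSpace ℝ (Fin m)) : EuclideanSpace ℝ (Fin m) [⋀^Fin n]→L[ℝ] ℝ :=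
  (η ((extChartAt (𝓡 m) p).symm y)).compContinuousLinearMap
    (mfderiv (𝓡 m) (𝓡 m) (extChartAt (𝓡 m) p).symm y)

/-- The differential form `η` is smooth. -/
def IsSmoothForm {n : ℕ} (η : ∀ q : M, TangentSpace (𝓡 m) q [⋀^Fin n]→L[ℝ] ℝ) : Prop :=
  ∀ p : M, ContDiffOn ℝ ∞ (localForm η p) (extChartAt (𝓡 m) p).target

/-- The (smooth) differential form `η` is closed: `dη = 0` in every preferred chart. -/
def IsClosedForm {n : ℕ} (η : ∀ q : M, TangentSpace (𝓡 m) q [⋀^Fin n]→L[ℝ] ℝ) : Prop :=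
  ∀ p : M, ∀ y ∈ (extChartAt (𝓡 m) p).target, extDeriv (localForm η p) y = 0

variable (m M) in
/-- A symplectic form on `M`: a smooth, closed, nondegenerate `2`-form. -/
structure SymplecticForm where
  form : ∀ q : M, TangentSpace (𝓡 m) q [⋀^Fin 2]→L[ℝ] ℝ
  smooth : IsSmoothForm form
  closed : IsClosedForm form
  nondegenerate : ∀ (q : M) (v : TangentSpace (𝓡 m) q),
    (∀ w : TangentSpace (𝓡 m) q, form q ![v, w] = 0) → v = 0

namespace SymplecticForm

variable (Ω : SymplecticForm m M)

/-- The one-form `i_X Ω = Ω(X, ·)`. -/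
def interior (X : ∀ q : M, TangentSpace (𝓡 m) q) (q : M) :
    TangentSpace (𝓡 m) q [⋀^Fin 1]→L[ℝ] ℝ :=
  ContinuousAlternatingMap.curryLeft (E := EuclideanSpace ℝ (Fin m)) (Ω.form q) (X q)

theorem interior_apply (X : ∀ q : M, TangentSpace (𝓡 m) q) (q : M) (v : TangentSpace (𝓡 m) q) :
    Ω.interior X q ![v] = Ω.form q ![X q, v] := rfl

/-- The linear map `v ↦ Ω_q(v, ·)` from the tangent space at `q` to its dual. -/
def flat (q : M) : TangentSpace (𝓡 m) q →ₗ[ℝ] Module.Dual ℝ (TangentSpace (𝓡 m) q) :=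
  LinearMap.mk₂ ℝ (fun v w => Ω.form q ![v, w])
    (fun v v' w => congrArg (fun η => η ![w]) (map_add (ContinuousAlternatingMap.curryLeft
      (E := EuclideanSpace ℝ (Fin m)) (Ω.form q)) v v'))
    (fun a v w => congrArg (fun η => η ![w]) (map_smul (ContinuousAlternatingMap.curryLeft
      (E := EuclideanSpace ℝ (Fin m)) (Ω.form q)) a v))
    (fun v w w' => congrArg (fun η => η ![]) (map_add (ContinuousAlternatingMap.curryLeft
      (ContinuousAlternatingMap.curryLeft
        (E := EuclideanSpace ℝ (Fin m)) (Ω.form q) v)) w w'))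
    (fun a v w => congrArg (fun η => η ![]) (map_smul (ContinuousAlternatingMap.curryLeft
      (ContinuousAlternatingMap.curryLeft
        (E := EuclideanSpace ℝ (Fin m)) (Ω.form q) v)) a w))

theorem flat_apply (q : M) (v w : TangentSpace (𝓡 m) q) : Ω.flat q v w = Ω.form q ![v, w] := rfl

theorem flat_injective (q : M) : Function.Injective (Ω.flat q) := by
  rw [injective_iff_map_eq_zero]
  intro v hv
  exact Ω.nondegenerate q v fun w => by rw [← flat_apply, hv]; rfl

/-- The musical isomorphism `v ↦ Ω_q(v, ·)`. -/
def flatEquiv (q : M) :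
    TangentSpace (𝓡 m) q ≃ₗ[ℝ] Module.Dual ℝ (TangentSpace (𝓡 m) q) :=
  haveI : FiniteDimensional ℝ (TangentSpace (𝓡 m) q) :=
    inferInstanceAs (FiniteDimensional ℝ (EuclideanSpace ℝ (Fin m)))
  LinearMap.linearEquivOfInjective (Ω.flat q) (Ω.flat_injective q)
    Subspace.dual_finrank_eq.symm

/-- The differential of a real function at `q`, as a covector. -/
def dReal (H : M → ℝ) (q : M) : TangentSpace (𝓡 m) q →L[ℝ] ℝ :=
  mfderiv (𝓡 m) 𝓘(ℝ, ℝ) H q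

/-- The differential of a complex function at `q`. -/
def dComplex (f : M → ℂ) (q : M) : TangentSpace (𝓡 m) q →L[ℝ] ℂ :=
  mfderiv (𝓡 m) 𝓘(ℝ, ℂ) f q

/-- The Hamiltonian vector field `X_H` of a real function, `i_{X_H} Ω = dH`. -/
def hamVec (H : M → ℝ) (q : M) : TangentSpace (𝓡 m) q :=
  (Ω.flatEquiv q).symm (dReal H q).toLinearMap

theorem form_hamVec (H : M → ℝ) (q : M) (w : TangentSpace (𝓡 m) q) :
    Ω.form q ![Ω.hamVec H q, w] = dReal H q w := by
  have h : Ω.flatEquiv q (Ω.hamVec H q) = (dReal H q).toLinearMap :=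
    LinearEquiv.apply_symm_apply _ _
  exact congrArg (fun l => l w) h

/-- The Poisson bracket `{f, g} = df(X_g)` of complex functions, where `X_g` is extended
complex linearly in `g`. -/
def poisson (f g : M → ℂ) (q : M) : ℂ :=
  dComplex f q (Ω.hamVec (fun x => (g x).re) q) +
    Complex.I * dComplex f q (Ω.hamVec (fun x => (g x).im) q)

/-- `X` is a (smooth) symplectic vector field: the one-form `i_X Ω` is closed. -/
structure IsSymplecticVectorField [IsManifold (𝓡 m) ∞ M]
    (X : ∀ q : M, TangentSpace (𝓡 m) q) : Prop where
  smooth : ContMDiff (𝓡 m) (𝓡 m).tangent ∞ (fun q => (⟨q, X q⟩ : TangentBundle (𝓡 m) M))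
  closed : IsClosedForm (Ω.interior X)

/-- `H` is a local Hamiltonian of `X` near `p`: `i_X Ω = dH` in a neighbourhood of `p`. -/
def IsHamiltonianNear (X : ∀ q : M, TangentSpace (𝓡 m) q) (H : M → ℝ) (p : M) : Prop :=
  ∀ᶠ q in 𝓝 p, ∀ v : TangentSpace (𝓡 m) q, Ω.interior X q ![v] = dReal H q v

end SymplecticForm

/-- The vector field `X` has a complete flow: its integral curves exist for all times. -/
def IsCompleteVectorField (X : ∀ q : M, TangentSpace (𝓡 m) q) : Prop :=
  ∀ p : M, ∃ γ : ℝ → M, γ 0 = p ∧ IsMIntegralCurve (I := 𝓡 m) γ X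

end Forms

/-! ### Smooth functions and formal power series -/

section Functions

variable (m : ℕ) (M : Type*) [TopologicalSpace M] [ChartedSpace (EuclideanSpace ℝ (Fin m)) M]

/-- The algebra `C^∞(M)` of smooth complex-valued functions. -/
def Smooth : Subalgebra ℂ (M → ℂ) where
  carrier := {f | ContMDiff (𝓡 m) 𝓘(ℝ, ℂ) ∞ f}
  mul_mem' hf hg := (contDiff_mul (𝕜 := ℝ)).comp_contMDiff
    (ContMDiff.prodMk_space hf hg)
  add_mem' hf hg := ContMDiff.add hf hg
  algebraMap_mem' _ := contMDiff_const

variable {m M}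

/-- Complex conjugation on `C^∞(M)`. -/
def conj : Smooth m M →+* Smooth m M where
  toFun f := ⟨fun q => starRingEnd ℂ (f.1 q),
    ContMDiff.comp (I' := 𝓘(ℝ, ℂ)) Complex.conjCLE.contDiff.contMDiff f.2⟩
  map_one' := by ext q; simp
  map_mul' f g := by ext q; simp
  map_zero' := by ext q; simp
  map_add' f g := by ext q; simp

/-- A smooth real function as an element of `C^∞(M)`. -/
def ofReal (H : M → ℝ) (hH : ContMDiff (𝓡 m) 𝓘(ℝ, ℝ) ∞ H) : Smooth m M :=
  ⟨fun q => (H q : ℂ),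
    ContMDiff.comp (I' := 𝓘(ℝ, ℝ)) Complex.ofRealCLM.contDiff.contMDiff hH⟩

variable (m M) in
/-- `C^∞(M)[[λ]]`. The formal parameter `λ` is the variable of the power series. -/
abbrev Series := PowerSeries (Smooth m M)

/-- The value at `q ∈ M` of the coefficient of `λ^n`. -/
def val (n : ℕ) (f : Series m M) (q : M) : ℂ := (PowerSeries.coeff n f).1 q

/-- Complex conjugation on `C^∞(M)[[λ]]`, with real `λ`. -/
def conjS : Series m M →+* Series m M := PowerSeries.map conj

/-- Complex conjugation on `ℂ[[λ]]`, with real `λ`. -/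
def conjC : ℂ⟦X⟧ →+* ℂ⟦X⟧ := PowerSeries.map (starRingEnd ℂ)

variable (m M) in
/-- `C_0^∞(M)[[λ]]`: the series all of whose coefficients have compact support. -/
def Compact : Submodule ℂ⟦X⟧ (Series m M) where
  carrier := {f | ∀ n, HasCompactSupport (val n f)}
  add_mem' := by
    intro f g hf hg n
    have : val n (f + g) = val n f + val n g := by
      funext q; simp [val]
    rw [this]
    exact (hf n).add (hg n)
  zero_mem' := by
    intro n
    have : val n (0 : Series m M) = 0 := by funext q; simp [val]
    rw [this]
    exact HasCompactSupport.zero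
  smul_mem' := by
    intro c f hf n
    have : val n (c • f) = ∑ ij ∈ Finset.HasAntidiagonal.antidiagonal n,
        fun q => PowerSeries.coeff ij.1 c * val ij.2 f q := by
      funext q
      have h : algebraMap ℂ⟦X⟧ (Series m M) c = PowerSeries.map (algebraMap ℂ (Smooth m M)) c :=
        rfl
      simp [val, Algebra.smul_def, h, PowerSeries.coeff_mul, Finset.sum_apply]
    rw [this]
    refine Finset.sum_induction _ HasCompactSupport (fun _ _ h h' => h.add h')
      HasCompactSupport.zero fun ij _ => ?_
    exact (hf ij.2).mul_left (f := fun _ => PowerSeries.coeff ij.1 c)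

variable (m M) in
/-- The `ℂ[[λ]]`-linear functionals `C_0^∞(M)[[λ]] → ℂ[[λ]]`. -/
abbrev Functional := Compact m M →ₗ[ℂ⟦X⟧] ℂ⟦X⟧

theorem conjS_mem {f : Series m M} (hf : f ∈ Compact m M) : conjS f ∈ Compact m M := by
  intro n
  have : val n (conjS f) = fun q => starRingEnd ℂ (val n f q) := by
    funext q; simp [val, conjS, conj]
  rw [this]
  exact (hf n).comp_left (g := starRingEnd ℂ) (map_zero _)

/-- A functional is real if `μ(conj f) = conj (μ f)`. -/
def IsReal (μ : Functional m M) : Prop :=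
  ∀ f : Compact m M, μ ⟨conjS f.1, conjS_mem f.2⟩ = conjC (μ f)

end Functions

/-- An element of `ℝ[[λ]]` is positive iff its lowest nonvanishing coefficient is positive. -/
def IsPosSeries (a : ℝ⟦X⟧) : Prop :=
  ∃ k, (∀ i < k, PowerSeries.coeff i a = 0) ∧ 0 < PowerSeries.coeff k a

/-- `a ≥ 0` for `a ∈ ℂ[[λ]]`: `a` is real, and zero or positive in the ordered ring `ℝ[[λ]]`. -/
def IsNonnegSeries (a : ℂ⟦X⟧) : Prop :=
  ∃ b : ℝ⟦X⟧, a = PowerSeries.map Complex.ofRealHom b ∧ (b = 0 ∨ IsPosSeries b)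

/-! ### Star products -/

section Star

variable {m : ℕ} {M : Type*} [TopologicalSpace M] [ChartedSpace (EuclideanSpace ℝ (Fin m)) M]

/-- The iterated coordinate derivative `∂_{I 0} ⋯ ∂_{I (i-1)} f` at `q`, with respect to the
coordinates of the preferred chart at `p`. -/
def partialDeriv (p : M) {i : ℕ} (I : Fin i → Fin m) (f : M → ℂ) (q : M) : ℂ :=
  iteratedFDeriv ℝ i (f ∘ (chartAt (EuclideanSpace ℝ (Fin m)) p).symm)
    (chartAt (EuclideanSpace ℝ (Fin m)) p q) (fun a => EuclideanSpace.single (I a) (1 : ℝ))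

/-- `B` is a bidifferential operator: near each point it is given, in a chart, by a finite sum
`∑ c_{IJ} ∂_I f ∂_J g` with smooth coefficients. -/
def IsBidifferential (B : Smooth m M →ₗ[ℂ] Smooth m M →ₗ[ℂ] Smooth m M) : Prop :=
  ∀ p : M, ∃ (k : ℕ) (U : Set M)
    (c : ∀ i j : ℕ, (Fin i → Fin m) → (Fin j → Fin m) → M → ℂ),
    IsOpen U ∧ p ∈ U ∧ U ⊆ (chartAt (EuclideanSpace ℝ (Fin m)) p).source ∧
    (∀ i j I J, ContMDiffOn (𝓡 m) 𝓘(ℝ, ℂ) ∞ (c i j I J) U) ∧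
    ∀ f g : Smooth m M, ∀ q ∈ U,
      (B f g).1 q = ∑ i ∈ Finset.range (k + 1), ∑ j ∈ Finset.range (k + 1),
        ∑ I : Fin i → Fin m, ∑ J : Fin j → Fin m,
          c i j I J q * partialDeriv p I f.1 q * partialDeriv p J g.1 q

/-- The `ℂ[[λ]]`-bilinear product `f * g = ∑_r λ^r B_r(f, g)` on `C^∞(M)[[λ]]`. -/
def starMul (B : ℕ → Smooth m M →ₗ[ℂ] Smooth m M →ₗ[ℂ] Smooth m M) (f g : Series m M) :
    Series m M :=
  PowerSeries.mk fun n => ∑ rs ∈ Finset.HasAntidiagonal.antidiagonal n, ∑ ij ∈ Finset.HasAntidiagonal.antidiagonal rs.2,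
    B rs.1 (PowerSeries.coeff ij.1 f) (PowerSeries.coeff ij.2 g)

/-- A star product on the symplectic manifold `(M, Ω)`. -/
structure StarProduct (Ω : SymplecticForm m M) where
  B : ℕ → Smooth m M →ₗ[ℂ] Smooth m M →ₗ[ℂ] Smooth m M
  bidiff : ∀ r, IsBidifferential (B r)
  zeroth : ∀ f g, B 0 f g = f * g
  first : ∀ f g q, (B 1 f g - B 1 g f).1 q = Complex.I * Ω.poisson f.1 g.1 q
  const_left : ∀ r, 1 ≤ r → ∀ f, B r 1 f = 0
  const_right : ∀ r, 1 ≤ r → ∀ f, B r f 1 = 0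
  assoc : ∀ f g h, starMul B (starMul B f g) h = starMul B f (starMul B g h)

theorem partialDeriv_eq_zero (p : M) {i : ℕ} (I : Fin i → Fin m) {f : M → ℂ} {q : M}
    (hq : q ∈ (chartAt (EuclideanSpace ℝ (Fin m)) p).source) (hf : f =ᶠ[𝓝 q] 0) :
    partialDeriv p I f q = 0 := by
  set φ := chartAt (EuclideanSpace ℝ (Fin m)) p
  have h1 : Filter.Tendsto φ.symm (𝓝 (φ q)) (𝓝 q) := by
    have := φ.continuousAt_symm (φ.map_source hq)
    rwa [ContinuousAt, φ.left_inv hq] at this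
  have h2 : (f ∘ φ.symm) =ᶠ[𝓝 (φ q)] (fun _ => 0) := h1.eventually hf
  have h3 := (h2.iteratedFDeriv ℝ i).eq_of_nhds
  unfold partialDeriv
  rw [h3]
  simp [iteratedFDeriv_fun_zero]

theorem IsBidifferential.support_left {B : Smooth m M →ₗ[ℂ] Smooth m M →ₗ[ℂ] Smooth m M}
    (hB : IsBidifferential B) (f g : Smooth m M) :
    Function.support (B f g).1 ⊆ tsupport f.1 := by
  intro q hq
  by_contra hn
  obtain ⟨k, U, c, -, hp, hU, -, h⟩ := hB q
  refine hq ((h f g q hp).trans ?_)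
  have hz : ∀ {i : ℕ} (I : Fin i → Fin m), partialDeriv q I f.1 q = 0 := fun I =>
    partialDeriv_eq_zero q I (hU hp) (notMem_tsupport_iff_eventuallyEq.1 hn)
  simp [hz]

theorem IsBidifferential.support_right {B : Smooth m M →ₗ[ℂ] Smooth m M →ₗ[ℂ] Smooth m M}
    (hB : IsBidifferential B) (f g : Smooth m M) :
    Function.support (B f g).1 ⊆ tsupport g.1 := by
  intro q hq
  by_contra hn
  obtain ⟨k, U, c, -, hp, hU, -, h⟩ := hB q
  refine hq ((h f g q hp).trans ?_)
  have hz : ∀ {i : ℕ} (I : Fin i → Fin m), partialDeriv q I g.1 q = 0 := fun I =>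
    partialDeriv_eq_zero q I (hU hp) (notMem_tsupport_iff_eventuallyEq.1 hn)
  simp [hz]

namespace StarProduct

variable {Ω : SymplecticForm m M} (S : StarProduct Ω)

/-- The product `f * g` on `C^∞(M)[[λ]]`. -/
def mul (f g : Series m M) : Series m M := starMul S.B f g

theorem val_mul (n : ℕ) (f g : Series m M) :
    val n (S.mul f g) = ∑ rs ∈ Finset.HasAntidiagonal.antidiagonal n, ∑ ij ∈ Finset.HasAntidiagonal.antidiagonal rs.2,
      (S.B rs.1 (PowerSeries.coeff ij.1 f) (PowerSeries.coeff ij.2 g)).1 := by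
  funext q
  simp [val, mul, starMul, Finset.sum_apply]

theorem mul_mem_left [T2Space M] {f : Series m M} (hf : f ∈ Compact m M) (g : Series m M) :
    S.mul f g ∈ Compact m M := by
  intro n
  rw [val_mul]
  refine Finset.sum_induction _ HasCompactSupport (fun _ _ h h' => h.add h')
    HasCompactSupport.zero fun rs _ => ?_
  refine Finset.sum_induction _ HasCompactSupport (fun _ _ h h' => h.add h')
    HasCompactSupport.zero fun ij _ => ?_
  exact HasCompactSupport.mono' (hf ij.1) ((S.bidiff rs.1).support_left _ _)

theorem mul_mem_right [T2Space M] (f : Series m M) {g : Series m M} (hg : g ∈ Compact m M) :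
    S.mul f g ∈ Compact m M := by
  intro n
  rw [val_mul]
  refine Finset.sum_induction _ HasCompactSupport (fun _ _ h h' => h.add h')
    HasCompactSupport.zero fun rs _ => ?_
  refine Finset.sum_induction _ HasCompactSupport (fun _ _ h h' => h.add h')
    HasCompactSupport.zero fun ij _ => ?_
  exact HasCompactSupport.mono' (hg ij.2) ((S.bidiff rs.1).support_right _ _)

/-- The product of a compactly supported series and an arbitrary one. -/
def mulLeft [T2Space M] (f : Compact m M) (g : Series m M) : Compact m M :=
  ⟨S.mul f.1 g, S.mul_mem_left f.2 g⟩

/-- The product of an arbitrary series and a compactly supported one. -/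
def mulRight [T2Space M] (f : Series m M) (g : Compact m M) : Compact m M :=
  ⟨S.mul f g.1, S.mul_mem_right f g.2⟩

/-- `*` is hermitian: complex conjugation is an antiautomorphism of it. -/
def IsHermitian : Prop :=
  ∀ f g : Series m M, conjS (S.mul f g) = S.mul (conjS g) (conjS f)

/-! ### Traces and positive functionals -/

/-- A trace: a `ℂ[[λ]]`-linear functional that vanishes on star commutators. -/
def IsTrace [T2Space M] (tr : Functional m M) : Prop :=
  ∀ f g : Compact m M, tr (S.mulLeft f g.1 - S.mulLeft g f.1) = 0

/-- `μ(conj f * f) ≥ 0` for all `f`, in the ring ordering of `ℝ[[λ]]`. -/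
def IsPositive [T2Space M] (μ : Functional m M) : Prop :=
  ∀ f : Compact m M, IsNonnegSeries (μ (S.mulRight (conjS f.1) f))

/-- The Gel'fand ideal `{f | μ(conj f * f) = 0}`. -/
def gelfandIdeal [T2Space M] (μ : Functional m M) : Set (Compact m M) :=
  {f | μ (S.mulRight (conjS f.1) f) = 0}

/-! ### The derivation of a symplectic vector field and the KMS conditions -/

/-- `ad(H) f = H * f - f * H`. -/
def ad (H : Smooth m M) (f : Series m M) : Series m M :=
  S.mul (PowerSeries.C H) f - S.mul f (PowerSeries.C H)

/-- `F = δ_X f`: near each point `p`, the series `F` is `ad(H) f` for the local Hamiltonians `H`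
of `X`. (A local Hamiltonian may be cut off to a globally defined function, and by locality
of `*` the value of `ad(H) f` at `p` depends only on `H` near `p`.) -/
def IsDelta (X : ∀ q : M, TangentSpace (𝓡 m) q) (f F : Series m M) : Prop :=
  ∀ (p : M) (H : M → ℝ) (hH : ContMDiff (𝓡 m) 𝓘(ℝ, ℝ) ∞ H), Ω.IsHamiltonianNear X H p →
    ∀ n, val n F p = val n (S.ad (ofReal H hH) f) p

open Classical in
/-- The derivation `δ_X` of a symplectic vector field `X`: the series `δ_X f` is the one
determined by `δ_X f = ad(H) f` locally, for local Hamiltonians `H` of `X`.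
(The default value is irrelevant for symplectic vector fields.) -/
def delta (X : ∀ q : M, TangentSpace (𝓡 m) q) (f : Series m M) : Series m M :=
  if h : ∃ F, S.IsDelta X f F then h.choose else 0

/-- `e^{β δ_X} f = ∑_r (β^r / r!) δ_X^r f`. As `δ_X` raises the `λ`-degree by at least one, only
the terms with `r ≤ n` contribute to the coefficient of `λ^n`. -/
def expDelta (X : ∀ q : M, TangentSpace (𝓡 m) q) (β : ℝ) (f : Series m M) : Series m M :=
  PowerSeries.mk fun n => ∑ r ∈ Finset.range (n + 1),
    ((β : ℂ) ^ r / (r.factorial : ℂ)) • PowerSeries.coeff n ((S.delta X)^[r] f)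

/-- The static formal KMS condition `μ(f * g) = μ(g * e^{β δ_X} f)`. -/
def StaticKMS [T2Space M] (X : ∀ q : M, TangentSpace (𝓡 m) q) (β : ℝ) (μ : Functional m M) :
    Prop :=
  ∀ f g : Compact m M, μ (S.mulLeft f g.1) = μ (S.mulLeft g (S.expDelta X β f.1))

/-- `F` solves Heisenberg's equation `d/dt F(t) = (i/λ) δ_X F(t)`, `F(0) = f`. All coefficients
are smooth in time and space together; the factor `1/λ` shifts the coefficients by one. -/
structure IsHeisenbergSolution (X : ∀ q : M, TangentSpace (𝓡 m) q) (f : Series m M)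
    (F : ℝ → Series m M) : Prop where
  initial : F 0 = f
  smooth : ∀ n, ContMDiff (𝓘(ℝ, ℝ).prod (𝓡 m)) 𝓘(ℝ, ℂ) ∞
    (fun tq : ℝ × M => val n (F tq.1) tq.2)
  deriv : ∀ (t : ℝ) (n : ℕ) (q : M),
    HasDerivAt (fun s => val n (F s) q) (Complex.I * val (n + 1) (S.delta X (F t)) q) t

open Classical in
/-- The time development operator `A_t` of a symplectic vector field `X` with complete flow:
`t ↦ A_t f` is the solution of Heisenberg's equation with initial value `f`.
(The default value is irrelevant for symplectic vector fields with complete flow.) -/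
def timeDev (X : ∀ q : M, TangentSpace (𝓡 m) q) (t : ℝ) (f : Series m M) : Series m M :=
  if h : ∃ F, S.IsHeisenbergSolution X f F then h.choose t else f

/-- The dynamic formal KMS condition `μ(A_t f * g) = μ(g * A_{t + iλβ} f)` for all `t`, where
`A_{t + iλβ} = A_t ∘ e^{β δ_X}`. -/
def DynamicKMS [T2Space M] (X : ∀ q : M, TangentSpace (𝓡 m) q) (β : ℝ) (μ : Functional m M) :
    Prop :=
  ∀ (t : ℝ) (f g : Compact m M), μ (S.mulRight (S.timeDev X t f.1) g) =
    μ (S.mulLeft g (S.timeDev X t (S.expDelta X β f.1)))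

end StarProduct

end Star

end DQ

end

/-!
The functionals in question are rigid already at lowest order in `λ`. Let `μ` be a trace or a
static KMS functional, let `λ^k` be its lowest order, and let `ν` be the coefficient of `λ^k` of
`μ`, restricted to `C_0^∞(M)`. The next order of the trace or KMS condition reads
`ν({f, g} + g D f) = 0`, where `D` maps real functions to real functions (`D = 0` for a trace,
`D f = -β {H, f}` with local Hamiltonians `H` of `X` for a KMS functional). No continuity of `ν`
is assumed.

*Lowest order.* `StarProduct.exists_phase` shows that, unless `ν = 0`, there is a complex number
`z ≠ 0` such that `ν(conj f * f)` is a positive multiple of `z` for all `f ≠ 0` in `C_0^∞(M)`. In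
a chart, coordinate vector fields are combinations of Hamiltonian vector fields, so the condition
becomes a first-order system `ν(∂_i v) = ν(b_i v)` with smooth real `b_i`, for all test functions
`v` on a box. If the one-form `b` is not closed, then `ν` vanishes on a smaller box, and by unique
continuation (`Solves.eq_zero_of_update`, `eq_zero_of_subbox`) on the whole box. If it is closed,
then `b = dφ` by the Poincaré lemma, and `ν(e^φ ·)` annihilates all coordinate derivatives; as test
functions can be integrated out one coordinate after the other, `ν` is then a multiple of
integration against a positive density (`exists_pos_mul_of_solves`). The phase of `z` is locally
constant, hence constant on the connected manifold `M`.

*Positivity.* If `f` starts with `λ^s f_s`, then `conj f * f` starts with `λ^{2s} conj f_s f_s`, so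
`μ(conj f * f)` starts with a positive multiple of `z` at order `k + 2s` (`HasLowestPhase`). For
a real `μ` the series `μ(conj f * f)` is real since `*` is hermitian, and `z` is real too, so that
`μ` or `-μ` is positive, with trivial Gel'fand ideal. This is the statement on traces.

*KMS functionals.* Rescale `μ` such that its value at one fixed real series `conj f₁ * f₁` is `λ^k`.
The conjugate functional `f ↦ conj μ(conj f)` satisfies the same KMS condition
(`StaticKMS.star`), because `δ_X` anticommutes with the conjugation and `e^{-βδ_X}` is inverse to
`e^{βδ_X}`. The difference of the two is a KMS functional that vanishes at `conj f₁ * f₁`; by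
the analysis of the lowest order it is zero. So the rescaled functional is real, and its lowest
order is positive.

The dynamic KMS condition contains the static one at time zero.
-/

open scoped Manifold ContDiff Topology PowerSeries

noncomputable section

namespace DQ

/-! ### Integration along coordinate lines -/

section Euclid

open Set MeasureTheory

variable {m : ℕ}
variable {F : Type*} [NormedAddCommGroup F] [NormedSpace ℝ F]

/-- The integral over `[0, 1]` of a smooth function depends smoothly on parameters. -/
theorem contDiff_integral_param {V : Type*} [NormedAddCommGroup V] [NormedSpace ℝ V]
    {f : V × ℝ → F} (hf : ContDiff ℝ ∞ f) :
    ContDiff ℝ ∞ fun x => ∫ t in (0 : ℝ)..1, f (x, t) := by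
  -- the integral is a convolution at `0`; the bump `ψ` provides the compact support
  let ψ : ContDiffBump (0 : ℝ) := ⟨2, 3, by norm_num, by norm_num⟩
  let g : V → ℝ → F := fun x u => ψ u • f (x, -u)
  let k : ℝ → ℝ := indicator (Ioc 0 1) 1
  have hg : ContDiff ℝ ∞ (fun q : V × ℝ => g q.1 q.2) := by
    have h1 : ContDiff ℝ ∞ (fun q : V × ℝ => ψ q.2) := ψ.contDiff.comp contDiff_snd
    exact h1.smul (hf.comp (contDiff_fst.prodMk contDiff_snd.neg))
  have hk : LocallyIntegrable k volume := by
    apply Integrable.locallyIntegrable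
    rw [integrable_indicator_iff measurableSet_Ioc]
    exact integrableOn_const (by simp)
  have h := contDiffOn_convolution_right_with_param_comp (n := ⊤) (μ := volume) (𝕜 := ℝ)
    (ContinuousLinearMap.lsmul ℝ ℝ : ℝ →L[ℝ] F →L[ℝ] F) (s := (univ : Set V))
    (v := fun _ => (0 : ℝ))
    contDiffOn_const (f := k) (g := g) (k := Metric.closedBall 0 3) isOpen_univ
    (isCompact_closedBall _ _) (fun p x _ hx => by
      have : ψ x = 0 := ψ.zero_of_le_dist (by
        simp only [Metric.mem_closedBall, not_le] at hx; exact hx.le)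
      simp [g, this]) hk hg.contDiffOn
  rw [contDiffOn_univ] at h
  convert h using 2 with x
  rw [convolution_def, intervalIntegral.integral_of_le zero_le_one]
  rw [← integral_indicator measurableSet_Ioc]
  congr 1
  funext t
  by_cases ht : t ∈ Ioc (0 : ℝ) 1
  · have : ψ (-t) = 1 := ψ.one_of_mem_closedBall (by
      simp only [Metric.mem_closedBall, dist_zero_right, norm_neg, Real.norm_eq_abs, ψ]
      rw [abs_of_pos ht.1]; linarith [ht.2])
    simp [k, g, ht, this, -mem_Ioc]
  · simp [k, g, ht, -mem_Ioc]

/-- The `i`-th standard basis vector. -/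
def basisVec (i : Fin m) : EuclideanSpace ℝ (Fin m) := EuclideanSpace.single i (1 : ℝ)

/-- The point `x` with its `i`-th coordinate replaced by `t`. -/
def slide (i : Fin m) (x : EuclideanSpace ℝ (Fin m)) (t : ℝ) : EuclideanSpace ℝ (Fin m) :=
  x + (t - x i) • basisVec i

theorem slide_apply (i j : Fin m) (x : EuclideanSpace ℝ (Fin m)) (t : ℝ) :
    slide i x t j = if j = i then t else x j := by
  by_cases h : j = i
  · subst h; simp [slide, basisVec]
  · simp [slide, basisVec, h]

theorem slide_self (i : Fin m) (x : EuclideanSpace ℝ (Fin m)) : slide i x (x i) = x := by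
  simp [slide]

theorem slide_slide (i : Fin m) (x : EuclideanSpace ℝ (Fin m)) (s t : ℝ) :
    slide i (slide i x s) t = slide i x t := by
  ext j; simp only [slide_apply]; split_ifs <;> rfl

theorem add_smul_basisVec (i : Fin m) (x : EuclideanSpace ℝ (Fin m)) (t : ℝ) :
    x + t • basisVec i = slide i x (x i + t) := by
  simp [slide]

theorem contDiff_coord (i : Fin m) :
    ContDiff ℝ ∞ (fun x : EuclideanSpace ℝ (Fin m) => x i) :=
  (EuclideanSpace.proj i : EuclideanSpace ℝ (Fin m) →L[ℝ] ℝ).contDiff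

theorem contDiff_slide (i : Fin m) :
    ContDiff ℝ ∞ (fun q : EuclideanSpace ℝ (Fin m) × ℝ => slide i q.1 q.2) := by
  unfold slide
  have h : ContDiff ℝ ∞ (fun q : EuclideanSpace ℝ (Fin m) × ℝ => q.1 i) :=
    (contDiff_coord i).comp contDiff_fst
  exact contDiff_fst.add ((contDiff_snd.sub h).smul contDiff_const)

/-- The integral of `k` over the line through `x` in direction `i`, between the coordinates
`a` and `c`. -/
def lineInt (i : Fin m) (a c : ℝ) (k : EuclideanSpace ℝ (Fin m) → F)
    (x : EuclideanSpace ℝ (Fin m)) : F :=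
  ∫ t in a..c, k (slide i x t)

/-- The primitive of `k` in direction `i` that vanishes at the coordinate `a`. -/
def prim (i : Fin m) (a : ℝ) (k : EuclideanSpace ℝ (Fin m) → F)
    (x : EuclideanSpace ℝ (Fin m)) : F :=
  ∫ t in a..x i, k (slide i x t)

theorem lineInt_slide (i : Fin m) (a c : ℝ) (k : EuclideanSpace ℝ (Fin m) → F)
    (x : EuclideanSpace ℝ (Fin m)) (t : ℝ) :
    lineInt i a c k (slide i x t) = lineInt i a c k x := by
  simp [lineInt, slide_slide]

/-- Integrals between smoothly varying limits are reduced to integrals over `[0, 1]`. -/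
theorem contDiff_integral_slide (i : Fin m) {k : EuclideanSpace ℝ (Fin m) → F}
    (hk : ContDiff ℝ ∞ k) (a : ℝ) {c : EuclideanSpace ℝ (Fin m) → ℝ} (hc : ContDiff ℝ ∞ c) :
    ContDiff ℝ ∞ fun x => ∫ t in a..c x, k (slide i x t) := by
  have h : (fun x => ∫ t in a..c x, k (slide i x t)) =
      fun x => (c x - a) • ∫ s in (0 : ℝ)..1, k (slide i x (a + (c x - a) * s)) := by
    funext x
    rw [intervalIntegral.smul_integral_comp_add_mul (fun t => k (slide i x t))]
    simp
  rw [h]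
  refine (hc.sub contDiff_const).smul (contDiff_integral_param
    (f := fun q : EuclideanSpace ℝ (Fin m) × ℝ => k (slide i q.1 (a + (c q.1 - a) * q.2))) ?_)
  have h1 : ContDiff ℝ ∞ fun q : EuclideanSpace ℝ (Fin m) × ℝ => a + (c q.1 - a) * q.2 :=
    contDiff_const.add (((hc.comp contDiff_fst).sub contDiff_const).mul contDiff_snd)
  exact hk.comp ((contDiff_slide i).comp (contDiff_fst.prodMk h1))

theorem contDiff_lineInt (i : Fin m) {k : EuclideanSpace ℝ (Fin m) → F}
    (hk : ContDiff ℝ ∞ k) (a c : ℝ) : ContDiff ℝ ∞ (lineInt i a c k) :=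
  contDiff_integral_slide i hk a contDiff_const

theorem contDiff_prim (i : Fin m) {k : EuclideanSpace ℝ (Fin m) → F}
    (hk : ContDiff ℝ ∞ k) (a : ℝ) : ContDiff ℝ ∞ (prim i a k) :=
  contDiff_integral_slide i hk a (contDiff_coord i)

theorem fderiv_prim [CompleteSpace F] (i : Fin m) {k : EuclideanSpace ℝ (Fin m) → F}
    (hk : ContDiff ℝ ∞ k) (a : ℝ) (x : EuclideanSpace ℝ (Fin m)) :
    fderiv ℝ (prim i a k) x (basisVec i) = k x := by
  have hc : Continuous fun t : ℝ => k (slide i x t) :=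
    hk.continuous.comp ((contDiff_slide i).continuous.comp (by fun_prop : Continuous
      fun t : ℝ => (x, t)))
  have h1 : HasDerivAt (fun t : ℝ => prim i a k (x + t • basisVec i)) (k x) 0 := by
    have h2 : (fun t : ℝ => prim i a k (x + t • basisVec i)) =
        fun t : ℝ => (fun s => ∫ u in a..s, k (slide i x u)) (x i + t) := by
      funext t
      simp only [prim, add_smul_basisVec, slide_slide]
      simp [slide_apply]
    rw [h2]
    have h3 := (hc.integral_hasStrictDerivAt a (x i)).hasDerivAt
    rw [slide_self] at h3
    rw [← add_zero (x i)] at h3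
    exact h3.comp_const_add (x i) 0
  have h4 : HasFDerivAt (prim i a k) (fderiv ℝ (prim i a k) x) (x + (0 : ℝ) • basisVec i) := by
    simpa using ((contDiff_prim i hk a).differentiable (by simp) x).hasFDerivAt
  have h5 : HasDerivAt (fun t : ℝ => x + t • basisVec i) (basisVec i) 0 := by
    simpa using ((hasDerivAt_id (0 : ℝ)).smul_const (basisVec i)).const_add x
  have h6 := HasFDerivAt.comp_hasDerivAt (f := fun t : ℝ => x + t • basisVec i) (0 : ℝ) h4 h5
  exact h6.unique h1

/-! ### Functionals on test functions of a box -/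

/-- `v` is a test function on the open box `∏ (α j, γ j)`: it is smooth and vanishes outside of
a smaller closed box. -/
def BoxTest (α γ : Fin m → ℝ) (v : EuclideanSpace ℝ (Fin m) → F) : Prop :=
  ContDiff ℝ ∞ v ∧ ∃ α' γ' : Fin m → ℝ, (∀ j, α j < α' j ∧ γ' j < γ j) ∧
    ∀ x, v x ≠ 0 → ∀ j, α' j ≤ x j ∧ x j ≤ γ' j

/-- The open box `∏ (α j, γ j)`. -/
def box (α γ : Fin m → ℝ) : Set (EuclideanSpace ℝ (Fin m)) := {x | ∀ j, α j < x j ∧ x j < γ j}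

theorem isOpen_box (α γ : Fin m → ℝ) : IsOpen (box α γ) := by
  simp only [box, ofPred_forall]
  exact isOpen_iInter_of_finite fun j =>
    (isOpen_lt continuous_const (contDiff_coord j).continuous).inter
      (isOpen_lt (contDiff_coord j).continuous continuous_const)

theorem convex_box (α γ : Fin m → ℝ) : Convex ℝ (box α γ) := by
  intro x hx y hy s t hs ht hst j
  have h1 := hx j
  have h2 := hy j
  have e : (s • x + t • y) j = s * x j + t * y j := by simp
  rw [e]
  obtain rfl : t = 1 - s := by linarith
  rcases hs.eq_or_lt with rfl | hs
  · simpa using h2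
  · constructor <;> nlinarith

theorem isClosed_closedBox (α γ : Fin m → ℝ) :
    IsClosed {x : EuclideanSpace ℝ (Fin m) | ∀ j, α j ≤ x j ∧ x j ≤ γ j} := by
  simp only [ofPred_forall]
  exact isClosed_iInter fun j =>
    (isClosed_le continuous_const (contDiff_coord j).continuous).inter
      (isClosed_le (contDiff_coord j).continuous continuous_const)

namespace BoxTest

variable {α γ : Fin m → ℝ} {v w : EuclideanSpace ℝ (Fin m) → F}

theorem tsupport_subset (hv : BoxTest α γ v) : tsupport v ⊆ box α γ := by
  obtain ⟨-, α', γ', h, hs⟩ := hv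
  refine (closure_minimal (fun x hx => hs x hx) (isClosed_closedBox α' γ')).trans ?_
  exact fun x hx j => ⟨(h j).1.trans_le (hx j).1, (hx j).2.trans_lt (h j).2⟩

theorem mem_box (hv : BoxTest α γ v) {x : EuclideanSpace ℝ (Fin m)} (hx : v x ≠ 0) :
    x ∈ box α γ := hv.tsupport_subset (subset_tsupport _ hx)

theorem hasCompactSupport (hv : BoxTest α γ v) : HasCompactSupport v := by
  obtain ⟨-, α', γ', h, hs⟩ := hv
  have hK : IsCompact ((EuclideanSpace.equiv (Fin m) ℝ).symm ''
      (Set.pi univ fun j => Icc (α' j) (γ' j))) :=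
    (isCompact_univ_pi fun j => isCompact_Icc).image
      (EuclideanSpace.equiv (Fin m) ℝ).symm.continuous
  refine HasCompactSupport.intro hK fun x hx => ?_
  by_contra hne
  exact hx ⟨EuclideanSpace.equiv (Fin m) ℝ x, fun j _ => hs x hne j, by simp⟩

/-- A smooth function that vanishes where a test function vanishes is a test function. -/
theorem of_imp {F' : Type*} [NormedAddCommGroup F'] [NormedSpace ℝ F']
    (hv : BoxTest α γ v) {u : EuclideanSpace ℝ (Fin m) → F'} (hu : ContDiff ℝ ∞ u)
    (h : ∀ x, u x ≠ 0 → x ∈ tsupport v) : BoxTest α γ u := by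
  obtain ⟨-, α', γ', hα, hs⟩ := hv
  refine ⟨hu, α', γ', hα, fun x hx => ?_⟩
  exact closure_minimal (fun x hx => hs x hx) (isClosed_closedBox α' γ') (h x hx)

theorem mono {α₁ γ₁ : Fin m → ℝ} (hv : BoxTest α γ v) (hα : ∀ j, α₁ j ≤ α j)
    (hγ : ∀ j, γ j ≤ γ₁ j) : BoxTest α₁ γ₁ v := by
  obtain ⟨h0, α', γ', h, hs⟩ := hv
  exact ⟨h0, α', γ', fun j => ⟨(hα j).trans_lt (h j).1, (h j).2.trans_le (hγ j)⟩, hs⟩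

theorem fderiv_apply (hv : BoxTest α γ v) (e : EuclideanSpace ℝ (Fin m)) :
    BoxTest α γ (fun x => fderiv ℝ v x e) := by
  refine hv.of_imp ((hv.1.fderiv_right (m := ∞) (by simp)).clm_apply contDiff_const) fun x hx => ?_
  by_contra hn
  rw [notMem_tsupport_iff_eventuallyEq] at hn
  apply hx
  rw [hn.fderiv_eq]
  simp

theorem sub (hv : BoxTest α γ v) (hw : BoxTest α γ w) : BoxTest α γ (fun x => v x - w x) := by
  obtain ⟨h0, α', γ', h, hs⟩ := hv
  obtain ⟨h0', α'', γ'', h', hs'⟩ := hw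
  refine ⟨h0.sub h0', fun j => min (α' j) (α'' j), fun j => max (γ' j) (γ'' j), fun j =>
    ⟨lt_min (h j).1 (h' j).1, max_lt (h j).2 (h' j).2⟩, fun x hx j => ?_⟩
  by_cases h1 : v x = 0
  · have h2 : w x ≠ 0 := by rintro h2; exact hx (by simp [h1, h2])
    exact ⟨min_le_of_right_le (hs' x h2 j).1, le_max_of_le_right (hs' x h2 j).2⟩
  · exact ⟨min_le_of_left_le (hs x h1 j).1, le_max_of_le_left (hs x h1 j).2⟩

theorem mul {A : Type*} [NormedRing A] [NormedAlgebra ℝ A] {v : EuclideanSpace ℝ (Fin m) → A}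
    (hv : BoxTest α γ v) {g : EuclideanSpace ℝ (Fin m) → A}
    (hg : ContDiffOn ℝ ∞ g (box α γ)) : BoxTest α γ (fun x => g x * v x) := by
  refine hv.of_imp ?_ fun x hx => subset_tsupport _ (right_ne_zero_of_mul hx)
  rw [contDiff_iff_contDiffAt]
  intro x
  by_cases hx : x ∈ tsupport v
  · exact ((hg.contDiffAt ((isOpen_box α γ).mem_nhds (hv.tsupport_subset hx))).mul
      hv.1.contDiffAt)
  · rw [notMem_tsupport_iff_eventuallyEq] at hx
    have : (fun x => g x * v x) =ᶠ[𝓝 x] fun _ => 0 := hx.mono fun y hy => by simp [hy]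
    exact contDiffAt_const.congr_of_eventuallyEq this

theorem ofReal {v : EuclideanSpace ℝ (Fin m) → ℝ} (hv : BoxTest α γ v) :
    BoxTest α γ (fun x => (v x : ℂ)) :=
  hv.of_imp (Complex.ofRealCLM.contDiff.comp hv.1) fun x hx =>
    subset_tsupport _ (by simpa using hx)

end BoxTest

/-- There are one-variable bump functions of integral one in every interval. -/
theorem exists_bump_integral_one {a c : ℝ} (h : a < c) :
    ∃ θ : ℝ → ℝ, ContDiff ℝ ∞ θ ∧ (∀ t, 0 ≤ θ t) ∧
      (∃ a' c', a < a' ∧ c' < c ∧ ∀ t, θ t ≠ 0 → a' ≤ t ∧ t ≤ c') ∧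
      (∀ α γ, α ≤ a → c ≤ γ → ∫ t in α..γ, θ t = 1) ∧ 0 < θ ((a + c) / 2) := by
  let ψ : ContDiffBump ((a + c) / 2) := ⟨(c - a) / 8, (c - a) / 4, by linarith, by linarith⟩
  have hs : ∀ t, ψ.normed volume t ≠ 0 → a + (c - a) / 4 ≤ t ∧ t ≤ c - (c - a) / 4 := by
    intro t ht
    have : t ∈ Function.support (ψ.normed volume) := ht
    rw [ψ.support_normed_eq, Real.ball_eq_Ioo] at this
    simp only [ψ, mem_Ioo] at this
    constructor <;> linarith [this.1, this.2]
  refine ⟨ψ.normed volume, ψ.contDiff_normed, ψ.nonneg_normed, ⟨_, _, by linarith, by linarith, hs⟩,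
    fun α γ hα hγ => ?_, ?_⟩
  · rw [intervalIntegral.integral_of_le (by linarith),
      setIntegral_eq_integral_of_forall_compl_eq_zero, ψ.integral_normed]
    intro t ht
    by_contra hne
    have := hs t hne
    exact ht ⟨by linarith, by linarith⟩
  · refine lt_of_le_of_ne (ψ.nonneg_normed _) (Ne.symm ?_)
    have : (a + c) / 2 ∈ Function.support (ψ.normed volume) := by
      rw [ψ.support_normed_eq]; exact Metric.mem_ball_self ψ.rOut_pos
    exact this

/-- Up to a derivative in direction `i`, a test function `h` may be replaced by the product of
a fixed bump function of the coordinate `x i` and the integral of `h` over the lines in this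
direction. -/
theorem exists_fderiv_eq_sub [CompleteSpace F] {α γ : Fin m → ℝ} (i : Fin m) {θ : ℝ → ℝ}
    (hθ : ContDiff ℝ ∞ θ)
    (hθs : ∃ a' c', α i < a' ∧ c' < γ i ∧ ∀ t, θ t ≠ 0 → a' ≤ t ∧ t ≤ c')
    (hθi : ∫ t in α i..γ i, θ t = 1) {h : EuclideanSpace ℝ (Fin m) → F} (hh : BoxTest α γ h) :
    ∃ w : EuclideanSpace ℝ (Fin m) → F, BoxTest α γ w ∧
      ∀ x, fderiv ℝ w x (basisVec i) = h x - θ (x i) • lineInt i (α i) (γ i) h x := by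
  obtain ⟨h0, α', γ', hα, hs⟩ := hh
  obtain ⟨a', c', ha', hc', hθs⟩ := hθs
  set k : EuclideanSpace ℝ (Fin m) → F := fun x => h x - θ (x i) • lineInt i (α i) (γ i) h x
  have hk : ContDiff ℝ ∞ k :=
    h0.sub ((hθ.comp (contDiff_coord i)).smul (contDiff_lineInt i h0 _ _))
  have hline : ∀ x, Continuous fun t : ℝ => (slide i x t) := fun x =>
    ((contDiff_slide i).continuous.comp (by fun_prop : Continuous fun t : ℝ => (x, t)))
  refine ⟨prim i (α i) k, ⟨contDiff_prim i hk _, Function.update α' i (min (α' i) a'),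
    Function.update γ' i (max (γ' i) c'), fun j => ?_, fun x hx j => ?_⟩,
    fun x => fderiv_prim i hk _ x⟩
  · by_cases hj : j = i
    · subst hj; simp [hα, ha', hc']
    · simp [hj, hα]
  · by_contra hcon
    apply hx
    -- the integrand at height `t` in the line through `x`
    have hkt : ∀ t, k (slide i x t) = h (slide i x t) - θ t • lineInt i (α i) (γ i) h x := by
      intro t
      simp only [k, lineInt_slide, slide_apply, if_true]
    by_cases hj : j = i
    · subst hj
      simp only [Function.update_self, not_and_or, not_le] at hcon
      have hz : ∀ t, (t < min (α' j) a' ∨ max (γ' j) c' < t) → k (slide j x t) = 0 := by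
        intro t ht
        have h1 : h (slide j x t) = 0 := by
          by_contra hne
          have := hs _ hne j
          simp only [slide_apply, if_true] at this
          rcases ht with ht | ht
          · linarith [min_le_left (α' j) a']
          · linarith [le_max_left (γ' j) c']
        have h2 : θ t = 0 := by
          by_contra hne
          have := hθs _ hne
          rcases ht with ht | ht
          · linarith [min_le_right (α' j) a']
          · linarith [le_max_right (γ' j) c']
        rw [hkt, h1, h2]; simp
      rcases hcon with hlt | hgt
      · unfold prim
        rw [intervalIntegral.integral_congr (g := fun _ => (0 : F))]
        · simp
        · intro t ht
          refine hz t (Or.inl ?_)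
          have h3 := ht.2
          exact h3.trans_lt (max_lt (lt_min (hα j).1 ha') hlt)
      · unfold prim
        have hint : ∀ a c, IntervalIntegrable (fun t => k (slide j x t)) volume a c := fun a c =>
          (hk.continuous.comp (hline x)).intervalIntegrable a c
        rw [← intervalIntegral.integral_add_adjacent_intervals (hint _ (γ j)) (hint _ _)]
        have e1 : ∫ t in γ j..x j, k (slide j x t) = 0 := by
          rw [intervalIntegral.integral_congr (g := fun _ => (0 : F))]
          · simp
          · intro t ht
            refine hz t (Or.inr ?_)
            have h3 := ht.1
            exact (lt_min (max_lt (hα j).2 hc') hgt).trans_le h3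
        rw [e1, add_zero]
        simp only [hkt]
        have i1 : Continuous fun t => h (slide j x t) := h0.continuous.comp (hline x)
        have i2 : Continuous fun t => θ t • lineInt j (α j) (γ j) h x :=
          hθ.continuous.smul continuous_const
        rw [intervalIntegral.integral_sub (i1.intervalIntegrable _ _)
          (i2.intervalIntegrable _ _), intervalIntegral.integral_smul_const, hθi, one_smul]
        exact sub_self _
    · simp only [Function.update_of_ne hj] at hcon
      have hz : ∀ t, h (slide i x t) = 0 := by
        intro t
        by_contra hne
        apply hcon
        simpa [slide_apply, hj] using hs _ hne j
      simp [prim, hkt, hz, lineInt]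

end Euclid

/-! ### Functionals that satisfy a first order system -/

section System

open Set MeasureTheory

variable {m : ℕ}

/-- The functional `L` satisfies `L (∂ v) = L (b v)` on the box `∏ (α j, γ j)`, where `∂` is the
derivative in direction `i`. -/
def Solves (α γ : Fin m → ℝ) (L : (EuclideanSpace ℝ (Fin m) → ℂ) →ₗ[ℂ] ℂ) (i : Fin m)
    (b : EuclideanSpace ℝ (Fin m) → ℝ) : Prop :=
  ∀ v, BoxTest α γ v → L (fun x => fderiv ℝ v x (basisVec i) - b x * v x) = 0

/-- An integrating factor turns the equation `L (∂ v) = L (b v)` into `N (∂ v) = 0` for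
`N v = L (E v)`. -/
theorem Solves.mul_fderiv {α γ : Fin m → ℝ} {L : (EuclideanSpace ℝ (Fin m) → ℂ) →ₗ[ℂ] ℂ}
    {i : Fin m} {b : EuclideanSpace ℝ (Fin m) → ℝ} (hL : Solves α γ L i b)
    {E : EuclideanSpace ℝ (Fin m) → ℝ} (hE : ContDiffOn ℝ ∞ E (box α γ))
    (hEb : ∀ x ∈ box α γ, fderiv ℝ E x (basisVec i) = b x * E x)
    {v : EuclideanSpace ℝ (Fin m) → ℂ} (hv : BoxTest α γ v) :
    L (fun x => E x * fderiv ℝ v x (basisVec i)) = 0 := by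
  have hE' : ContDiffOn ℝ ∞ (fun x => (E x : ℂ)) (box α γ) :=
    Complex.ofRealCLM.contDiff.comp_contDiffOn hE
  rw [← hL _ (hv.mul hE')]
  congr 1
  funext x
  by_cases hx : x ∈ box α γ
  · have hd : HasFDerivAt (fun x => (E x : ℂ)) (Complex.ofRealCLM.comp (fderiv ℝ E x)) x :=
      Complex.ofRealCLM.hasFDerivAt.comp x
        (((hE.contDiffAt ((isOpen_box α γ).mem_nhds hx)).differentiableAt (by simp)).hasFDerivAt)
    have hd' := hd.fun_mul (hv.1.differentiable (by simp) x).hasFDerivAt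
    rw [hd'.fderiv]
    simp [hEb x hx]
    ring
  · have h0 : v =ᶠ[𝓝 x] fun _ => 0 := notMem_tsupport_iff_eventuallyEq.1
      fun h => hx (hv.tsupport_subset h)
    have h1 : (fun x => E x * v x) =ᶠ[𝓝 x] fun _ => 0 := h0.mono fun y hy => by simp [hy]
    rw [h0.fderiv_eq, h1.fderiv_eq, h0.eq_of_nhds]
    simp

/-- Unique continuation in one coordinate direction. -/
theorem Solves.eq_zero_of_update {α γ : Fin m → ℝ} {L : (EuclideanSpace ℝ (Fin m) → ℂ) →ₗ[ℂ] ℂ}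
    {i : Fin m} {b : EuclideanSpace ℝ (Fin m) → ℝ} (hb : ContDiff ℝ ∞ b) (hL : Solves α γ L i b)
    {a c : ℝ} (ha : α i ≤ a) (hac : a < c) (hc : c ≤ γ i)
    (h0 : ∀ v, BoxTest (Function.update α i a) (Function.update γ i c) v → L v = 0)
    {v : EuclideanSpace ℝ (Fin m) → ℂ} (hv : BoxTest α γ v) : L v = 0 := by
  obtain ⟨θ, hθ, -, ⟨a', c', ha', hc', hs⟩, hθi, -⟩ := exists_bump_integral_one hac
  set E : EuclideanSpace ℝ (Fin m) → ℝ := fun x => Real.exp (prim i 0 b x)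
  have hE : ContDiff ℝ ∞ E := Real.contDiff_exp.comp (contDiff_prim i hb 0)
  have hE0 : ∀ x, (E x : ℂ) ≠ 0 := fun x => by
    exact_mod_cast (Real.exp_pos _).ne'
  have hEb : ∀ x, fderiv ℝ E x (basisVec i) = b x * E x := fun x => by
    have h1 := ((contDiff_prim i hb 0).differentiable (by simp) x).hasFDerivAt.exp
    rw [h1.fderiv]
    simp [fderiv_prim i hb, E, mul_comm]
  have hEi : ContDiff ℝ ∞ (fun x => (E x : ℂ)⁻¹) := by
    have : (fun x => (E x : ℂ)⁻¹) = fun x => ((Real.exp (-prim i 0 b x) : ℝ) : ℂ) := by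
      funext x; simp only [E]; rw [Real.exp_neg, Complex.ofReal_inv]
    rw [this]
    exact Complex.ofRealCLM.contDiff.comp (Real.contDiff_exp.comp (contDiff_prim i hb 0).neg)
  set h : EuclideanSpace ℝ (Fin m) → ℂ := fun x => (E x : ℂ)⁻¹ * v x
  have hh : BoxTest α γ h := hv.mul hEi.contDiffOn
  obtain ⟨w, hw, hwd⟩ := exists_fderiv_eq_sub i hθ
    ⟨a', c', ha.trans_lt ha', hc'.trans_le hc, hs⟩ (hθi _ _ ha hc) hh
  have e1 := hL.mul_fderiv hE.contDiffOn (fun x _ => hEb x) hw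
  set u : EuclideanSpace ℝ (Fin m) → ℂ := fun x => E x * (θ (x i) • lineInt i (α i) (γ i) h x)
  have e2 : L u = 0 := by
    refine h0 _ ?_
    obtain ⟨-, α', γ', hα, hs'⟩ := hh
    refine ⟨(Complex.ofRealCLM.contDiff.comp hE).mul ((hθ.comp (contDiff_coord i)).smul
      (contDiff_lineInt i (hv.mul hEi.contDiffOn).1 _ _)), Function.update α' i a',
      Function.update γ' i c', fun j => ?_, fun x hx j => ?_⟩
    · by_cases hj : j = i
      · subst hj; simp [ha', hc']
      · simp [hj, hα]
    · by_cases hj : j = i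
      · subst hj
        simp only [Function.update_self]
        refine hs _ fun hne => hx ?_
        simp [u, hne]
      · simp only [Function.update_of_ne hj]
        by_contra hcon
        apply hx
        have : ∀ t, h (slide i x t) = 0 := by
          intro t
          by_contra hne
          apply hcon
          simpa [slide_apply, hj] using hs' _ hne j
        simp [u, lineInt, this]
  have e3 : v = (fun x => E x * fderiv ℝ w x (basisVec i)) + u := by
    funext x
    simp only [Pi.add_apply, hwd, u, h]
    field_simp [hE0 x]
    ring
  rw [e3, map_add, e1, e2, add_zero]

/-- Unique continuation: a solution that vanishes on a smaller box vanishes. -/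
theorem eq_zero_of_subbox {α γ : Fin m → ℝ} {L : (EuclideanSpace ℝ (Fin m) → ℂ) →ₗ[ℂ] ℂ}
    {b : Fin m → EuclideanSpace ℝ (Fin m) → ℝ} (hb : ∀ i, ContDiff ℝ ∞ (b i))
    (hL : ∀ i, Solves α γ L i (b i)) {a c : Fin m → ℝ} (ha : ∀ i, α i ≤ a i)
    (hac : ∀ i, a i < c i) (hc : ∀ i, c i ≤ γ i) (h0 : ∀ v, BoxTest a c v → L v = 0)
    {v : EuclideanSpace ℝ (Fin m) → ℂ} (hv : BoxTest α γ v) : L v = 0 := by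
  classical
  have key : ∀ s : Finset (Fin m), ∀ v, BoxTest (s.piecewise α a) (s.piecewise γ c) v →
      L v = 0 := by
    intro s
    induction s using Finset.induction_on with
    | empty => intro v hv; exact h0 v (by simpa using hv)
    | insert i s hi ih =>
      intro v hv
      have hLi : Solves ((insert i s).piecewise α a) ((insert i s).piecewise γ c) L i (b i) := by
        intro u hu
        refine hL i u (hu.mono (fun j => ?_) fun j => ?_)
        · by_cases hj : j ∈ insert i s
          · simp [Finset.piecewise, hj]
          · simp only [Finset.piecewise, hj, if_false]; exact ha j
        · by_cases hj : j ∈ insert i s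
          · simp [Finset.piecewise, hj]
          · simp only [Finset.piecewise, hj, if_false]; exact hc j
      refine hLi.eq_zero_of_update (hb i) (a := a i) (c := c i) ?_ (hac i) ?_ ?_ hv
      · simp [Finset.piecewise, ha]
      · simp [Finset.piecewise, hc]
      · intro u hu
        have h1 : ∀ f g : Fin m → ℝ, Function.update ((insert i s).piecewise f g) i (g i) =
            s.piecewise f g := by
          intro f g
          rw [Finset.piecewise_insert, Function.update_idem]
          funext j
          by_cases hj : j = i
          · subst hj; simp [Finset.piecewise, hi]
          · simp [hj]
        rw [h1, h1] at hu
        exact ih u hu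
  exact key Finset.univ v (by simpa using hv)

/-- The compatibility condition of the first order system, applied to the functional. -/
theorem Solves.cross {α γ : Fin m → ℝ} {L : (EuclideanSpace ℝ (Fin m) → ℂ) →ₗ[ℂ] ℂ}
    {i j : Fin m} {b b' : EuclideanSpace ℝ (Fin m) → ℝ} (hb : ContDiff ℝ ∞ b)
    (hb' : ContDiff ℝ ∞ b') (hL : Solves α γ L i b) (hL' : Solves α γ L j b')
    {u : EuclideanSpace ℝ (Fin m) → ℂ} (hu : BoxTest α γ u) :
    L (fun x => ((fderiv ℝ b x (basisVec j) - fderiv ℝ b' x (basisVec i) : ℝ) : ℂ) * u x) = 0 := by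
  have hc : ContDiff ℝ ∞ (fun x => (b x : ℂ)) := Complex.ofRealCLM.contDiff.comp hb
  have hc' : ContDiff ℝ ∞ (fun x => (b' x : ℂ)) := Complex.ofRealCLM.contDiff.comp hb'
  have h1 := hL _ ((hu.fderiv_apply (basisVec j)).sub (hu.mul hc'.contDiffOn))
  have h2 := hL' _ ((hu.fderiv_apply (basisVec i)).sub (hu.mul hc.contDiffOn))
  have h3 := sub_eq_zero.2 (h1.trans h2.symm)
  rw [← map_sub] at h3
  rw [← h3]
  congr 1
  funext x
  have hmul : ∀ {g : EuclideanSpace ℝ (Fin m) → ℝ}, ContDiff ℝ ∞ g →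
      HasFDerivAt (fun x => (g x : ℂ) * u x)
        ((g x : ℂ) • fderiv ℝ u x + u x • Complex.ofRealCLM.comp (fderiv ℝ g x)) x := by
    intro g hg
    have hd : HasFDerivAt (fun x => (g x : ℂ)) (Complex.ofRealCLM.comp (fderiv ℝ g x)) x :=
      Complex.ofRealCLM.hasFDerivAt.comp x (hg.differentiable (by simp) x).hasFDerivAt
    exact hd.fun_mul (hu.1.differentiable (by simp) x).hasFDerivAt
  have hdd : ∀ e, HasFDerivAt (fun x => fderiv ℝ u x e)
      ((fderiv ℝ (fderiv ℝ u) x).flip e) x := by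
    intro e
    have h4 : HasFDerivAt (fderiv ℝ u) (fderiv ℝ (fderiv ℝ u) x) x :=
      ((hu.1.fderiv_right (m := ∞) (by simp)).differentiable (by simp) x).hasFDerivAt
    simpa using h4.clm_apply (hasFDerivAt_const e x)
  have hsymm : fderiv ℝ (fderiv ℝ u) x (basisVec i) (basisVec j) =
      fderiv ℝ (fderiv ℝ u) x (basisVec j) (basisVec i) :=
    ((hu.1.contDiffAt (x := x)).isSymmSndFDerivAt
      (by rw [minSmoothness_of_isRCLikeNormedField]
          exact WithTop.coe_le_coe.2 (le_top : (2 : ℕ∞) ≤ ⊤))) _ _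
  simp only [Pi.sub_apply]
  rw [((hdd (basisVec j)).fun_sub (hmul hb')).fderiv,
    ((hdd (basisVec i)).fun_sub (hmul hb)).fderiv]
  simp [hsymm]
  ring

theorem exists_box_subset {U : Set (EuclideanSpace ℝ (Fin m))} (hU : IsOpen U)
    {y : EuclideanSpace ℝ (Fin m)} (hy : y ∈ U) : ∃ α γ : Fin m → ℝ, y ∈ box α γ ∧ box α γ ⊆ U := by
  have hV := (EuclideanSpace.equiv (Fin m) ℝ).symm.continuous.isOpen_preimage _ hU
  obtain ⟨ε, hε, hs⟩ := Metric.isOpen_iff.1 hV (EuclideanSpace.equiv (Fin m) ℝ y)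
    (by simpa using hy)
  refine ⟨fun l => y l - ε, fun l => y l + ε, fun l => ⟨by linarith, by linarith⟩, fun x hx => ?_⟩
  have h1 : (EuclideanSpace.equiv (Fin m) ℝ x) ∈
      Metric.ball (EuclideanSpace.equiv (Fin m) ℝ y) ε := by
    rw [Metric.mem_ball, dist_pi_lt_iff hε]
    intro l
    have := hx l
    rw [Real.dist_eq, abs_lt]
    exact ⟨by simpa using (by linarith [this.1] : -ε < x l - y l),
      by simpa using (by linarith [this.2] : x l - y l < ε)⟩
  exact hs h1

/-- A nonvanishing solution exists only if the system is integrable. -/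
theorem eq_zero_or_closed {α γ : Fin m → ℝ} {L : (EuclideanSpace ℝ (Fin m) → ℂ) →ₗ[ℂ] ℂ}
    {b : Fin m → EuclideanSpace ℝ (Fin m) → ℝ} (hb : ∀ i, ContDiff ℝ ∞ (b i))
    (hL : ∀ i, Solves α γ L i (b i)) :
    (∀ v, BoxTest α γ v → L v = 0) ∨
      ∀ x ∈ box α γ, ∀ i j, fderiv ℝ (b i) x (basisVec j) = fderiv ℝ (b j) x (basisVec i) := by
  by_contra! hcon
  obtain ⟨⟨v, hv, hne⟩, y, hy, i, j, hij⟩ := hcon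
  set κ : EuclideanSpace ℝ (Fin m) → ℝ :=
    fun x => fderiv ℝ (b i) x (basisVec j) - fderiv ℝ (b j) x (basisVec i)
  have hκ : ContDiff ℝ ∞ κ :=
    (((hb i).fderiv_right (m := ∞) (by simp)).clm_apply contDiff_const).sub
      (((hb j).fderiv_right (m := ∞) (by simp)).clm_apply contDiff_const)
  have hκc : ContDiff ℝ ∞ (fun x => (κ x : ℂ)) := Complex.ofRealCLM.contDiff.comp hκ
  -- a box around `y` in which the obstruction does not vanish
  obtain ⟨a₀, c₀, hy₀, hbox₀⟩ := exists_box_subset (isOpen_ne_fun hκ.continuous continuous_const)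
    (show y ∈ {x | κ x ≠ 0} by simpa [κ, sub_eq_zero] using hij)
  set a : Fin m → ℝ := fun l => max (α l) (a₀ l)
  set c : Fin m → ℝ := fun l => min (γ l) (c₀ l)
  have hbox : ∀ x ∈ box a c, κ x ≠ 0 := by
    exact fun x hx => hbox₀ fun l =>
      ⟨(le_max_right _ _).trans_lt (hx l).1, (hx l).2.trans_le (min_le_right _ _)⟩
  refine hne (eq_zero_of_subbox hb hL (a := a) (c := c) (fun l => le_max_left _ _) (fun l => ?_)
    (fun l => min_le_left _ _) (fun u hu => ?_) hv)
  · have h1 := hy l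
    have h2 := hy₀ l
    simp only [a, c, max_lt_iff, lt_min_iff]
    exact ⟨⟨by linarith, by linarith⟩, by linarith, by linarith⟩
  · have hinv : ContDiffOn ℝ ∞ (fun x => (κ x : ℂ)⁻¹) (box a c) :=
      hκc.contDiffOn.inv fun x hx => by exact_mod_cast hbox x hx
    have hw := hu.mul hinv
    have h1 := (hL i).cross (hb i) (hb j) (hL j)
      (hw.mono (fun l => le_max_left _ _) (fun l => min_le_left _ _))
    rw [← h1]
    congr 1
    funext x
    by_cases hx : u x = 0
    · simp [hx]
    · have : (κ x : ℂ) ≠ 0 := by exact_mod_cast hbox x (hu.mem_box hx)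
      change u x = (κ x : ℂ) * ((κ x : ℂ)⁻¹ * u x)
      field_simp

/-- The Poincaré lemma for the system of coefficients `b`. -/
theorem exists_potential {α γ : Fin m → ℝ} {b : Fin m → EuclideanSpace ℝ (Fin m) → ℝ}
    (hb : ∀ i, ContDiffOn ℝ ∞ (b i) (box α γ))
    (hc : ∀ x ∈ box α γ, ∀ i j, fderiv ℝ (b i) x (basisVec j) = fderiv ℝ (b j) x (basisVec i)) :
    ∃ φ : EuclideanSpace ℝ (Fin m) → ℝ, ContDiffOn ℝ ∞ φ (box α γ) ∧
      ∀ x ∈ box α γ, ∀ i, fderiv ℝ φ x (basisVec i) = b i x := by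
  set η : EuclideanSpace ℝ (Fin m) → EuclideanSpace ℝ (Fin m) →L[ℝ] ℝ :=
    fun x => ∑ i, b i x • (EuclideanSpace.proj i : EuclideanSpace ℝ (Fin m) →L[ℝ] ℝ)
  have hη : ContDiffOn ℝ ∞ η (box α γ) :=
    ContDiffOn.sum fun i _ => (hb i).smul contDiffOn_const
  have hdiff : ∀ {F : Type} [NormedAddCommGroup F] [NormedSpace ℝ F]
      {f : EuclideanSpace ℝ (Fin m) → F}, ContDiffOn ℝ ∞ f (box α γ) →
      ∀ x ∈ box α γ, DifferentiableAt ℝ f x := fun hf x hx =>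
    (hf.contDiffAt ((isOpen_box α γ).mem_nhds hx)).differentiableAt (by simp)
  have hηi : ∀ x i, η x (basisVec i) = b i x := by
    intro x i
    simp [η, basisVec]
  have hd : ∀ x ∈ box α γ, ∀ e e', fderiv ℝ η x e e' = ∑ i, fderiv ℝ (b i) x e * e' i := by
    intro x hx e e'
    have h1 := (hdiff hη x hx).hasFDerivAt.clm_apply (hasFDerivAt_const e' x)
    have h2 : HasFDerivAt (fun y => ∑ i, b i y * e' i) (∑ i, e' i • fderiv ℝ (b i) x) x :=
      HasFDerivAt.fun_sum fun i _ => (hdiff (hb i) x hx).hasFDerivAt.mul_const _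
    have h3 : (fun y => η y e') = fun y => ∑ i, b i y * e' i := by
      funext y; simp [η]
    rw [h3] at h1
    have h4 := congrArg (fun l => l e) (h1.unique h2)
    simpa [mul_comm] using h4
  have hexp : ∀ (l : EuclideanSpace ℝ (Fin m) →L[ℝ] ℝ) (e : EuclideanSpace ℝ (Fin m)),
      l e = ∑ j, e j * l (basisVec j) := by
    intro l e
    conv_lhs => rw [← (EuclideanSpace.basisFun (Fin m) ℝ).sum_repr e]
    simp [basisVec]
  obtain ⟨φ, hφ⟩ := (convex_box α γ).exists_forall_hasFDerivAt_of_fderiv_symmetric (𝕜 := ℝ)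
    (isOpen_box α γ) (fun x hx => (hdiff hη x hx).differentiableWithinAt) (by
      intro x hx e e'
      rw [hd x hx, hd x hx]
      simp only [hexp (fderiv ℝ (b _) x) e, hexp (fderiv ℝ (b _) x) e', Finset.sum_mul]
      rw [Finset.sum_comm]
      refine Finset.sum_congr rfl fun i _ => Finset.sum_congr rfl fun j _ => ?_
      rw [hc x hx j i]
      ring)
  refine ⟨φ, ?_, fun x hx i => by rw [(hφ x hx).fderiv, hηi]⟩
  rw [contDiffOn_infty_iff_fderiv_of_isOpen (isOpen_box α γ)]
  refine ⟨fun x hx => (hφ x hx).differentiableAt.differentiableWithinAt, ?_⟩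
  exact hη.congr fun x hx => (hφ x hx).fderiv

/-- A functional that annihilates the derivatives of test functions on a box has a definite value
on nonnegative test functions, up to positive factors: all coordinates are integrated out one
after the other. -/
theorem exists_pos_mul_of_fderiv_eq_zero {α γ : Fin m → ℝ}
    {N : (EuclideanSpace ℝ (Fin m) → ℂ) →ₗ[ℂ] ℂ}
    (hN : ∀ i v, BoxTest α γ v → N (fun x => fderiv ℝ v x (basisVec i)) = 0) :
    ∃ z : ℂ, ∀ h : EuclideanSpace ℝ (Fin m) → ℝ, BoxTest α γ h → (∀ x, 0 ≤ h x) → (∃ x, 0 < h x) →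
      ∃ κ : ℝ, 0 < κ ∧ N (fun x => (h x : ℂ)) = κ * z := by
  classical
  by_cases hne : ∀ i, α i < γ i
  swap
  · push Not at hne
    obtain ⟨i, hi⟩ := hne
    refine ⟨0, fun h hh _ ⟨x, hx⟩ => ?_⟩
    have := hh.mem_box hx.ne' i
    linarith
  choose θ hθ hθ0 hθs hθi hθp using fun i => exists_bump_integral_one (hne i)
  refine ⟨N (fun x => ((∏ i, θ i (x i) : ℝ) : ℂ)), fun h hh hpos hex => ?_⟩
  have key : ∀ s : Finset (Fin m), ∃ k : EuclideanSpace ℝ (Fin m) → ℝ, ContDiff ℝ ∞ k ∧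
      (∀ x y, (∀ i, i ∉ s → x i = y i) → k x = k y) ∧
      BoxTest α γ (fun x => (∏ i ∈ s, θ i (x i)) * k x) ∧ (∀ x, 0 ≤ k x) ∧
      (∃ x, 0 < (∏ i ∈ s, θ i (x i)) * k x) ∧
      N (fun x => (h x : ℂ)) = N (fun x => (((∏ i ∈ s, θ i (x i)) * k x : ℝ) : ℂ)) := by
    intro s
    induction s using Finset.induction_on with
    | empty =>
      refine ⟨h, hh.1, fun x y hxy => ?_, by simpa using hh, hpos, by simpa using hex, by simp⟩
      have : x = y := by ext i; exact hxy i (by simp)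
      rw [this]
    | insert j s hj ih =>
      obtain ⟨k, hk, hinv, hG, hk0, ⟨x₀, hx₀⟩, hNk⟩ := ih
      set G : EuclideanSpace ℝ (Fin m) → ℝ := fun x => (∏ i ∈ s, θ i (x i)) * k x
      set k' : EuclideanSpace ℝ (Fin m) → ℝ := lineInt j (α j) (γ j) k
      have hθslide : ∀ x t, ∏ i ∈ s, θ i (slide j x t i) = ∏ i ∈ s, θ i (x i) := by
        intro x t
        refine Finset.prod_congr rfl fun i hi => ?_
        rw [slide_apply, if_neg (by rintro rfl; exact hj hi)]
      have hlineG : ∀ x, lineInt j (α j) (γ j) G x = (∏ i ∈ s, θ i (x i)) * k' x := by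
        intro x
        simp only [lineInt, G, k', hθslide, intervalIntegral.integral_const_mul]
      obtain ⟨w, hw, hwd⟩ := exists_fderiv_eq_sub j (hθ j) (hθs j) (hθi j _ _ le_rfl le_rfl) hG
      have hG' : (fun x => (∏ i ∈ insert j s, θ i (x i)) * k' x) =
          fun x => G x - fderiv ℝ w x (basisVec j) := by
        funext x
        rw [hwd, hlineG, Finset.prod_insert hj]
        simp only [smul_eq_mul]; ring
      have hcont : ∀ x, Continuous fun t => k (slide j x t) := fun x =>
        hk.continuous.comp ((contDiff_slide j).continuous.comp
          (by fun_prop : Continuous fun t : ℝ => (x, t)))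
      refine ⟨k', contDiff_lineInt j hk _ _, fun x y hxy => ?_, ?_, fun x => ?_, ?_, ?_⟩
      · simp only [k', lineInt]
        congr 1
        funext t
        refine hinv _ _ fun i hi => ?_
        simp only [slide_apply]
        split_ifs with h1
        · rfl
        · exact hxy i (by simp [h1, hi])
      · rw [hG']
        exact hG.sub (hw.fderiv_apply _)
      · exact intervalIntegral.integral_nonneg (hne j).le fun t _ => hk0 _
      · -- `k` is positive at `x₀`, a point of the box; move its `j`-th coordinate to where `θ j`
        -- is positive
        refine ⟨slide j x₀ ((α j + γ j) / 2), ?_⟩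
        have hmem := hG.mem_box hx₀.ne'
        have hprod : 0 ≤ ∏ i ∈ s, θ i (x₀ i) := Finset.prod_nonneg fun i _ => hθ0 i _
        have hkpos : 0 < k x₀ := lt_of_le_of_ne (hk0 _) fun h1 => by
          rw [← h1] at hx₀; simp at hx₀
        have hprod' : 0 < ∏ i ∈ s, θ i (x₀ i) := lt_of_le_of_ne hprod fun h1 => by
          rw [← h1] at hx₀; simp at hx₀
        rw [Finset.prod_insert hj, hθslide, slide_apply, if_pos rfl]
        refine mul_pos (mul_pos (hθp j) hprod') ?_
        simp only [k', lineInt_slide]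
        refine intervalIntegral.integral_pos (hne j) (hcont _).continuousOn (fun t _ => hk0 _)
          ⟨x₀ j, ⟨(hmem j).1.le, (hmem j).2.le⟩, by rwa [slide_self]⟩
      · rw [hNk]
        have h1 := hN j _ hw.ofReal
        have h2 : (fun x => fderiv ℝ (fun x => (w x : ℂ)) x (basisVec j)) =
            fun x => ((fderiv ℝ w x (basisVec j) : ℝ) : ℂ) := by
          funext x
          have hd : HasFDerivAt (fun x => (w x : ℂ)) (Complex.ofRealCLM.comp (fderiv ℝ w x)) x :=
            Complex.ofRealCLM.hasFDerivAt.comp x (hw.1.differentiable (by simp) x).hasFDerivAt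
          rw [hd.fderiv]; simp
        rw [h2] at h1
        rw [← sub_eq_zero, ← map_sub, ← h1]
        congr 1
        funext x
        have := congrFun hG' x
        simp only at this
        simp only [Pi.sub_apply, this, G]
        push_cast; ring
  obtain ⟨k, -, hinv, -, -, ⟨x₀, hx₀⟩, hNk⟩ := key Finset.univ
  have hconst : ∀ x, k x = k x₀ := fun x => hinv _ _ fun i hi => absurd (Finset.mem_univ i) hi
  refine ⟨k x₀, ?_, ?_⟩
  · have hprod : 0 ≤ ∏ i, θ i (x₀ i) := Finset.prod_nonneg fun i _ => hθ0 i _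
    by_contra hcon
    nlinarith
  · rw [hNk, ← smul_eq_mul, ← map_smul]
    congr 1
    funext x
    simp [hconst x, mul_comm]

/-- A solution of a first order system with real coefficients has a definite phase on the
nonnegative test functions of a box. -/
theorem exists_pos_mul_of_solves {α γ : Fin m → ℝ}
    {L : (EuclideanSpace ℝ (Fin m) → ℂ) →ₗ[ℂ] ℂ}
    {b : Fin m → EuclideanSpace ℝ (Fin m) → ℝ} (hb : ∀ i, ContDiff ℝ ∞ (b i))
    (hL : ∀ i, Solves α γ L i (b i)) :
    ∃ z : ℂ, ∀ h : EuclideanSpace ℝ (Fin m) → ℝ, BoxTest α γ h → (∀ x, 0 ≤ h x) → (∃ x, 0 < h x) →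
      ∃ κ : ℝ, 0 < κ ∧ L (fun x => (h x : ℂ)) = κ * z := by
  rcases eq_zero_or_closed hb hL with h0 | hc
  · exact ⟨0, fun h hh _ _ => ⟨1, one_pos, by rw [h0 _ hh.ofReal]; simp⟩⟩
  obtain ⟨φ, hφ, hφb⟩ := exists_potential (fun i => (hb i).contDiffOn) hc
  set E : EuclideanSpace ℝ (Fin m) → ℝ := fun x => Real.exp (φ x)
  have hE : ContDiffOn ℝ ∞ E (box α γ) := Real.contDiff_exp.comp_contDiffOn hφ
  have hE' : ContDiffOn ℝ ∞ (fun x => Real.exp (-φ x)) (box α γ) :=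
    Real.contDiff_exp.comp_contDiffOn hφ.neg
  have hEb : ∀ i, ∀ x ∈ box α γ, fderiv ℝ E x (basisVec i) = b i x * E x := by
    intro i x hx
    have h1 := ((hφ.contDiffAt ((isOpen_box α γ).mem_nhds hx)).differentiableAt
      (by simp)).hasFDerivAt.exp
    rw [h1.fderiv]
    simp [hφb x hx, E, mul_comm]
  let N : (EuclideanSpace ℝ (Fin m) → ℂ) →ₗ[ℂ] ℂ :=
    L ∘ₗ LinearMap.mulLeft ℂ (fun x => (E x : ℂ))
  obtain ⟨z, hz⟩ := exists_pos_mul_of_fderiv_eq_zero (α := α) (γ := γ) (N := N)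
    fun i v hv => (hL i).mul_fderiv hE (hEb i) hv
  refine ⟨z, fun h hh h0 ⟨x, hx⟩ => ?_⟩
  obtain ⟨κ, hκ, e⟩ := hz (fun x => Real.exp (-φ x) * h x) (hh.mul hE')
    (fun x => mul_nonneg (Real.exp_pos _).le (h0 x)) ⟨x, mul_pos (Real.exp_pos _) hx⟩
  refine ⟨κ, hκ, e ▸ ?_⟩
  simp only [N, LinearMap.comp_apply, LinearMap.mulLeft_apply]
  congr 1
  funext y
  simp only [Pi.mul_apply, E]
  rw [← Complex.ofReal_mul, ← mul_assoc, ← Real.exp_add]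
  simp

end System

/-! ### Functions and forms in charts -/

section Charts

open Set

variable {m : ℕ} {M : Type*} [TopologicalSpace M] [ChartedSpace (EuclideanSpace ℝ (Fin m)) M]

theorem tsupport_indicator_comp_subset {X Y F : Type*} [TopologicalSpace X] [TopologicalSpace Y]
    [T2Space X] [NormedAddCommGroup F] (e : OpenPartialHomeomorph X Y) {v : Y → F}
    (hc : HasCompactSupport v) (hs : tsupport v ⊆ e.target) :
    tsupport (e.source.indicator (v ∘ e)) ⊆ e.symm '' tsupport v := by
  refine closure_minimal (fun x hx => ?_)
    (IsCompact.image_of_continuousOn hc (e.continuousOn_symm.mono hs)).isClosed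
  have hxs : x ∈ e.source := by
    by_contra h; exact hx (indicator_of_notMem h _)
  refine ⟨e x, subset_tsupport _ ?_, e.left_inv hxs⟩
  simpa [hxs] using hx

theorem hasCompactSupport_indicator_comp {X Y F : Type*} [TopologicalSpace X] [TopologicalSpace Y]
    [T2Space X] [NormedAddCommGroup F] (e : OpenPartialHomeomorph X Y) {v : Y → F}
    (hc : HasCompactSupport v) (hs : tsupport v ⊆ e.target) :
    HasCompactSupport (e.source.indicator (v ∘ e)) :=
  HasCompactSupport.of_support_subset_isCompact
    (IsCompact.image_of_continuousOn hc (e.continuousOn_symm.mono hs))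
    ((subset_tsupport _).trans (tsupport_indicator_comp_subset e hc hs))

/-- A function on the target of the chart at `p`, transported to `M` and extended by zero. -/
def push (p : M) : (EuclideanSpace ℝ (Fin m) → ℂ) →ₗ[ℂ] (M → ℂ) where
  toFun v := (chartAt (EuclideanSpace ℝ (Fin m)) p).source.indicator
    (v ∘ chartAt (EuclideanSpace ℝ (Fin m)) p)
  map_add' v w := by
    funext q
    by_cases hq : q ∈ (chartAt (EuclideanSpace ℝ (Fin m)) p).source <;> simp [hq]
  map_smul' c v := by
    funext q
    by_cases hq : q ∈ (chartAt (EuclideanSpace ℝ (Fin m)) p).source <;> simp [hq]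

theorem push_apply (p : M) (v : EuclideanSpace ℝ (Fin m) → ℂ) :
    push p v = (chartAt (EuclideanSpace ℝ (Fin m)) p).source.indicator
      (v ∘ chartAt (EuclideanSpace ℝ (Fin m)) p) := rfl

variable (m) in
/-- The derivative of the inverse of the chart at `p`: it maps coordinate vectors to tangent
vectors. -/
def chartVec (p : M) (y : EuclideanSpace ℝ (Fin m)) : EuclideanSpace ℝ (Fin m) →L[ℝ]
    TangentSpace (𝓡 m) ((chartAt (EuclideanSpace ℝ (Fin m)) p).symm y) :=
  mfderiv (𝓡 m) (𝓡 m) (chartAt (EuclideanSpace ℝ (Fin m)) p).symm y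

theorem localForm_apply {n : ℕ} (η : ∀ q : M, TangentSpace (𝓡 m) q [⋀^Fin n]→L[ℝ] ℝ) (p : M)
    (y : EuclideanSpace ℝ (Fin m)) (w : Fin n → EuclideanSpace ℝ (Fin m)) :
    localForm η p y w = η ((chartAt (EuclideanSpace ℝ (Fin m)) p).symm y)
      (fun i => chartVec m p y (w i)) := rfl

namespace SymplecticForm

variable (Ω : SymplecticForm m M)

theorem poisson_ofReal (f : M → ℂ) (g : M → ℝ) (q : M) :
    Ω.poisson f (fun x => (g x : ℂ)) q = dComplex f q (Ω.hamVec g q) := by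
  have h0 : Ω.hamVec (fun _ => (0 : ℝ)) q = 0 := by
    have : dReal (m := m) (fun _ : M => (0 : ℝ)) q = 0 := mfderiv_const
    rw [hamVec, this]
    exact map_zero _
  simp only [poisson, Complex.ofReal_re, Complex.ofReal_im, h0, map_zero, mul_zero, add_zero]

theorem poisson_mul_left {f g : M → ℂ} (hf : ContMDiff (𝓡 m) 𝓘(ℝ, ℂ) ∞ f)
    (hg : ContMDiff (𝓡 m) 𝓘(ℝ, ℂ) ∞ g) (h : M → ℂ) (q : M) :
    Ω.poisson (fun x => f x * g x) h q = f q * Ω.poisson g h q + g q * Ω.poisson f h q := by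
  have h1 := (hf.mdifferentiableAt (by simp) (x := q)).hasMFDerivAt.mul
    (hg.mdifferentiableAt (by simp) (x := q)).hasMFDerivAt
  have h2 : ∀ v, dComplex (fun x => f x * g x) q v = f q * dComplex g q v + g q * dComplex f q v :=
    fun v => congrArg (fun l => l v) h1.mfderiv
  simp only [poisson, h2]
  ring

end SymplecticForm

variable [IsManifold (𝓡 m) ∞ M]

theorem contMDiff_push [T2Space M] (p : M) {v : EuclideanSpace ℝ (Fin m) → ℂ} (hv : ContDiff ℝ ∞ v)
    (hc : HasCompactSupport v) (hs : tsupport v ⊆ (chartAt (EuclideanSpace ℝ (Fin m)) p).target) :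
    ContMDiff (𝓡 m) 𝓘(ℝ, ℂ) ∞ (push p v) := by
  refine contMDiff_of_tsupport fun q hq => ?_
  obtain ⟨y, hy, rfl⟩ := tsupport_indicator_comp_subset _ hc hs hq
  have hys := (chartAt (EuclideanSpace ℝ (Fin m)) p).map_target (hs hy)
  have h1 : ContMDiffAt (𝓡 m) 𝓘(ℝ, EuclideanSpace ℝ (Fin m)) ∞
      (chartAt (EuclideanSpace ℝ (Fin m)) p) _ :=
    (contMDiffOn_chart (I := 𝓡 m) (n := ∞) (x := p)).contMDiffAt
      ((chartAt (EuclideanSpace ℝ (Fin m)) p).open_source.mem_nhds hys)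
  refine (hv.contDiffAt.contMDiffAt.comp _ h1).congr_of_eventuallyEq ?_
  filter_upwards [(chartAt (EuclideanSpace ℝ (Fin m)) p).open_source.mem_nhds hys] with q hq
  simp [push_apply, hq]

/-- A function with compact support in the domain of a chart is smooth in the coordinates, when
extended by zero. -/
theorem contDiff_pull {F : Type*} [NormedAddCommGroup F] [NormedSpace ℝ F] (p : M) {f : M → F}
    (hf : ContMDiff (𝓡 m) 𝓘(ℝ, F) ∞ f) (hc : HasCompactSupport f)
    (hs : tsupport f ⊆ (chartAt (EuclideanSpace ℝ (Fin m)) p).source) :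
    ContDiff ℝ ∞ ((chartAt (EuclideanSpace ℝ (Fin m)) p).target.indicator
      (f ∘ (chartAt (EuclideanSpace ℝ (Fin m)) p).symm)) := by
  rw [← contMDiff_iff_contDiff]
  refine contMDiff_of_tsupport fun y hy => ?_
  obtain ⟨q, hq, rfl⟩ :=
    tsupport_indicator_comp_subset (chartAt (EuclideanSpace ℝ (Fin m)) p).symm hc hs hy
  have hys : (chartAt (EuclideanSpace ℝ (Fin m)) p) q ∈ _ :=
    (chartAt (EuclideanSpace ℝ (Fin m)) p).map_source (hs hq)
  have h1 : ContMDiffAt 𝓘(ℝ, EuclideanSpace ℝ (Fin m)) (𝓡 m) ∞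
      (chartAt (EuclideanSpace ℝ (Fin m)) p).symm
      ((chartAt (EuclideanSpace ℝ (Fin m)) p) q) :=
    (contMDiffOn_chart_symm (I := 𝓡 m) (n := ∞) (x := p)).contMDiffAt
      ((chartAt (EuclideanSpace ℝ (Fin m)) p).open_target.mem_nhds hys)
  refine (hf.contMDiffAt.comp _ h1).congr_of_eventuallyEq ?_
  filter_upwards [(chartAt (EuclideanSpace ℝ (Fin m)) p).open_target.mem_nhds hys] with q hq
  simp [hq]

theorem chartVec_surjective (p : M) {y : EuclideanSpace ℝ (Fin m)}
    (hy : y ∈ (chartAt (EuclideanSpace ℝ (Fin m)) p).target) :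
    Function.Surjective (chartVec m p y) :=
  haveI : IsManifold (𝓡 m) 1 M := IsManifold.of_le (n := ∞) (by simp)
  (mdifferentiable_chart (I := 𝓡 m) p).symm.mfderiv_surjective hy

theorem mdifferentiableAt_chart_symm (p : M) {y : EuclideanSpace ℝ (Fin m)}
    (hy : y ∈ (chartAt (EuclideanSpace ℝ (Fin m)) p).target) :
    MDifferentiableAt (𝓡 m) (𝓡 m) (chartAt (EuclideanSpace ℝ (Fin m)) p).symm y :=
  haveI : IsManifold (𝓡 m) 1 M := IsManifold.of_le (n := ∞) (by simp)
  (mdifferentiable_chart (I := 𝓡 m) p).mdifferentiableAt_symm hy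

theorem dComplex_chartVec (p : M) {y : EuclideanSpace ℝ (Fin m)}
    (hy : y ∈ (chartAt (EuclideanSpace ℝ (Fin m)) p).target) {f : M → ℂ}
    (hf : MDifferentiableAt (𝓡 m) 𝓘(ℝ, ℂ) f ((chartAt (EuclideanSpace ℝ (Fin m)) p).symm y))
    (e : EuclideanSpace ℝ (Fin m)) :
    SymplecticForm.dComplex f _ (chartVec m p y e) =
      fderiv ℝ (f ∘ (chartAt (EuclideanSpace ℝ (Fin m)) p).symm) y e := by
  have h := mfderiv_comp y hf (mdifferentiableAt_chart_symm p hy)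
  rw [← mfderiv_eq_fderiv]
  exact (congrArg (fun l => l e) h).symm

theorem dReal_chartVec (p : M) {y : EuclideanSpace ℝ (Fin m)}
    (hy : y ∈ (chartAt (EuclideanSpace ℝ (Fin m)) p).target) {f : M → ℝ}
    (hf : MDifferentiableAt (𝓡 m) 𝓘(ℝ, ℝ) f ((chartAt (EuclideanSpace ℝ (Fin m)) p).symm y))
    (e : EuclideanSpace ℝ (Fin m)) :
    SymplecticForm.dReal f _ (chartVec m p y e) =
      fderiv ℝ (f ∘ (chartAt (EuclideanSpace ℝ (Fin m)) p).symm) y e := by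
  have h := mfderiv_comp y hf (mdifferentiableAt_chart_symm p hy)
  rw [← mfderiv_eq_fderiv]
  exact (congrArg (fun l => l e) h).symm

/-- The smooth coefficients of a form in the coordinates of a chart. -/
theorem contMDiffOn_localForm {n : ℕ} {η : ∀ q : M, TangentSpace (𝓡 m) q [⋀^Fin n]→L[ℝ] ℝ}
    (hη : IsSmoothForm η) (p : M) (w : Fin n → EuclideanSpace ℝ (Fin m)) :
    ContMDiffOn (𝓡 m) 𝓘(ℝ, ℝ) ∞
      (fun q => localForm η p (chartAt (EuclideanSpace ℝ (Fin m)) p q) w)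
      (chartAt (EuclideanSpace ℝ (Fin m)) p).source := by
  have h1 : ContDiffOn ℝ ∞ (fun y => localForm η p y w)
      (chartAt (EuclideanSpace ℝ (Fin m)) p).target := by
    have h2 : ContDiffOn ℝ ∞ (localForm η p) (chartAt (EuclideanSpace ℝ (Fin m)) p).target := by
      simpa [mfld_simps] using! hη p
    exact (ContinuousAlternatingMap.apply ℝ (EuclideanSpace ℝ (Fin m)) ℝ w).contDiff.comp_contDiffOn
      h2
  exact h1.contMDiffOn.comp (contMDiffOn_chart (I := 𝓡 m) (n := ∞) (x := p))
    (chartAt (EuclideanSpace ℝ (Fin m)) p).mapsTo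

namespace SymplecticForm

variable (Ω : SymplecticForm m M)

/-- Coordinate vector fields are combinations of the Hamiltonian vector fields of the coordinate
functions; the coefficients are those of the symplectic form. -/
theorem chartVec_basisVec (p : M) {y : EuclideanSpace ℝ (Fin m)}
    (hy : y ∈ (chartAt (EuclideanSpace ℝ (Fin m)) p).target) {g : Fin m → M → ℝ}
    (hg : ∀ j, g j =ᶠ[𝓝 ((chartAt (EuclideanSpace ℝ (Fin m)) p).symm y)]
      fun q => chartAt (EuclideanSpace ℝ (Fin m)) p q j) (i : Fin m) :
    chartVec m p y (basisVec i) = ∑ j, localForm Ω.form p y ![basisVec i, basisVec j] •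
      Ω.hamVec (g j) ((chartAt (EuclideanSpace ℝ (Fin m)) p).symm y) := by
  set φ := chartAt (EuclideanSpace ℝ (Fin m)) p
  have hform : ∀ e e', localForm Ω.form p y ![e, e'] =
      Ω.flat (φ.symm y) (chartVec m p y e) (chartVec m p y e') := by
    intro e e'
    rw [localForm_apply, flat_apply]
    congr 1
    funext l
    fin_cases l <;> rfl
  have hd : ∀ j e, dReal (g j) (φ.symm y) (chartVec m p y e) = e j := by
    intro j e
    have hev : (g j ∘ φ.symm) =ᶠ[𝓝 y] fun x => x j := by
      have h1 : Filter.Tendsto φ.symm (𝓝 y) (𝓝 (φ.symm y)) := φ.continuousAt_symm hy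
      filter_upwards [h1.eventually (hg j), φ.open_target.mem_nhds hy] with x hx hxt
      simp only [Function.comp_apply, hx, φ.right_inv hxt]
    have hdiff : MDifferentiableAt (𝓡 m) 𝓘(ℝ, ℝ) (g j) (φ.symm y) := by
      have h2 : MDifferentiableAt (𝓡 m) (𝓡 m) φ (φ.symm y) :=
        haveI : IsManifold (𝓡 m) 1 M := IsManifold.of_le (n := ∞) (by simp)
        (mdifferentiable_chart (I := 𝓡 m) p).mdifferentiableAt (φ.map_target hy)
      have h3 : MDifferentiableAt (𝓡 m) 𝓘(ℝ, ℝ) (fun x : EuclideanSpace ℝ (Fin m) => x j)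
          (φ (φ.symm y)) :=
        ((contDiff_coord j).differentiable (by simp)).differentiableAt.mdifferentiableAt
      exact (h3.comp _ h2).congr_of_eventuallyEq (hg j)
    rw [dReal_chartVec p hy hdiff, hev.fderiv_eq]
    exact congrArg (fun l => l e)
      (EuclideanSpace.proj j : EuclideanSpace ℝ (Fin m) →L[ℝ] ℝ).fderiv
  apply Ω.flat_injective
  ext w
  obtain ⟨e, rfl⟩ := chartVec_surjective p hy w
  have he : e = ∑ j, e j • basisVec j := by
    conv_lhs => rw [← (EuclideanSpace.basisFun (Fin m) ℝ).sum_repr e]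
    simp [basisVec]
  rw [map_sum, LinearMap.sum_apply]
  simp only [map_smul, LinearMap.smul_apply, flat_apply, form_hamVec, hd]
  rw [← flat_apply]
  conv_lhs => rw [he]
  simp only [map_sum, map_smul, hform, smul_eq_mul, mul_comm]

end SymplecticForm

end Charts

/-! ### Functionals that annihilate twisted Poisson brackets -/

section Bracket

open Set

variable {m : ℕ}

theorem BoxTest.of_isCompact {F : Type*} [NormedAddCommGroup F] [NormedSpace ℝ F]
    {α γ : Fin m → ℝ} {v : EuclideanSpace ℝ (Fin m) → F}
    (hv : ContDiff ℝ ∞ v) {K : Set (EuclideanSpace ℝ (Fin m))} (hK : IsCompact K)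
    (hKb : K ⊆ box α γ) (hs : Function.support v ⊆ K) : BoxTest α γ v := by
  rcases K.eq_empty_or_nonempty with rfl | hne
  · refine ⟨hv, fun j => α j + 1, fun j => γ j - 1, fun j => ⟨by linarith, by linarith⟩,
      fun x hx => ?_⟩
    exact absurd (hs hx) (notMem_empty _)
  choose a ha ha' using fun j : Fin m =>
    hK.exists_isMinOn hne (contDiff_coord j).continuous.continuousOn
  choose c hc hc' using fun j : Fin m =>
    hK.exists_isMaxOn hne (contDiff_coord j).continuous.continuousOn
  exact ⟨hv, fun j => a j j, fun j => c j j, fun j => ⟨(hKb (ha j) j).1, (hKb (hc j) j).2⟩,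
    fun x hx j => ⟨ha' j (hs hx), hc' j (hs hx)⟩⟩

variable {M : Type*} [TopologicalSpace M] [ChartedSpace (EuclideanSpace ℝ (Fin m)) M]

namespace StarProduct

variable {Ω : SymplecticForm m M} (S : StarProduct Ω)

/-- The Poisson bracket as a smooth function. Its smoothness is read off from the commutator
of the star product. -/
def br (f g : Smooth m M) : Smooth m M := (-Complex.I) • (S.B 1 f g - S.B 1 g f)

theorem br_apply (f g : Smooth m M) (q : M) : (S.br f g).1 q = Ω.poisson f.1 g.1 q := by
  have h := S.first f g q
  change -Complex.I * (S.B 1 f g - S.B 1 g f).1 q = _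
  rw [h, ← mul_assoc]
  simp

theorem br_antisymm (f g : Smooth m M) : S.br f g = -S.br g f := by
  simp only [br]
  module

theorem br_mul_ofReal (f g : Smooth m M) {h : M → ℝ} (hh : ContMDiff (𝓡 m) 𝓘(ℝ, ℝ) ∞ h) :
    S.br (f * g) (ofReal h hh) = f * S.br g (ofReal h hh) + g * S.br f (ofReal h hh) := by
  ext q
  have h1 := Ω.poisson_mul_left f.2 g.2 (ofReal h hh).1 q
  change (S.br (f * g) (ofReal h hh)).1 q = f.1 q * (S.br g (ofReal h hh)).1 q +
    g.1 q * (S.br f (ofReal h hh)).1 q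
  rw [br_apply, br_apply, br_apply, ← h1]
  rfl

end StarProduct

theorem dComplex_ofReal {f : M → ℝ} (hf : ContMDiff (𝓡 m) 𝓘(ℝ, ℝ) ∞ f) (q : M)
    (v : TangentSpace (𝓡 m) q) :
    SymplecticForm.dComplex (fun x => (f x : ℂ)) q v = (SymplecticForm.dReal f q v : ℂ) := by
  have h1 : HasMFDerivAt (𝓡 m) 𝓘(ℝ, ℝ) f q (mfderiv (𝓡 m) 𝓘(ℝ, ℝ) f q) :=
    (hf.mdifferentiableAt (by simp)).hasMFDerivAt
  have h2 : HasMFDerivAt 𝓘(ℝ, ℝ) 𝓘(ℝ, ℂ) (fun x : ℝ => (x : ℂ)) (f q) Complex.ofRealCLM :=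
    Complex.ofRealCLM.hasFDerivAt.hasMFDerivAt
  exact congrArg (fun l => l v) (h2.comp q h1).mfderiv

theorem StarProduct.br_ofReal_im {Ω : SymplecticForm m M} (S : StarProduct Ω) {f g : M → ℝ}
    (hf : ContMDiff (𝓡 m) 𝓘(ℝ, ℝ) ∞ f) (hg : ContMDiff (𝓡 m) 𝓘(ℝ, ℝ) ∞ g) (q : M) :
    ((S.br (ofReal f hf) (ofReal g hg)).1 q).im = 0 := by
  rw [S.br_apply]
  change (Ω.poisson (fun x => (f x : ℂ)) (fun x => (g x : ℂ)) q).im = 0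
  rw [Ω.poisson_ofReal, dComplex_ofReal hf, Complex.ofReal_im]

theorem dComplex_eq_zero {f : M → ℂ} {q : M} (h : q ∉ tsupport f) :
    SymplecticForm.dComplex (m := m) f q = 0 := by
  rw [notMem_tsupport_iff_eventuallyEq] at h
  have h1 : mfderiv (𝓡 m) 𝓘(ℝ, ℂ) f q = mfderiv (𝓡 m) 𝓘(ℝ, ℂ) (fun _ : M => (0 : ℂ)) q :=
    h.mfderiv_eq
  exact h1.trans mfderiv_const

variable [IsManifold (𝓡 m) ∞ M] [T2Space M]

/-- In a chart, a functional that annihilates all `{f, g} + g D f` solves a first order system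
with real coefficients, and so has a definite phase on nonnegative functions. -/
theorem StarProduct.exists_phase_near {Ω : SymplecticForm m M} (S : StarProduct Ω)
    {D : Smooth m M → Smooth m M}
    (hD : ∀ (f : M → ℝ) (hf : ContMDiff (𝓡 m) 𝓘(ℝ, ℝ) ∞ f) (q : M),
      ((D (ofReal f hf)).1 q).im = 0)
    {ν : (M → ℂ) →ₗ[ℂ] ℂ}
    (hν : ∀ f g : Smooth m M, HasCompactSupport f.1 → HasCompactSupport g.1 →
      ν (S.br f g + g * D f).1 = 0) (p : M) :
    ∃ U : Set M, IsOpen U ∧ p ∈ U ∧ ∃ z : ℂ, ∀ h : M → ℝ, ContMDiff (𝓡 m) 𝓘(ℝ, ℝ) ∞ h →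
      HasCompactSupport h → tsupport h ⊆ U → (∀ q, 0 ≤ h q) → (∃ q, 0 < h q) →
      ∃ κ : ℝ, 0 < κ ∧ ν (fun q => (h q : ℂ)) = κ * z := by
  classical
  set φ := chartAt (EuclideanSpace ℝ (Fin m)) p with hφ
  have hpφ : p ∈ φ.source := mem_chart_source _ p
  obtain ⟨χ, -⟩ := (SmoothBumpFunction.nhds_basis_tsupport (I := 𝓡 m) p).ex_mem
  -- near `p` the cutoff `χ` equals one
  obtain ⟨U₀, hU₀, hU₀o, hpU₀⟩ := mem_nhds_iff.1 χ.eventuallyEq_one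
  obtain ⟨α, γ, hpb, hbox⟩ := exists_box_subset (φ.symm.isOpen_inter_preimage hU₀o)
    (y := φ p) ⟨φ.map_source hpφ, by simpa [φ.left_inv hpφ] using hpU₀⟩
  have hboxt : box α γ ⊆ φ.target := fun y hy => (hbox hy).1
  let cut : (M → ℝ) → M → ℝ := fun k q => χ q * k q
  have hcut : ∀ {k}, ContMDiffOn (𝓡 m) 𝓘(ℝ, ℝ) ∞ k φ.source →
      ContMDiff (𝓡 m) 𝓘(ℝ, ℝ) ∞ (cut k) := fun hk => χ.contMDiff_smul hk
  have hcutc : ∀ {k} (hk : ContMDiff (𝓡 m) 𝓘(ℝ, ℝ) ∞ (cut k)),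
      HasCompactSupport (ofReal (cut k) hk).1 := fun {k} hk =>
    χ.hasCompactSupport.mono' fun q hq => subset_tsupport _ fun h0 => hq (by
      change ((χ q * k q : ℝ) : ℂ) = 0
      rw [h0]; simp)
  have hcut1 : ∀ k, ∀ y ∈ box α γ, cut k =ᶠ[𝓝 (φ.symm y)] k := by
    intro k y hy
    filter_upwards [hU₀o.mem_nhds (hbox hy).2] with q hq
    have : χ q = 1 := hU₀ hq
    simp [cut, this]
  have hφs : ContMDiffOn (𝓡 m) 𝓘(ℝ, EuclideanSpace ℝ (Fin m)) ∞ φ φ.source :=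
    contMDiffOn_chart (I := 𝓡 m) (n := ∞) (x := p)
  have hg0 : ∀ j : Fin m, ContMDiffOn (𝓡 m) 𝓘(ℝ, ℝ) ∞ (fun q => φ q j) φ.source := fun j =>
    (contDiff_coord j).contMDiff.comp_contMDiffOn hφs
  let A : Fin m → Fin m → M → ℝ := fun i j q => localForm Ω.form p (φ q) ![basisVec i, basisVec j]
  have ha0 : ∀ i j, ContMDiffOn (𝓡 m) 𝓘(ℝ, ℝ) ∞ (A i j) φ.source := fun i j =>
    contMDiffOn_localForm Ω.smooth p ![basisVec i, basisVec j]
  set g : Fin m → Smooth m M := fun j => ofReal _ (hcut (hg0 j))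
  set a : Fin m → Fin m → Smooth m M := fun i j => ofReal _ (hcut (ha0 i j))
  set B : Fin m → Smooth m M := fun i => ∑ j, (a i j * D (g j) - S.br (a i j) (g j))
  have coe_sum : ∀ (f : Fin m → Smooth m M) (q : M), (∑ j, f j).1 q = ∑ j, (f j).1 q := by
    intro f q
    rw [show (∑ j, f j).1 = ∑ j, (f j).1 from map_sum (Smooth m M).val f Finset.univ,
      Finset.sum_apply]
  have hBim : ∀ i q, ((B i).1 q).im = 0 := by
    intro i q
    simp only [B, coe_sum, Complex.im_sum]
    refine Finset.sum_eq_zero fun j _ => ?_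
    change ((a i j).1 q * (D (g j)).1 q - (S.br (a i j) (g j)).1 q).im = 0
    rw [Complex.sub_im, Complex.mul_im, S.br_ofReal_im, hD]
    change (_ * 0 + ((cut (A i j) q : ℝ) : ℂ).im * _) - 0 = (0 : ℝ)
    rw [Complex.ofReal_im]; simp
  -- the coefficients of the system, in coordinates
  have hBre : ∀ i, ContMDiff (𝓡 m) 𝓘(ℝ, ℝ) ∞ (fun q => ((B i).1 q).re) := fun i =>
    ContMDiff.comp (I' := 𝓘(ℝ, ℂ)) Complex.reCLM.contDiff.contMDiff (B i).2
  set b : Fin m → EuclideanSpace ℝ (Fin m) → ℝ := fun i =>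
    φ.target.indicator (cut (fun q => ((B i).1 q).re) ∘ φ.symm)
  have htsχ : ∀ k, tsupport (cut k) ⊆ tsupport χ := fun k =>
    closure_mono fun q hq => left_ne_zero_of_mul hq
  have hb : ∀ i, ContDiff ℝ ∞ (b i) := fun i =>
    contDiff_pull p (hcut (hBre i).contMDiffOn)
      (χ.hasCompactSupport.mono' ((subset_tsupport _).trans (htsχ _)))
      ((htsχ _).trans χ.tsupport_subset_chartAt_source)
  have hbB : ∀ i, ∀ y ∈ box α γ, (b i y : ℂ) = (B i).1 (φ.symm y) := by
    intro i y hy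
    have : b i y = ((B i).1 (φ.symm y)).re := by
      simp only [b, indicator_of_mem (hboxt hy)]
      exact (hcut1 (fun q => ((B i).1 q).re) y hy).eq_of_nhds
    rw [this]
    apply Complex.ext <;> simp [hBim]
  have hsolve : ∀ i, Solves α γ (ν ∘ₗ push p) i (b i) := by
    intro i v hv
    have hvt : tsupport v ⊆ φ.target := hv.tsupport_subset.trans hboxt
    set u : Smooth m M := ⟨push p v, contMDiff_push p hv.1 hv.hasCompactSupport hvt⟩
    have hus : tsupport u.1 ⊆ φ.symm '' tsupport v :=
      tsupport_indicator_comp_subset φ hv.hasCompactSupport hvt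
    have huc : HasCompactSupport u.1 :=
      hasCompactSupport_indicator_comp φ hv.hasCompactSupport hvt
    have hcol : ∀ j, ν (a i j * S.br u (g j) - u * (a i j * D (g j) - S.br (a i j) (g j))).1
        = 0 := by
      intro j
      have h1 := hν (g j) (a i j * u) (hcutc _) huc.mul_left
      rw [S.br_antisymm, S.br_mul_ofReal] at h1
      rw [← neg_eq_zero, ← map_neg, ← h1]
      congr 1
      change (-(a i j * S.br u (g j) - u * (a i j * D (g j) - S.br (a i j) (g j)))).1 = _
      congr 1
      ring
    have hsum : push p (fun x => fderiv ℝ v x (basisVec i) - b i x * v x) =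
        ∑ j, (a i j * S.br u (g j) - u * (a i j * D (g j) - S.br (a i j) (g j))).1 := by
      funext q
      have hR : (∑ j, (a i j * S.br u (g j) - u * (a i j * D (g j) - S.br (a i j) (g j))).1) q =
          (∑ j, (a i j).1 q * Ω.poisson u.1 (g j).1 q) - u.1 q * (B i).1 q := by
        rw [Finset.sum_apply]
        simp only [B, coe_sum, Finset.mul_sum, ← Finset.sum_sub_distrib]
        refine Finset.sum_congr rfl fun j _ => ?_
        rw [← S.br_apply]
        rfl
      rw [hR]
      by_cases hq : q ∈ tsupport u.1
      · obtain ⟨y, hy, rfl⟩ := hus hq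
        have hyb := hv.tsupport_subset hy
        have hyt := hboxt hyb
        have hu_y : u.1 (φ.symm y) = v y := by
          change φ.source.indicator (v ∘ φ) _ = _
          rw [indicator_of_mem (φ.map_target hyt)]
          simp [φ.right_inv hyt]
        have hev : u.1 ∘ φ.symm =ᶠ[𝓝 y] v := by
          filter_upwards [φ.open_target.mem_nhds hyt] with x hx
          change φ.source.indicator (v ∘ φ) (φ.symm x) = _
          rw [indicator_of_mem (φ.map_target hx)]
          simp [φ.right_inv hx]
        have hL : push p (fun x => fderiv ℝ v x (basisVec i) - b i x * v x) (φ.symm y) =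
            fderiv ℝ v y (basisVec i) - b i y * v y := by
          rw [push_apply, indicator_of_mem (φ.map_target hyt)]
          simp only [Function.comp_apply, ← hφ, φ.right_inv hyt]
        rw [hL, hbB i y hyb, hu_y, mul_comm (v y)]
        congr 1
        have hd := dComplex_chartVec p hyt (f := u.1) (u.2.mdifferentiableAt (by simp))
          (basisVec i)
        rw [← hφ, hev.fderiv_eq] at hd
        rw [← hd, Ω.chartVec_basisVec p hyt (g := fun j => cut fun q => φ q j)
          (fun j => hcut1 _ y hyb) i, map_sum]
        refine Finset.sum_congr rfl fun j _ => ?_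
        rw [map_smul]
        have h3 : (a i j).1 (φ.symm y) =
            ((localForm Ω.form p y ![basisVec i, basisVec j] : ℝ) : ℂ) := by
          change ((cut (A i j) (φ.symm y) : ℝ) : ℂ) = _
          rw [(hcut1 (A i j) y hyb).eq_of_nhds]
          simp only [A, φ.right_inv hyt]
        rw [h3, Complex.real_smul]
        congr 1
        exact (Ω.poisson_ofReal u.1 (cut fun q => φ q j) _).symm
      · have h0 : u.1 q = 0 := image_eq_zero_of_notMem_tsupport hq
        have h1 : ∀ j, Ω.poisson u.1 (g j).1 q = 0 := by
          intro j
          simp [SymplecticForm.poisson, dComplex_eq_zero hq]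
        rw [h0]
        simp only [h1, mul_zero, Finset.sum_const_zero, zero_mul, sub_zero]
        rw [push_apply]
        by_cases hqs : q ∈ φ.source
        · rw [indicator_of_mem hqs]
          have h2 : v =ᶠ[𝓝 (φ q)] fun _ => 0 := by
            have h3 : Filter.Tendsto φ.symm (𝓝 (φ q)) (𝓝 q) := by
              have := φ.continuousAt_symm (φ.map_source hqs)
              rwa [ContinuousAt, φ.left_inv hqs] at this
            filter_upwards [h3.eventually (notMem_tsupport_iff_eventuallyEq.1 hq),
              φ.open_target.mem_nhds (φ.map_source hqs)] with x hx hxt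
            have h4 : φ.source.indicator (v ∘ φ) (φ.symm x) = 0 := hx
            rw [indicator_of_mem (φ.map_target hxt)] at h4
            simpa [φ.right_inv hxt] using h4
          simp only [Function.comp_apply, ← hφ, h2.fderiv_eq, h2.eq_of_nhds]
          simp
        · exact indicator_of_notMem hqs _
    rw [LinearMap.comp_apply, hsum, map_sum]
    exact Finset.sum_eq_zero fun j _ => hcol j
  obtain ⟨z, hz⟩ := exists_pos_mul_of_solves hb hsolve
  refine ⟨φ.source ∩ φ ⁻¹' box α γ, φ.isOpen_inter_preimage (isOpen_box α γ), ⟨hpφ, hpb⟩, z,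
    fun h hh hc hs h0 ⟨q, hq⟩ => ?_⟩
  have hss : tsupport h ⊆ φ.source := hs.trans inter_subset_left
  have hbt : BoxTest α γ (φ.target.indicator (h ∘ φ.symm)) := by
    refine BoxTest.of_isCompact (contDiff_pull p hh hc hss)
      (IsCompact.image_of_continuousOn hc (φ.continuousOn.mono hss)) ?_
      ((subset_tsupport _).trans (tsupport_indicator_comp_subset φ.symm hc hss))
    rintro _ ⟨x, hx, rfl⟩
    exact (hs hx).2
  obtain ⟨κ, hκ, e⟩ := hz _ hbt (fun y => indicator_nonneg (fun _ _ => h0 _) _) ⟨φ q, by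
    have hqs := hss (subset_tsupport h hq.ne')
    rw [indicator_of_mem (φ.map_source hqs)]
    simpa [φ.left_inv hqs] using hq⟩
  refine ⟨κ, hκ, ?_⟩
  rw [← e, LinearMap.comp_apply]
  congr 1
  funext x
  rw [push_apply]
  by_cases hx : x ∈ φ.source
  · rw [indicator_of_mem hx]
    simp [← hφ, φ.map_source hx, φ.left_inv hx]
  · rw [indicator_of_notMem hx]
    have : h x = 0 := image_eq_zero_of_notMem_tsupport fun h' => hx (hss h')
    simp [this]

end Bracket

/-! ### The global phase of a functional -/

section Phase

open Set

variable {m : ℕ} {M : Type*} [TopologicalSpace M] [ChartedSpace (EuclideanSpace ℝ (Fin m)) M]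

variable (m) in
/-- On the nonzero nonnegative smooth functions with compact support in `U`, the values of `ν` are
positive multiples of `z`. -/
def HasPhase (ν : (M → ℂ) →ₗ[ℂ] ℂ) (U : Set M) (z : ℂ) : Prop :=
  ∀ h : M → ℝ, ContMDiff (𝓡 m) 𝓘(ℝ, ℝ) ∞ h → HasCompactSupport h → tsupport h ⊆ U →
    (∀ q, 0 ≤ h q) → (∃ q, 0 < h q) → ∃ κ : ℝ, 0 < κ ∧ ν (fun q => (h q : ℂ)) = κ * z

theorem HasPhase.normalize {ν : (M → ℂ) →ₗ[ℂ] ℂ} {U : Set M} {z : ℂ} (hz : HasPhase m ν U z) :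
    HasPhase m ν U (z / ‖z‖) := by
  intro h h1 h2 h3 h4 h5
  obtain ⟨κ, hκ, e⟩ := hz h h1 h2 h3 h4 h5
  rcases eq_or_ne z 0 with rfl | hne
  · exact ⟨κ, hκ, by simpa using e⟩
  · refine ⟨κ * ‖z‖, mul_pos hκ (norm_pos_iff.2 hne), ?_⟩
    have : (‖z‖ : ℂ) ≠ 0 := by exact_mod_cast (norm_pos_iff.2 hne).ne'
    rw [e]; push_cast; field_simp

variable [IsManifold (𝓡 m) ∞ M] [T2Space M]

/-- Normalized phases on overlapping sets agree. -/
theorem HasPhase.unique {ν : (M → ℂ) →ₗ[ℂ] ℂ} {U V : Set M} {z w : ℂ}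
    (hz : HasPhase m ν U (z / ‖z‖))
    (hw : HasPhase m ν V (w / ‖w‖)) (hU : IsOpen U) (hV : IsOpen V) {q : M} (hq : q ∈ U ∩ V) :
    z / ‖z‖ = w / ‖w‖ := by
  obtain ⟨χ, -, hχ⟩ := (SmoothBumpFunction.nhds_basis_tsupport (I := 𝓡 m) q).mem_iff.1
    ((hU.inter hV).mem_nhds hq)
  have hpos : ∃ q, 0 < χ q := ⟨q, by rw [χ.eq_one]; exact one_pos⟩
  obtain ⟨κ, hκ, e⟩ := hz χ χ.contMDiff χ.hasCompactSupport (hχ.trans inter_subset_left)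
    (fun _ => χ.nonneg) hpos
  obtain ⟨κ', hκ', e'⟩ := hw χ χ.contMDiff χ.hasCompactSupport (hχ.trans inter_subset_right)
    (fun _ => χ.nonneg) hpos
  have h := e.symm.trans e'
  have hκc : (κ : ℂ) ≠ 0 := by exact_mod_cast hκ.ne'
  have hκc' : (κ' : ℂ) ≠ 0 := by exact_mod_cast hκ'.ne'
  rcases eq_or_ne z 0 with rfl | hz0
  · have hw0 : w = 0 := by simpa [hκc'] using h
    rw [hw0]
  rcases eq_or_ne w 0 with rfl | hw0
  · simp [hκc, hz0] at h
  have hn : ∀ u : ℂ, u ≠ 0 → ‖u / ‖u‖‖ = 1 := fun u hu => by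
    simp [div_self (norm_ne_zero_iff.2 hu)]
  have h2 := congrArg norm h
  rw [norm_mul, norm_mul, hn z hz0, hn w hw0, mul_one, mul_one, Complex.norm_real,
    Complex.norm_real, Real.norm_of_nonneg hκ.le, Real.norm_of_nonneg hκ'.le] at h2
  rw [← h2] at h
  exact mul_left_cancel₀ hκc h

variable [SecondCountableTopology M]

/-- Phases are glued with a partition of unity. -/
theorem hasPhase_univ_of_local {ν : (M → ℂ) →ₗ[ℂ] ℂ} {z : ℂ}
    (hloc : ∀ p : M, ∃ U : Set M, IsOpen U ∧ p ∈ U ∧ HasPhase m ν U z) :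
    HasPhase m ν univ z := by
  classical
  intro h hh hc _ h0 ⟨q₀, hq₀⟩
  have : LocallyCompactSpace M := ChartedSpace.locallyCompactSpace (EuclideanSpace ℝ (Fin m)) M
  choose U hU hpU hz using hloc
  obtain ⟨ρ, hρ⟩ := SmoothPartitionOfUnity.exists_isSubordinate (𝓡 m) isClosed_univ U hU
    (fun p _ => mem_iUnion.2 ⟨p, hpU p⟩)
  have hfin := ρ.locallyFinite.finite_nonempty_inter_compact hc
  set s : Finset M := hfin.toFinset
  have hsum : ∀ q, h q = ∑ i ∈ s, ρ i q * h q := by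
    intro q
    by_cases hq : h q = 0
    · simp [hq]
    · rw [← Finset.sum_mul]
      have h1 : ∑ i ∈ s, ρ i q = 1 := by
        refine ρ.sum_finsupport' q (mem_univ q) fun i hi => ?_
        rw [SmoothPartitionOfUnity.mem_finsupport] at hi
        exact hfin.mem_toFinset.2 ⟨q, hi, subset_tsupport _ hq⟩
      rw [h1, one_mul]
  have hterm : ∀ i, ∃ κ : ℝ, 0 ≤ κ ∧ ((∃ q, 0 < ρ i q * h q) → 0 < κ) ∧
      ν (fun q => ((ρ i q * h q : ℝ) : ℂ)) = κ * z := by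
    intro i
    by_cases hi : ∃ q, 0 < ρ i q * h q
    · obtain ⟨κ, hκ, e⟩ := hz i (fun q => ρ i q * h q) ((ρ i).contMDiff.mul hh) hc.mul_left
        ((closure_mono fun q hq => left_ne_zero_of_mul hq).trans (hρ i))
        (fun q => mul_nonneg (ρ.nonneg i q) (h0 q)) hi
      exact ⟨κ, hκ.le, fun _ => hκ, e⟩
    · refine ⟨0, le_rfl, fun h => absurd h hi, ?_⟩
      push Not at hi
      have : (fun q => ((ρ i q * h q : ℝ) : ℂ)) = 0 := by
        funext q
        have := le_antisymm (hi q) (mul_nonneg (ρ.nonneg i q) (h0 q))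
        simp only [this]; simp
      rw [this]; simp
  choose κ hκ0 hκ1 hκ2 using hterm
  refine ⟨∑ i ∈ s, κ i, ?_, ?_⟩
  · obtain ⟨i, hi, hne⟩ : ∃ i ∈ s, ρ i q₀ * h q₀ ≠ 0 := by
      apply Finset.exists_ne_zero_of_sum_ne_zero
      rw [← hsum q₀]
      exact hq₀.ne'
    exact Finset.sum_pos' (fun i _ => hκ0 i) ⟨i, hi, hκ1 i ⟨q₀,
      lt_of_le_of_ne (mul_nonneg (ρ.nonneg i q₀) (h0 q₀)) hne.symm⟩⟩
  · have : (fun q => (h q : ℂ)) = ∑ i ∈ s, fun q => ((ρ i q * h q : ℝ) : ℂ) := by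
      funext q
      rw [Finset.sum_apply, ← Complex.ofReal_sum, ← hsum q]
    rw [this, map_sum, Complex.ofReal_sum, Finset.sum_mul]
    exact Finset.sum_congr rfl fun i _ => hκ2 i

/-- A functional with phase zero vanishes: every real function with compact support is a difference
of nonnegative ones. -/
theorem HasPhase.eq_zero {ν : (M → ℂ) →ₗ[ℂ] ℂ} (hν : HasPhase m ν univ 0) {f : M → ℂ}
    (hf : ContMDiff (𝓡 m) 𝓘(ℝ, ℂ) ∞ f) (hc : HasCompactSupport f) : ν f = 0 := by
  have : LocallyCompactSpace M := ChartedSpace.locallyCompactSpace (EuclideanSpace ℝ (Fin m)) M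
  have hnonneg : ∀ h : M → ℝ, ContMDiff (𝓡 m) 𝓘(ℝ, ℝ) ∞ h → HasCompactSupport h →
      (∀ q, 0 ≤ h q) → ν (fun q => (h q : ℂ)) = 0 := by
    intro h hh hhc h0
    by_cases hex : ∃ q, 0 < h q
    · obtain ⟨κ, -, e⟩ := hν h hh hhc (subset_univ _) h0 hex
      simpa using e
    · push Not at hex
      have : (fun q => (h q : ℂ)) = 0 := by
        funext q; simp [le_antisymm (hex q) (h0 q)]
      rw [this, map_zero]
  have hreal : ∀ h : M → ℝ, ContMDiff (𝓡 m) 𝓘(ℝ, ℝ) ∞ h → HasCompactSupport h →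
      ν (fun q => (h q : ℂ)) = 0 := by
    intro h hh hhc
    obtain ⟨K, hK, hhK⟩ := exists_compact_superset (show IsCompact (tsupport h) from hhc)
    obtain ⟨ψ, hψ0, hψ1, -⟩ := exists_contMDiffMap_zero_one_of_isClosed (n := ⊤) (𝓡 m)
      (isOpen_interior (s := K)).isClosed_compl (isClosed_tsupport h)
      (disjoint_compl_left_iff_subset.2 hhK)
    have hψc : HasCompactSupport (fun q => ψ q * ψ q) := by
      refine HasCompactSupport.intro hK fun q hq => ?_
      have : ψ q = 0 := hψ0 fun h' => hq (interior_subset h')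
      simp [this]
    -- `4 h = ψ² (h + 1)² - ψ² (h - 1)²`
    have hsq : ∀ c : ℝ, ν (fun q => ((ψ q * ψ q * ((h q + c) * (h q + c)) : ℝ) : ℂ)) = 0 := by
      intro c
      have h1 : ContMDiff (𝓡 m) 𝓘(ℝ, ℝ) ∞ (fun q => h q + c) := hh.add contMDiff_const
      exact hnonneg _ ((ψ.contMDiff.mul ψ.contMDiff).mul (h1.mul h1)) hψc.mul_right
        fun q => mul_nonneg (mul_self_nonneg _) (mul_self_nonneg _)
    have e : (fun q => (h q : ℂ)) = (1 / 4 : ℂ) •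
        ((fun q => ((ψ q * ψ q * ((h q + 1) * (h q + 1)) : ℝ) : ℂ)) -
          fun q => ((ψ q * ψ q * ((h q + -1) * (h q + -1)) : ℝ) : ℂ)) := by
      funext q
      by_cases hq : q ∈ tsupport h
      · have : ψ q = 1 := hψ1 hq
        simp [this]; ring
      · have : h q = 0 := image_eq_zero_of_notMem_tsupport hq
        simp [this]
    rw [e, map_smul, map_sub, hsq, hsq]; simp
  have h1 := hreal (fun q => (f q).re)
    (ContMDiff.comp (I' := 𝓘(ℝ, ℂ)) Complex.reCLM.contDiff.contMDiff hf)
    (hc.comp_left Complex.zero_re)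
  have h2 := hreal (fun q => (f q).im)
    (ContMDiff.comp (I' := 𝓘(ℝ, ℂ)) Complex.imCLM.contDiff.contMDiff hf)
    (hc.comp_left Complex.zero_im)
  have e : f = (fun q => ((f q).re : ℂ)) + Complex.I • fun q => ((f q).im : ℂ) := by
    funext q
    simp [mul_comm Complex.I, Complex.re_add_im]
  rw [e, map_add, map_smul, h1, h2]; simp

variable [ConnectedSpace M]

/-- A nonzero functional that annihilates all `{f, g} + g D f`, with a real operator `D`, is a
complex multiple of a strictly positive functional. -/
theorem StarProduct.exists_phase {Ω : SymplecticForm m M} (S : StarProduct Ω)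
    {D : Smooth m M → Smooth m M}
    (hD : ∀ (f : M → ℝ) (hf : ContMDiff (𝓡 m) 𝓘(ℝ, ℝ) ∞ f) (q : M),
      ((D (ofReal f hf)).1 q).im = 0)
    {ν : (M → ℂ) →ₗ[ℂ] ℂ}
    (hν : ∀ f g : Smooth m M, HasCompactSupport f.1 → HasCompactSupport g.1 →
      ν (S.br f g + g * D f).1 = 0)
    (hne : ∃ f : Smooth m M, HasCompactSupport f.1 ∧ ν f.1 ≠ 0) :
    ∃ z : ℂ, z ≠ 0 ∧ ∀ f : Smooth m M, HasCompactSupport f.1 → f ≠ 0 →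
      ∃ κ : ℝ, 0 < κ ∧ ν (conj f * f).1 = κ * z := by
  choose U hU hpU w hw using S.exists_phase_near hD hν
  have hphase : ∀ p, HasPhase m ν (U p) (w p / ‖w p‖) := fun p => HasPhase.normalize (hw p)
  have hlc : IsLocallyConstant fun p => w p / (‖w p‖ : ℂ) := by
    rw [IsLocallyConstant.iff_exists_open]
    exact fun p => ⟨U p, hU p, hpU p, fun q hq =>
      (hphase q).unique (hphase p) (hU q) (hU p) ⟨hpU q, hq⟩⟩
  obtain ⟨p₀⟩ : Nonempty M := inferInstance
  set z := w p₀ / (‖w p₀‖ : ℂ)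
  have huniv : HasPhase m ν univ z := hasPhase_univ_of_local fun p =>
    ⟨U p, hU p, hpU p, by
      have h := hphase p
      rwa [hlc.apply_eq_of_preconnectedSpace p p₀] at h⟩
  refine ⟨z, ?_, fun f hc hf => ?_⟩
  · rintro hz
    obtain ⟨f, hfc, hfν⟩ := hne
    rw [hz] at huniv
    exact hfν (huniv.eq_zero f.2 hfc)
  · have hval : ∀ q, ((Complex.normSq (f.1 q) : ℝ) : ℂ) = (conj f * f).1 q := fun q =>
      (Complex.normSq_eq_conj_mul_self)
    have hsm : ContMDiff (𝓡 m) 𝓘(ℝ, ℝ) ∞ fun q => Complex.normSq (f.1 q) := by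
      have h1 : (fun q => Complex.normSq (f.1 q)) = fun q => ((conj f * f).1 q).re := by
        funext q; rw [← hval]; simp
      rw [h1]
      exact ContMDiff.comp (I' := 𝓘(ℝ, ℂ)) Complex.reCLM.contDiff.contMDiff (conj f * f).2
    obtain ⟨q, hq⟩ : ∃ q, f.1 q ≠ 0 := by
      by_contra! hcon
      exact hf (Subtype.ext (funext hcon))
    obtain ⟨κ, hκ, e⟩ := huniv _ hsm (hc.comp_left (map_zero Complex.normSq)) (subset_univ _)
      (fun q => Complex.normSq_nonneg _) ⟨q, Complex.normSq_pos.2 hq⟩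
    refine ⟨κ, hκ, ?_⟩
    rw [← e]
    congr 1
    funext q
    exact (hval q).symm

end Phase

/-! ### Local Hamiltonians of symplectic vector fields -/

section Hamiltonian

open Set

variable {m : ℕ} {M : Type*} [TopologicalSpace M] [ChartedSpace (EuclideanSpace ℝ (Fin m)) M]
  [IsManifold (𝓡 m) ∞ M]

theorem chartVec_isInvertible (p : M) {y : EuclideanSpace ℝ (Fin m)}
    (hy : y ∈ (chartAt (EuclideanSpace ℝ (Fin m)) p).target) :
    (mfderiv (𝓡 m) (𝓡 m) (chartAt (EuclideanSpace ℝ (Fin m)) p).symm y).IsInvertible :=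
  haveI : IsManifold (𝓡 m) 1 M := IsManifold.of_le (n := ∞) (by simp)
  ⟨(mdifferentiable_chart (I := 𝓡 m) p).symm.mfderiv hy, rfl⟩

/-- A smooth vector field has smooth components in a chart. -/
theorem exists_contDiffOn_chartVec {X : ∀ q : M, TangentSpace (𝓡 m) q}
    (hX : ContMDiff (𝓡 m) (𝓡 m).tangent ∞ (fun q => (⟨q, X q⟩ : TangentBundle (𝓡 m) M)))
    (p : M) : ∃ Y : EuclideanSpace ℝ (Fin m) → EuclideanSpace ℝ (Fin m),
      ContDiffOn ℝ ∞ Y (chartAt (EuclideanSpace ℝ (Fin m)) p).target ∧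
      ∀ y ∈ (chartAt (EuclideanSpace ℝ (Fin m)) p).target,
        chartVec m p y (Y y) = X ((chartAt (EuclideanSpace ℝ (Fin m)) p).symm y) := by
  refine ⟨VectorField.mpullback (𝓡 m) (𝓡 m) (chartAt (EuclideanSpace ℝ (Fin m)) p).symm X,
    fun y hy => ?_, fun y hy => ?_⟩
  · have h1 : ContMDiffAt (𝓡 m) (𝓡 m) ∞ (chartAt (EuclideanSpace ℝ (Fin m)) p).symm y :=
      (contMDiffOn_chart_symm (I := 𝓡 m) (n := ∞) (x := p)).contMDiffAt
        ((chartAt (EuclideanSpace ℝ (Fin m)) p).open_target.mem_nhds hy)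
    have h2 := ContMDiffAt.mpullback_vectorField_preimage (hX.contMDiffAt (x :=
      (chartAt (EuclideanSpace ℝ (Fin m)) p).symm y)) h1 (chartVec_isInvertible p hy) (by simp)
    exact (contMDiffAt_vectorSpace_iff_contDiffAt.1 h2).contDiffWithinAt
  · obtain ⟨A, hA⟩ := chartVec_isInvertible p hy
    simp only [chartVec, VectorField.mpullback_apply, ← hA, ContinuousLinearMap.inverse_equiv]
    exact A.apply_symm_apply _

namespace SymplecticForm

variable (Ω : SymplecticForm m M)

theorem contDiffOn_localForm_interior {X : ∀ q : M, TangentSpace (𝓡 m) q}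
    (hX : ContMDiff (𝓡 m) (𝓡 m).tangent ∞ (fun q => (⟨q, X q⟩ : TangentBundle (𝓡 m) M)))
    (p : M) : ContDiffOn ℝ ∞ (localForm (Ω.interior X) p)
      (chartAt (EuclideanSpace ℝ (Fin m)) p).target := by
  obtain ⟨Y, hY, hYX⟩ := exists_contDiffOn_chartVec hX p
  have h2 : ContDiffOn ℝ ∞ (localForm Ω.form p) (chartAt (EuclideanSpace ℝ (Fin m)) p).target := by
    simpa [mfld_simps] using! Ω.smooth p
  let L : (EuclideanSpace ℝ (Fin m) [⋀^Fin 2]→L[ℝ] ℝ) →L[ℝ]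
      (EuclideanSpace ℝ (Fin m) →L[ℝ] EuclideanSpace ℝ (Fin m) [⋀^Fin 1]→L[ℝ] ℝ) :=
    (ContinuousAlternatingMap.curryLeftLI (𝕜 := ℝ) (E := EuclideanSpace ℝ (Fin m)) (F := ℝ)
      (n := 1)).toContinuousLinearMap
  have hc : ContDiff ℝ ∞ (fun ξ : EuclideanSpace ℝ (Fin m) [⋀^Fin 2]→L[ℝ] ℝ => ξ.curryLeft) := by
    exact ContinuousLinearMap.contDiff (𝕜 := ℝ) (E := EuclideanSpace ℝ (Fin m) [⋀^Fin 2]→L[ℝ] ℝ)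
      (F := EuclideanSpace ℝ (Fin m) →L[ℝ] EuclideanSpace ℝ (Fin m) [⋀^Fin 1]→L[ℝ] ℝ) L
  have h3 : ContDiffOn ℝ ∞ (fun y => (localForm Ω.form p y).curryLeft (Y y))
      (chartAt (EuclideanSpace ℝ (Fin m)) p).target :=
    ContDiffOn.clm_apply (f := fun y => (localForm Ω.form p y).curryLeft)
      (hc.comp_contDiffOn h2) hY
  refine h3.congr fun y hy => ?_
  ext w
  rw [localForm_apply, ContinuousAlternatingMap.curryLeft_apply_apply, localForm_apply]
  have : (fun i => chartVec m p y (w i)) = ![chartVec m p y (w 0)] := by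
    funext i; fin_cases i; rfl
  rw [this, interior_apply, ← hYX y hy]
  congr 1
  funext l
  fin_cases l <;> rfl

/-- By the Poincaré lemma, symplectic vector fields are locally Hamiltonian. -/
theorem exists_isHamiltonianNear [T2Space M] {X : ∀ q : M, TangentSpace (𝓡 m) q}
    (hX : Ω.IsSymplecticVectorField X) (p : M) :
    ∃ H : M → ℝ, ContMDiff (𝓡 m) 𝓘(ℝ, ℝ) ∞ H ∧ Ω.IsHamiltonianNear X H p := by
  set φ := chartAt (EuclideanSpace ℝ (Fin m)) p with hφ
  have hp : p ∈ φ.source := mem_chart_source _ p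
  obtain ⟨α, γ, hpb, hbt⟩ := exists_box_subset φ.open_target (φ.map_source hp)
  have hsm := Ω.contDiffOn_localForm_interior hX.smooth p
  have hb : ∀ i, ContDiffOn ℝ ∞ (fun y => localForm (Ω.interior X) p y ![basisVec i])
      (box α γ) := fun i =>
    (ContinuousAlternatingMap.apply ℝ (EuclideanSpace ℝ (Fin m)) ℝ
      ![basisVec i]).contDiff.comp_contDiffOn (hsm.mono hbt)
  obtain ⟨ψ, hψ, hψb⟩ := exists_potential hb (by
    intro x hx i j
    have hd : DifferentiableAt ℝ (localForm (Ω.interior X) p) x :=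
      (hsm.contDiffAt (φ.open_target.mem_nhds (hbt hx))).differentiableAt (by simp)
    have h0 : extDeriv (localForm (Ω.interior X) p) x = 0 :=
      hX.closed p x (by simpa [mfld_simps] using! hbt hx)
    have h1 := extDeriv_apply hd ![basisVec i, basisVec j]
    have e0 : Fin.removeNth (0 : Fin 2) ![(basisVec i : EuclideanSpace ℝ (Fin m)), basisVec j] =
        ![basisVec j] := by funext l; fin_cases l; rfl
    have e1 : Fin.removeNth (1 : Fin 2) ![(basisVec i : EuclideanSpace ℝ (Fin m)), basisVec j] =
        ![basisVec i] := by funext l; fin_cases l; rfl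
    rw [h0, Fin.sum_univ_two, e0, e1] at h1
    simp at h1
    linarith)
  have hU : φ.source ∩ φ ⁻¹' box α γ ∈ 𝓝 p :=
    (φ.isOpen_inter_preimage (isOpen_box α γ)).mem_nhds ⟨hp, hpb⟩
  obtain ⟨χ, -, hχ⟩ := (SmoothBumpFunction.nhds_basis_tsupport (I := 𝓡 m) p).mem_iff.1 hU
  have hψφ : ContMDiffOn (𝓡 m) 𝓘(ℝ, ℝ) ∞ (ψ ∘ φ) (φ.source ∩ φ ⁻¹' box α γ) :=
    hψ.contMDiffOn.comp ((contMDiffOn_chart (I := 𝓡 m) (n := ∞) (x := p)).mono inter_subset_left)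
      fun q hq => hq.2
  have hO : IsOpen (φ.source ∩ φ ⁻¹' box α γ) := φ.isOpen_inter_preimage (isOpen_box α γ)
  refine ⟨fun q => χ q * ψ (φ q), contMDiff_of_tsupport fun q hq => ?_, ?_⟩
  · have hq' := hχ (tsupport_mul_subset_left hq)
    exact χ.contMDiffAt.mul (hψφ.contMDiffAt (hO.mem_nhds hq'))
  · filter_upwards [χ.eventuallyEq_one.eventually_nhds, hO.mem_nhds ⟨hp, hpb⟩] with q hq hqU v
    have hev : (fun q => χ q * ψ (φ q)) =ᶠ[𝓝 q] ψ ∘ φ := by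
      filter_upwards [hq] with r hr
      simp [hr]
    have h1 : dReal (fun q => χ q * ψ (φ q)) q = dReal (m := m) (ψ ∘ φ) q := hev.mfderiv_eq
    rw [h1]
    obtain ⟨y, hy, rfl⟩ : ∃ y ∈ φ.target, φ.symm y = q :=
      ⟨φ q, φ.map_source hqU.1, φ.left_inv hqU.1⟩
    have hyb : y ∈ box α γ := by simpa [φ.right_inv hy] using hqU.2
    obtain ⟨e, rfl⟩ := chartVec_surjective p hy v
    rw [dReal_chartVec p hy
      ((hψφ.contMDiffAt (hO.mem_nhds hqU)).mdifferentiableAt (by simp)) e]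
    have hev2 : (ψ ∘ φ) ∘ φ.symm =ᶠ[𝓝 y] ψ := by
      filter_upwards [φ.open_target.mem_nhds hy] with x hx
      simp [φ.right_inv hx]
    rw [hev2.fderiv_eq]
    have he : e = ∑ j, e j • basisVec j := by
      conv_lhs => rw [← (EuclideanSpace.basisFun (Fin m) ℝ).sum_repr e]
      simp [basisVec]
    have hflat : ∀ e, Ω.interior X (φ.symm y) ![chartVec m p y e] =
        Ω.flat (φ.symm y) (X (φ.symm y)) (chartVec m p y e) := fun e => rfl
    have hloc : ∀ i, fderiv ℝ ψ y (basisVec i) =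
        Ω.flat (φ.symm y) (X (φ.symm y)) (chartVec m p y (basisVec i)) := by
      intro i
      rw [hψb y hyb i, localForm_apply, ← hflat]
      congr 1
      funext l
      fin_cases l
      rfl
    rw [hflat]
    conv_lhs => rw [he]
    conv_rhs => rw [he]
    simp only [map_sum, map_smul, hloc]

/-- Local Hamiltonians are unique up to a constant. -/
theorem IsHamiltonianNear.eq_add_const {Ω : SymplecticForm m M} {X : ∀ q : M, TangentSpace (𝓡 m) q}
    {H K : M → ℝ} {p : M} (hH : ContMDiff (𝓡 m) 𝓘(ℝ, ℝ) ∞ H) (hK : ContMDiff (𝓡 m) 𝓘(ℝ, ℝ) ∞ K)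
    (h1 : Ω.IsHamiltonianNear X H p) (h2 : Ω.IsHamiltonianNear X K p) :
    ∃ c : ℝ, ∀ᶠ q in 𝓝 p, H q = K q + c := by
  set φ := chartAt (EuclideanSpace ℝ (Fin m)) p with hφ
  have hp : p ∈ φ.source := mem_chart_source _ p
  have ht : Filter.Tendsto φ.symm (𝓝 (φ p)) (𝓝 p) := by
    have := φ.continuousAt_symm (φ.map_source hp)
    rwa [ContinuousAt, φ.left_inv hp] at this
  have hW : {y : EuclideanSpace ℝ (Fin m) | y ∈ φ.target ∧
      ∀ v, dReal (m := m) H (φ.symm y) v = dReal (m := m) K (φ.symm y) v} ∈ 𝓝 (φ p) := by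
    filter_upwards [φ.open_target.mem_nhds (φ.map_source hp), ht.eventually h1, ht.eventually h2]
      with y hy hy1 hy2
    exact ⟨hy, fun v => (hy1 v).symm.trans (hy2 v)⟩
  obtain ⟨ε, hε, hball⟩ := Metric.mem_nhds_iff.1 hW
  have hdiff : ∀ L : M → ℝ, ContMDiff (𝓡 m) 𝓘(ℝ, ℝ) ∞ L →
      DifferentiableOn ℝ (L ∘ φ.symm) (Metric.ball (φ p) ε) := by
    intro L hL y hy
    have h3 : MDifferentiableAt (𝓡 m) 𝓘(ℝ, ℝ) L (φ.symm y) := hL.mdifferentiableAt (by simp)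
    have h4 := h3.comp y (mdifferentiableAt_chart_symm p (hball hy).1)
    exact h4.differentiableAt.differentiableWithinAt
  obtain ⟨c, hc⟩ := Metric.isOpen_ball.exists_eq_add_of_fderiv_eq
    (convex_ball (φ p) ε).isPreconnected (hdiff H hH) (hdiff K hK) (by
      intro y hy
      ext e
      rw [← dReal_chartVec p (hball hy).1 (hH.mdifferentiableAt (by simp)) e,
        ← dReal_chartVec p (hball hy).1 (hK.mdifferentiableAt (by simp)) e]
      exact (hball hy).2 _)
  refine ⟨c, ?_⟩
  filter_upwards [φ.open_source.mem_nhds hp,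
    (φ.continuousAt hp).eventually (Metric.ball_mem_nhds _ hε)] with q hq hqb
  simpa [φ.left_inv hq] using hc hqb

end SymplecticForm

end Hamiltonian

/-! ### The derivation of a symplectic vector field and its exponential -/

section Derivation

open Finset.HasAntidiagonal PowerSeries

variable {m : ℕ} {M : Type*} [TopologicalSpace M] [ChartedSpace (EuclideanSpace ℝ (Fin m)) M]

theorem val_ext {f g : Series m M} (h : ∀ n q, val n f q = val n g q) : f = g := by
  ext n q
  exact h n q

theorem coeff_conjS (n : ℕ) (f : Series m M) : coeff n (conjS f) = conj (coeff n f) :=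
  PowerSeries.coeff_map _ _ _

theorem conj_conj (f : Smooth m M) : conj (conj f) = f := by
  ext q
  exact Complex.conj_conj _

theorem conjS_conjS (f : Series m M) : conjS (conjS f) = f := by
  ext n : 1
  rw [coeff_conjS, coeff_conjS, conj_conj]

theorem conjS_C (f : Smooth m M) : conjS (C f) = C (conj f) := PowerSeries.map_C _ _

theorem conj_ofReal {H : M → ℝ} (hH : ContMDiff (𝓡 m) 𝓘(ℝ, ℝ) ∞ H) :
    conj (ofReal H hH) = ofReal H hH := by
  ext q
  exact Complex.conj_ofReal _

theorem conj_smul (c : ℂ) (f : Smooth m M) :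
    conj (c • f) = (starRingEnd ℂ c) • conj f := by
  ext q
  exact map_mul (starRingEnd ℂ) _ _

namespace StarProduct

variable {Ω : SymplecticForm m M} (S : StarProduct Ω)

theorem coeff_mul (n : ℕ) (f g : Series m M) :
    coeff n (S.mul f g) = ∑ rs ∈ antidiagonal n, ∑ ij ∈ antidiagonal rs.2,
      S.B rs.1 (coeff ij.1 f) (coeff ij.2 g) := by
  rw [mul, starMul, coeff_mk]

theorem coeff_C_mul (n : ℕ) (K : Smooth m M) (f : Series m M) :
    coeff n (S.mul (C K) f) = ∑ rs ∈ antidiagonal n, S.B rs.1 K (coeff rs.2 f) := by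
  rw [coeff_mul]
  refine Finset.sum_congr rfl fun rs _ => ?_
  rw [Finset.sum_eq_single (0, rs.2)]
  · simp
  · rintro ⟨i, j⟩ hij hne
    have hi : i ≠ 0 := by
      rintro rfl
      simp only [mem_antidiagonal, zero_add] at hij
      exact hne (by rw [hij])
    simp [coeff_C, hi]
  · intro h
    simp at h

theorem coeff_mul_C (n : ℕ) (f : Series m M) (K : Smooth m M) :
    coeff n (S.mul f (C K)) = ∑ rs ∈ antidiagonal n, S.B rs.1 (coeff rs.2 f) K := by
  rw [coeff_mul]
  refine Finset.sum_congr rfl fun rs _ => ?_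
  rw [Finset.sum_eq_single (rs.2, 0)]
  · simp
  · rintro ⟨i, j⟩ hij hne
    have hj : j ≠ 0 := by
      rintro rfl
      simp only [mem_antidiagonal, add_zero] at hij
      exact hne (by rw [hij])
    simp [coeff_C, hj]
  · intro h
    simp at h

theorem coeff_ad (n : ℕ) (K : Smooth m M) (f : Series m M) :
    coeff n (S.ad K f) =
      ∑ rs ∈ antidiagonal n, (S.B rs.1 K (coeff rs.2 f) - S.B rs.1 (coeff rs.2 f) K) := by
  rw [ad, map_sub, coeff_C_mul, coeff_mul_C, Finset.sum_sub_distrib]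

theorem val_ad (n : ℕ) (K : Smooth m M) (f : Series m M) (q : M) :
    val n (S.ad K f) q = ∑ rs ∈ antidiagonal n,
      ((S.B rs.1 K (coeff rs.2 f)).1 q - (S.B rs.1 (coeff rs.2 f) K).1 q) := by
  rw [val, coeff_ad]
  simp [Finset.sum_apply]

theorem ad_add (K : Smooth m M) (f g : Series m M) : S.ad K (f + g) = S.ad K f + S.ad K g := by
  ext n : 1
  rw [map_add, coeff_ad, coeff_ad, coeff_ad, ← Finset.sum_add_distrib]
  refine Finset.sum_congr rfl fun rs _ => ?_
  simp only [map_add, LinearMap.add_apply]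
  abel

theorem ad_smul (K : Smooth m M) (c : ℂ) (f : Series m M) : S.ad K (c • f) = c • S.ad K f := by
  ext n : 1
  have h : ∀ (j : ℕ) (f : Series m M), coeff j (c • f) = c • coeff j f := fun j f => rfl
  rw [h, coeff_ad, coeff_ad, Finset.smul_sum]
  refine Finset.sum_congr rfl fun rs _ => ?_
  simp only [h, map_smul, LinearMap.smul_apply, smul_sub]

/-- The commutator of two functions vanishes at order zero, so `ad K` raises the order. -/
theorem coeff_ad_eq_zero {n : ℕ} (K : Smooth m M) {f : Series m M} (hf : ∀ k < n, coeff k f = 0)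
    {k : ℕ} (hk : k ≤ n) : coeff k (S.ad K f) = 0 := by
  rw [coeff_ad]
  refine Finset.sum_eq_zero fun rs hrs => ?_
  rw [mem_antidiagonal] at hrs
  rcases Nat.eq_zero_or_pos rs.1 with h | h
  · rw [h, S.zeroth, S.zeroth, mul_comm, sub_self]
  · rw [hf rs.2 (by omega)]
    simp

theorem coeff_one_ad_C (K f : Smooth m M) : coeff 1 (S.ad K (C f)) = S.B 1 K f - S.B 1 f K := by
  rw [coeff_ad, Finset.Nat.antidiagonal_succ]
  simp [coeff_C]

theorem conjS_ad (hS : S.IsHermitian) {H : M → ℝ} (hH : ContMDiff (𝓡 m) 𝓘(ℝ, ℝ) ∞ H)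
    (f : Series m M) : S.ad (ofReal H hH) (conjS f) = -conjS (S.ad (ofReal H hH) f) := by
  rw [ad, ad, map_sub, hS, hS, conjS_C, conj_ofReal, neg_sub]

/-- Constants are central, and the coefficients of the star product are local. -/
theorem val_ad_congr {K K' : Smooth m M} {p : M} {c : ℂ} (h : ∀ᶠ q in 𝓝 p, K.1 q = K'.1 q + c)
    (n : ℕ) (f : Series m M) : val n (S.ad K f) p = val n (S.ad K' f) p := by
  set Z : Smooth m M := K - K' - c • 1
  have hZ : p ∉ tsupport Z.1 := by
    rw [notMem_tsupport_iff_eventuallyEq]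
    filter_upwards [h] with q hq
    change K.1 q - K'.1 q - c * 1 = 0
    rw [hq]
    ring
  have hK : K = K' + Z + c • 1 := by simp only [Z]; abel
  rw [val_ad, val_ad]
  refine Finset.sum_congr rfl fun rs _ => ?_
  have hZl : (S.B rs.1 Z (coeff rs.2 f)).1 p = 0 := by
    by_contra hne
    exact hZ ((S.bidiff rs.1).support_left _ _ hne)
  have hZr : (S.B rs.1 (coeff rs.2 f) Z).1 p = 0 := by
    by_contra hne
    exact hZ ((S.bidiff rs.1).support_right _ _ hne)
  have h1 : (S.B rs.1 1 (coeff rs.2 f)).1 p = (S.B rs.1 (coeff rs.2 f) 1).1 p := by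
    rcases Nat.eq_zero_or_pos rs.1 with h | h
    · rw [h, S.zeroth, S.zeroth, mul_comm]
    · rw [S.const_left _ h, S.const_right _ h]
  have e1 : S.B rs.1 K (coeff rs.2 f) = S.B rs.1 K' (coeff rs.2 f) + S.B rs.1 Z (coeff rs.2 f) +
      c • S.B rs.1 1 (coeff rs.2 f) := by
    rw [hK]; simp only [map_add, LinearMap.add_apply, map_smul, LinearMap.smul_apply]
  have e2 : S.B rs.1 (coeff rs.2 f) K = S.B rs.1 (coeff rs.2 f) K' + S.B rs.1 (coeff rs.2 f) Z +
      c • S.B rs.1 (coeff rs.2 f) 1 := by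
    rw [hK]; simp only [map_add, map_smul]
  rw [e1, e2]
  change (S.B rs.1 K' (coeff rs.2 f)).1 p + (S.B rs.1 Z (coeff rs.2 f)).1 p +
      c * (S.B rs.1 1 (coeff rs.2 f)).1 p - ((S.B rs.1 (coeff rs.2 f) K').1 p +
      (S.B rs.1 (coeff rs.2 f) Z).1 p + c * (S.B rs.1 (coeff rs.2 f) 1).1 p) = _
  rw [hZl, hZr, h1]
  ring

theorem val_ad_eq_of_notMem {p : M} {n : ℕ} {f : Series m M}
    (h : ∀ j ≤ n, p ∉ tsupport (val j f)) (K : Smooth m M) : val n (S.ad K f) p = 0 := by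
  rw [val_ad]
  refine Finset.sum_eq_zero fun rs hrs => ?_
  rw [mem_antidiagonal] at hrs
  have h1 : (S.B rs.1 K (coeff rs.2 f)).1 p = 0 := by
    by_contra hne
    exact h rs.2 (by omega) ((S.bidiff rs.1).support_right _ _ hne)
  have h2 : (S.B rs.1 (coeff rs.2 f) K).1 p = 0 := by
    by_contra hne
    exact h rs.2 (by omega) ((S.bidiff rs.1).support_left _ _ hne)
  rw [h1, h2, sub_zero]

variable [IsManifold (𝓡 m) ∞ M] {X : ∀ q : M, TangentSpace (𝓡 m) q}

theorem val_ad_eq_of_isHamiltonianNear {H K : M → ℝ} {p : M} {hH : ContMDiff (𝓡 m) 𝓘(ℝ, ℝ) ∞ H}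
    {hK : ContMDiff (𝓡 m) 𝓘(ℝ, ℝ) ∞ K} (h1 : Ω.IsHamiltonianNear X H p)
    (h2 : Ω.IsHamiltonianNear X K p) (n : ℕ) (f : Series m M) :
    val n (S.ad (ofReal H hH) f) p = val n (S.ad (ofReal K hK) f) p := by
  obtain ⟨c, hc⟩ := SymplecticForm.IsHamiltonianNear.eq_add_const hH hK h1 h2
  refine S.val_ad_congr (c := c) ?_ n f
  filter_upwards [hc] with q hq
  change ((H q : ℝ) : ℂ) = (K q : ℂ) + c
  rw [hq]
  push_cast
  rfl

variable [T2Space M]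

/-- The local commutators with Hamiltonians of `X` glue to a globally defined series. -/
theorem isDelta_delta (hX : Ω.IsSymplecticVectorField X) (f : Series m M) :
    S.IsDelta X f (S.delta X f) := by
  have hex : ∃ F, S.IsDelta X f F := by
    choose H hH hHp using fun p => Ω.exists_isHamiltonianNear hX p
    have hsm : ∀ n, ContMDiff (𝓡 m) 𝓘(ℝ, ℂ) ∞
        (fun q => val n (S.ad (ofReal (H q) (hH q)) f) q) := by
      intro n p
      have h0 : ContMDiffAt (𝓡 m) 𝓘(ℝ, ℂ) ∞ (val n (S.ad (ofReal (H p) (hH p)) f)) p :=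
        (coeff n (S.ad (ofReal (H p) (hH p)) f)).2.contMDiffAt
      refine h0.congr_of_eventuallyEq ?_
      filter_upwards [(hHp p).eventually_nhds] with q hq
      exact S.val_ad_eq_of_isHamiltonianNear (hHp q) hq n f
    let F : ℕ → Smooth m M := fun n => ⟨_, hsm n⟩
    refine ⟨PowerSeries.mk F, ?_⟩
    intro p K hK hKp n
    have h1 : val n (PowerSeries.mk F) p = val n (S.ad (ofReal (H p) (hH p)) f) p := by
      rw [val, coeff_mk]
    rw [h1]
    exact S.val_ad_eq_of_isHamiltonianNear (hHp p) hKp n f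
  rw [delta, dif_pos hex]
  exact hex.choose_spec

theorem exists_val_delta_eq (hX : Ω.IsSymplecticVectorField X) (p : M) :
    ∃ (H : M → ℝ) (hH : ContMDiff (𝓡 m) 𝓘(ℝ, ℝ) ∞ H), ∀ f n,
      val n (S.delta X f) p = val n (S.ad (ofReal H hH) f) p := by
  obtain ⟨H, hH, hp⟩ := Ω.exists_isHamiltonianNear hX p
  exact ⟨H, hH, fun f n => S.isDelta_delta hX f p H hH hp n⟩

/-- `δ_X` as a linear map. -/
def deltaHom (hX : Ω.IsSymplecticVectorField X) : Series m M →ₗ[ℂ] Series m M where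
  toFun := S.delta X
  map_add' f g := val_ext fun n q => by
    obtain ⟨H, hH, h⟩ := S.exists_val_delta_eq hX q
    change _ = val n (S.delta X f) q + val n (S.delta X g) q
    rw [h, h, h, ad_add]
    rfl
  map_smul' c f := val_ext fun n q => by
    obtain ⟨H, hH, h⟩ := S.exists_val_delta_eq hX q
    change _ = c * val n (S.delta X f) q
    rw [h, h, ad_smul]
    rfl

theorem coeff_delta_eq_zero (hX : Ω.IsSymplecticVectorField X) {n : ℕ} {f : Series m M}
    (hf : ∀ k < n, coeff k f = 0) {k : ℕ} (hk : k ≤ n) : coeff k (S.delta X f) = 0 := by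
  ext q
  obtain ⟨H, hH, h⟩ := S.exists_val_delta_eq hX q
  refine (h f k).trans ?_
  rw [val, S.coeff_ad_eq_zero _ hf hk]

theorem coeff_deltaHom_pow_eq_zero (hX : Ω.IsSymplecticVectorField X) {n : ℕ} {f : Series m M}
    (hf : ∀ k < n, coeff k f = 0) (r : ℕ) {k : ℕ} (hk : k < n + r) :
    coeff k ((S.deltaHom hX ^ r) f) = 0 := by
  induction r generalizing k with
  | zero => exact hf k hk
  | succ r ih =>
    rw [pow_succ']
    exact S.coeff_delta_eq_zero hX (n := n + r) (fun k hk => ih hk) (by omega)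

theorem delta_mem_compact (hX : Ω.IsSymplecticVectorField X) {f : Series m M}
    (hf : f ∈ Compact m M) : S.delta X f ∈ Compact m M := by
  intro n
  refine HasCompactSupport.intro
    ((Finset.range (n + 1)).finite_toSet.isCompact_biUnion (f := fun j => tsupport (val j f))
      fun j _ => hf j) fun q hq => ?_
  obtain ⟨H, hH, h⟩ := S.exists_val_delta_eq hX q
  rw [h]
  refine S.val_ad_eq_of_notMem (fun j hj hq' => hq ?_) _
  exact Set.mem_biUnion (by simpa using Nat.lt_succ_of_le hj) hq'

/-- Local Hamiltonians are real, and conjugation reverses commutators. -/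
theorem delta_conjS (hX : Ω.IsSymplecticVectorField X) (hS : S.IsHermitian) (f : Series m M) :
    S.delta X (conjS f) = -conjS (S.delta X f) := by
  refine val_ext fun n q => ?_
  obtain ⟨H, hH, h⟩ := S.exists_val_delta_eq hX q
  have e : ∀ g : Series m M, val n (-conjS g) q = -starRingEnd ℂ (val n g q) := by
    intro g
    change -(coeff n (conjS g)).1 q = _
    rw [coeff_conjS]
    rfl
  rw [h, S.conjS_ad hS, e, e, h]

theorem iterate_delta (hX : Ω.IsSymplecticVectorField X) (r : ℕ) (f : Series m M) :
    (S.delta X)^[r] f = (S.deltaHom hX ^ r) f :=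
  (Module.End.pow_apply (S.deltaHom hX) r f).symm

theorem coeff_expDelta (hX : Ω.IsSymplecticVectorField X) (β : ℝ) (f : Series m M) {k n : ℕ}
    (hkn : k ≤ n) : coeff k (S.expDelta X β f) = ∑ r ∈ Finset.range (n + 1),
      ((β : ℂ) ^ r / (r.factorial : ℂ)) • coeff k ((S.deltaHom hX ^ r) f) := by
  rw [expDelta, coeff_mk]
  simp only [S.iterate_delta hX]
  refine Finset.sum_subset (Finset.range_mono (by omega)) fun r _ hr => ?_
  rw [S.coeff_deltaHom_pow_eq_zero hX (n := 0) (by simp) r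
    (by simp only [Finset.mem_range, not_lt] at hr; omega), smul_zero]

theorem expDelta_mem_compact (hX : Ω.IsSymplecticVectorField X) (β : ℝ) {f : Series m M}
    (hf : f ∈ Compact m M) : S.expDelta X β f ∈ Compact m M := by
  have hr : ∀ r, (S.delta X)^[r] f ∈ Compact m M := by
    intro r
    induction r with
    | zero => exact hf
    | succ r ih =>
      rw [Function.iterate_succ_apply']
      exact S.delta_mem_compact hX ih
  intro n
  have e : val n (S.expDelta X β f) = ∑ r ∈ Finset.range (n + 1),
      fun q => ((β : ℂ) ^ r / (r.factorial : ℂ)) * val n ((S.delta X)^[r] f) q := by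
    funext q
    simp [val, expDelta, Finset.sum_apply]
  rw [e]
  refine Finset.sum_induction _ HasCompactSupport (fun _ _ h h' => h.add h')
    HasCompactSupport.zero fun r _ => ?_
  exact (hr r n).mul_left (f := fun _ => (β : ℂ) ^ r / (r.factorial : ℂ))

theorem expDelta_conjS (hX : Ω.IsSymplecticVectorField X) (hS : S.IsHermitian) (β : ℝ)
    (f : Series m M) : S.expDelta X β (conjS f) = conjS (S.expDelta X (-β) f) := by
  have hr : ∀ r, (S.delta X)^[r] (conjS f) = ((-1 : ℂ) ^ r) • conjS ((S.delta X)^[r] f) := by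
    intro r
    induction r with
    | zero => simp
    | succ r ih =>
      rw [Function.iterate_succ_apply', Function.iterate_succ_apply', ih]
      have := (S.deltaHom hX).map_smul ((-1 : ℂ) ^ r) (conjS ((S.delta X)^[r] f))
      refine this.trans ?_
      change ((-1 : ℂ) ^ r) • S.delta X (conjS ((S.delta X)^[r] f)) = _
      rw [S.delta_conjS hX hS, pow_succ]
      simp
  ext n : 1
  rw [coeff_conjS, expDelta, coeff_mk, expDelta, coeff_mk, map_sum]
  refine Finset.sum_congr rfl fun r _ => ?_
  rw [hr, conj_smul, ← coeff_conjS]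
  change ((β : ℂ) ^ r / (r.factorial : ℂ)) •
    (((-1 : ℂ) ^ r) • coeff n (conjS ((S.delta X)^[r] f))) = _
  rw [smul_smul]
  congr 1
  simp [neg_pow (β : ℂ)]
  ring

/-- `e^{βδ_X}` and `e^{-βδ_X}` are inverse to each other: modulo `λ^{n+1}` both are polynomials
in `δ_X`, whose product is `1` modulo `δ_X^{n+1}`. -/
theorem expDelta_expDelta_neg (hX : Ω.IsSymplecticVectorField X) (β : ℝ) (f : Series m M) :
    S.expDelta X β (S.expDelta X (-β) f) = f := by
  ext n : 1
  set Δ := S.deltaHom hX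
  let P : ℝ → Polynomial ℂ := fun b =>
    ∑ r ∈ Finset.range (n + 1), Polynomial.monomial r ((b : ℂ) ^ r / (r.factorial : ℂ))
  have hP : ∀ b g, Polynomial.aeval Δ (P b) g =
      ∑ r ∈ Finset.range (n + 1), ((b : ℂ) ^ r / (r.factorial : ℂ)) • (Δ ^ r) g := by
    intro b g
    simp only [P, map_sum, Polynomial.aeval_monomial, LinearMap.sum_apply]
    rfl
  have hcoeff : ∀ b k (g : Series m M), k ≤ n →
      coeff k (S.expDelta X b g) = coeff k (Polynomial.aeval Δ (P b) g) := by
    intro b k g hk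
    rw [S.coeff_expDelta hX b g hk, hP, map_sum]
    rfl
  have hPc : ∀ b r, r ≤ n → (P b).coeff r = (b : ℂ) ^ r / (r.factorial : ℂ) := by
    intro b r hr
    simp only [P, Polynomial.finsetSum_coeff, Polynomial.coeff_monomial]
    rw [Finset.sum_ite_eq']
    simp [Nat.lt_succ_of_le hr]
  have hdvd : (Polynomial.X : Polynomial ℂ) ^ (n + 1) ∣ P β * P (-β) - 1 := by
    rw [Polynomial.X_pow_dvd_iff]
    intro d hd
    have h1 := congrArg (coeff d)
      (PowerSeries.exp_mul_exp_eq_exp_add (A := ℂ) (β : ℂ) ((-β : ℝ) : ℂ))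
    rw [PowerSeries.coeff_mul] at h1
    rw [Polynomial.coeff_sub, Polynomial.coeff_mul]
    have h2 : ∑ x ∈ antidiagonal d, (P β).coeff x.1 * (P (-β)).coeff x.2 =
        ∑ x ∈ antidiagonal d, coeff x.1 (rescale (β : ℂ) (exp ℂ)) *
          coeff x.2 (rescale ((-β : ℝ) : ℂ) (exp ℂ)) := by
      refine Finset.sum_congr rfl fun x hx => ?_
      rw [mem_antidiagonal] at hx
      rw [hPc _ _ (by omega), hPc _ _ (by omega)]
      simp [coeff_rescale, coeff_exp, div_eq_mul_inv]
    have h3 : (β : ℂ) + ((-β : ℝ) : ℂ) = 0 := by push_cast; ring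
    rw [h2, h1, h3, Polynomial.coeff_one]
    rcases Nat.eq_zero_or_pos d with rfl | hd0
    · simp
    · simp [hd0.ne']
  obtain ⟨Q, hQ⟩ := hdvd
  have hQ' : P β * P (-β) = 1 + Polynomial.X ^ (n + 1) * Q := by rw [← hQ]; ring
  set g := S.expDelta X (-β) f
  -- Replace the inner exponential by a polynomial in `δ_X`; the error has order at least `n + 1`.
  have hg : coeff n (Polynomial.aeval Δ (P β) g) =
      coeff n (Polynomial.aeval Δ (P β) (Polynomial.aeval Δ (P (-β)) f)) := by
    rw [hP, hP, map_sum, map_sum]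
    refine Finset.sum_congr rfl fun r _ => ?_
    change ((β : ℂ) ^ r / (r.factorial : ℂ)) • coeff n ((Δ ^ r) g) =
      ((β : ℂ) ^ r / (r.factorial : ℂ)) • coeff n ((Δ ^ r) (Polynomial.aeval Δ (P (-β)) f))
    congr 1
    rw [← sub_eq_zero, ← map_sub, ← map_sub]
    refine S.coeff_deltaHom_pow_eq_zero hX (n := n + 1) (fun k hk => ?_) r (by omega)
    rw [map_sub, sub_eq_zero]
    exact hcoeff _ _ _ (by omega)
  rw [hcoeff _ _ _ le_rfl, hg]
  have h5 : Polynomial.aeval Δ (P β) (Polynomial.aeval Δ (P (-β)) f) =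
      Polynomial.aeval Δ (P β * P (-β)) f := by
    rw [map_mul]
    rfl
  rw [h5, hQ', map_add, map_mul, map_one, map_pow, Polynomial.aeval_X]
  have h6 : coeff n ((Δ ^ (n + 1)) (Polynomial.aeval Δ Q f)) = 0 :=
    S.coeff_deltaHom_pow_eq_zero hX (n := 0) (by simp) (n + 1) (by omega)
  change coeff n (f + (Δ ^ (n + 1)) (Polynomial.aeval Δ Q f)) = _
  rw [map_add, h6, add_zero]

end StarProduct

end Derivation

/-! ### The lowest order of a functional, and positivity -/

section Lowest

open Finset.HasAntidiagonal PowerSeries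

variable {m : ℕ} {M : Type*} [TopologicalSpace M] [ChartedSpace (EuclideanSpace ℝ (Fin m)) M]

theorem hasCompactSupport_val {f : Series m M} (hf : f ∈ Compact m M) (n : ℕ) :
    HasCompactSupport (coeff n f).1 := hf n

theorem C_mem_compact {f : Smooth m M} (hf : HasCompactSupport f.1) : C f ∈ Compact m M := by
  intro n
  rcases Nat.eq_zero_or_pos n with rfl | hn
  · have : val 0 (C f : Series m M) = f.1 := by
      funext q
      simp [val]
    rwa [this]
  · have : val n (C f : Series m M) = 0 := by
      funext q
      simp [val, coeff_C, hn.ne']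
    rw [this]
    exact HasCompactSupport.zero

theorem hasCompactSupport_conj_mul {f : Smooth m M} (hf : HasCompactSupport f.1) :
    HasCompactSupport (conj f * f).1 :=
  HasCompactSupport.mul_left (f := (conj f).1) hf

variable (m) in
/-- The lowest order of `μ` is `λ^k`, and there `μ` takes values in the open half line spanned
by `z` on all series that start with a nonzero function `conj f * f`. -/
def HasLowestPhase (μ : Functional m M) (k : ℕ) (z : ℂ) : Prop :=
  ∀ (s : ℕ) (F : Compact m M) (f : Smooth m M), f ≠ 0 → HasCompactSupport f.1 →
    (∀ i < s, coeff i F.1 = 0) → coeff s F.1 = conj f * f →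
    (∀ i < k + s, coeff i (μ F) = 0) ∧ ∃ κ : ℝ, 0 < κ ∧ coeff (k + s) (μ F) = κ * z

theorem HasLowestPhase.neg {μ : Functional m M} {k : ℕ} {z : ℂ} (h : HasLowestPhase m μ k z) :
    HasLowestPhase m (-μ) k (-z) := by
  intro s F f hf hc h0 hs
  obtain ⟨h1, κ, hκ, h2⟩ := h s F f hf hc h0 hs
  refine ⟨fun i hi => ?_, κ, hκ, ?_⟩
  · rw [LinearMap.neg_apply, map_neg, h1 i hi, neg_zero]
  · rw [LinearMap.neg_apply, map_neg, h2, mul_neg]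

/-- The coefficient of `λ^k` in `μ`, as a functional on functions. -/
theorem exists_coeff_functional (μ : Functional m M) (k : ℕ) :
    ∃ ν : (M → ℂ) →ₗ[ℂ] ℂ, ∀ (f : Smooth m M) (hf : HasCompactSupport f.1),
      ν f.1 = coeff k (μ ⟨C f, C_mem_compact hf⟩) := by
  let W : Submodule ℂ (M → ℂ) :=
    { carrier := {f | ContMDiff (𝓡 m) 𝓘(ℝ, ℂ) ∞ f ∧ HasCompactSupport f}
      add_mem' := fun hf hg => ⟨hf.1.add hg.1, hf.2.add hg.2⟩
      zero_mem' := ⟨contMDiff_const, HasCompactSupport.zero⟩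
      smul_mem' := fun c f hf => ⟨(Smooth m M).smul_mem hf.1 c,
        hf.2.mul_left (f := fun _ => c)⟩ }
  let ν₀ : W →ₗ[ℂ] ℂ :=
    { toFun := fun f => coeff k (μ ⟨C (⟨f.1, f.2.1⟩ : Smooth m M), C_mem_compact f.2.2⟩)
      map_add' := fun f g => by
        rw [← map_add, ← map_add]
        congr 2
        apply Subtype.ext
        exact map_add (C (R := Smooth m M)) ⟨f.1, f.2.1⟩ ⟨g.1, g.2.1⟩
      map_smul' := fun c f => by
        have : (⟨C (⟨(c • f).1, (c • f).2.1⟩ : Smooth m M), C_mem_compact (c • f).2.2⟩ :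
            Compact m M) = (C c : ℂ⟦X⟧) • ⟨C (⟨f.1, f.2.1⟩ : Smooth m M), C_mem_compact f.2.2⟩ := by
          apply Subtype.ext
          have h : algebraMap ℂ⟦X⟧ (Series m M) (C c) = C (algebraMap ℂ (Smooth m M) c) :=
            PowerSeries.map_C _ _
          change _ = (C c : ℂ⟦X⟧) • (C (⟨f.1, f.2.1⟩ : Smooth m M) : Series m M)
          rw [Algebra.smul_def, h, ← map_mul]
          rfl
        rw [this, map_smul, smul_eq_mul, coeff_C_mul]
        rfl }
  obtain ⟨ν, hν⟩ := LinearMap.exists_extend ν₀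
  refine ⟨ν, fun f hf => ?_⟩
  exact congrArg (fun l => l ⟨f.1, f.2, hf⟩) hν

/-- A series that starts at order `s` is `λ^s` times a series. -/
theorem exists_eq_X_pow_smul (F : Compact m M) {s : ℕ} (h : ∀ i < s, coeff i F.1 = 0) :
    ∃ G : Compact m M, F = (X ^ s : ℂ⟦X⟧) • G ∧ coeff 0 G.1 = coeff s F.1 := by
  refine ⟨⟨PowerSeries.mk fun n => coeff (n + s) F.1, fun n => ?_⟩, ?_, ?_⟩
  · have : val n (PowerSeries.mk fun n => coeff (n + s) F.1) = val (n + s) F.1 := by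
      funext q
      rw [val, coeff_mk]
      rfl
    rw [this]
    exact F.2 _
  · apply Subtype.ext
    have hX : algebraMap ℂ⟦X⟧ (Series m M) (X ^ s) = X ^ s := by
      have : algebraMap ℂ⟦X⟧ (Series m M) X = X := PowerSeries.map_X _
      rw [map_pow, this]
    change F.1 = (X ^ s : ℂ⟦X⟧) • (PowerSeries.mk fun n => coeff (n + s) F.1 : Series m M)
    rw [Algebra.smul_def, hX]
    ext n : 1
    rw [coeff_X_pow_mul']
    split_ifs with hn
    · rw [coeff_mk, Nat.sub_add_cancel hn]
    · exact h n (not_le.1 hn)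
  · rw [coeff_mk, zero_add]

/-- If `μ` has order at least `k`, then on series of order at least `s` it has order at least
`k + s`, and there it is given by its lowest coefficient. -/
theorem coeff_apply_of_order {μ : Functional m M} {k : ℕ}
    (hk : ∀ (F : Compact m M), ∀ i < k, coeff i (μ F) = 0) (F : Compact m M) {s : ℕ}
    (h : ∀ i < s, coeff i F.1 = 0) :
    (∀ i < k + s, coeff i (μ F) = 0) ∧ coeff (k + s) (μ F) =
      coeff k (μ ⟨C (coeff s F.1), C_mem_compact (hasCompactSupport_val F.2 s)⟩) := by
  obtain ⟨G, hG, hG0⟩ := exists_eq_X_pow_smul F h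
  have h1 : μ F = X ^ s * μ G := by
    conv_lhs => rw [hG, map_smul, smul_eq_mul]
  refine ⟨fun i hi => ?_, ?_⟩
  · rw [h1, coeff_X_pow_mul']
    split_ifs with hs
    · exact hk G _ (by omega)
    · rfl
  · rw [h1, coeff_X_pow_mul]
    set G₀ : Compact m M := ⟨C (coeff s F.1), C_mem_compact (hasCompactSupport_val F.2 s)⟩
    obtain ⟨G', hG', -⟩ := exists_eq_X_pow_smul (G - G₀) (s := 1) (by
      intro i hi
      obtain rfl : i = 0 := by omega
      change coeff 0 (G.1 - C (coeff s F.1)) = 0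
      rw [map_sub, hG0, coeff_zero_C, sub_self])
    have h2 : μ G = μ G₀ + X ^ 1 * μ G' := by
      have e : G₀ + (G - G₀) = G := Subtype.ext (add_sub_cancel G₀.1 G.1)
      rw [← smul_eq_mul, ← map_smul, ← hG', ← map_add, e]
    have h3 : coeff k (X ^ 1 * μ G') = 0 := by
      rw [coeff_X_pow_mul']
      split_ifs with hs
      · exact hk G' _ (by omega)
      · rfl
    rw [h2, map_add, h3, add_zero]

theorem exists_order {μ : Functional m M} (hμ : μ ≠ 0) :
    ∃ k, (∀ (F : Compact m M), ∀ i < k, coeff i (μ F) = 0) ∧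
      ∃ f : Smooth m M, ∃ hf : HasCompactSupport f.1,
        coeff k (μ ⟨C f, C_mem_compact hf⟩) ≠ 0 := by
  classical
  have hex : ∃ k, ∃ F, coeff k (μ F) ≠ 0 := by
    by_contra! h
    refine hμ (LinearMap.ext fun F => ?_)
    ext k
    exact h k F
  have hk : ∀ (F : Compact m M), ∀ i < Nat.find hex, coeff i (μ F) = 0 := by
    intro F i hi
    by_contra hne
    exact Nat.find_min hex hi ⟨F, hne⟩
  obtain ⟨F, hF⟩ := Nat.find_spec hex
  refine ⟨Nat.find hex, hk, coeff 0 F.1, F.2 0, ?_⟩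
  rwa [← (coeff_apply_of_order hk F (s := 0) (by simp)).2]

theorem exists_ne_zero_of_ne_zero {μ : Functional m M} (hμ : μ ≠ 0) :
    ∃ f : Smooth m M, HasCompactSupport f.1 ∧ f ≠ 0 := by
  obtain ⟨k, -, f, hf, hne⟩ := exists_order hμ
  refine ⟨f, hf, ?_⟩
  rintro rfl
  refine hne ?_
  have : (⟨C 0, C_mem_compact hf⟩ : Compact m M) = 0 := Subtype.ext (map_zero _)
  rw [this, map_zero, map_zero]

namespace StarProduct

variable {Ω : SymplecticForm m M} (S : StarProduct Ω)

/-- For all functions `f` and `g` with compact support, `μ` vanishes on some series whose lowest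
term is `iλ` times the twisted Poisson bracket `{f, g} + g D f`. Such series are the commutators
`f * g - g * f`, with `D = 0`, and their analogues `f * g - g * e^{βδ} f`. -/
def AnnihilatesTwisted (D : Smooth m M → Smooth m M) (μ : Functional m M) : Prop :=
  ∀ f g : Smooth m M, HasCompactSupport f.1 → HasCompactSupport g.1 →
    ∃ F : Compact m M, μ F = 0 ∧ coeff 0 F.1 = 0 ∧
      coeff 1 F.1 = Complex.I • (S.br f g + g * D f)

/-- The lowest coefficient of `μ` annihilates all twisted Poisson brackets, so it has a phase by
`exists_phase`. -/
theorem exists_hasLowestPhase [IsManifold (𝓡 m) ∞ M] [T2Space M] [SecondCountableTopology M]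
    [ConnectedSpace M] {D : Smooth m M → Smooth m M}
    (hD : ∀ f hf q, ((D (ofReal f hf)).1 q).im = 0) {μ : Functional m M}
    (hμ : S.AnnihilatesTwisted D μ) (hne : μ ≠ 0) :
    ∃ k z, z ≠ 0 ∧ HasLowestPhase m μ k z := by
  obtain ⟨k, hk, f, hf, hfne⟩ := exists_order hne
  obtain ⟨ν, hν⟩ := exists_coeff_functional μ k
  obtain ⟨z, hz, hzf⟩ := S.exists_phase hD (ν := ν) (fun f g hf hg => by
    obtain ⟨F, hF, hF0, hF1⟩ := hμ f g hf hg
    have h1 := (coeff_apply_of_order hk F (s := 1) (by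
      intro i hi
      obtain rfl : i = 0 := by omega
      exact hF0)).2
    rw [hF, map_zero, ← hν _ (hasCompactSupport_val F.2 1), hF1] at h1
    have h2 : (Complex.I • (S.br f g + g * D f)).1 = Complex.I • (S.br f g + g * D f).1 := rfl
    rw [h2, map_smul, smul_eq_mul] at h1
    exact (mul_eq_zero.1 h1.symm).resolve_left Complex.I_ne_zero) ⟨f, hf, by rwa [hν f hf]⟩
  refine ⟨k, z, hz, fun s F g hg hgc h0 hs => ?_⟩
  obtain ⟨h1, h2⟩ := coeff_apply_of_order hk F h0
  obtain ⟨κ, hκ, h3⟩ := hzf g hgc hg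
  refine ⟨h1, κ, hκ, ?_⟩
  rw [h2, ← hν _ (hasCompactSupport_val F.2 s), hs, h3]

theorem coeff_mul_of_order {f g : Series m M} {s t : ℕ} (hf : ∀ i < s, coeff i f = 0)
    (hg : ∀ i < t, coeff i g = 0) :
    (∀ i < s + t, coeff i (S.mul f g) = 0) ∧
      coeff (s + t) (S.mul f g) = coeff s f * coeff t g := by
  have key : ∀ n, n ≤ s + t → ∀ r i j, r + (i + j) = n → (r, i, j) ≠ (0, s, t) →
      S.B r (coeff i f) (coeff j g) = 0 := by
    intro n hn r i j hij hne
    by_cases hi : i < s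
    · rw [hf i hi]; simp
    by_cases hj : j < t
    · rw [hg j hj]; simp
    refine absurd ?_ hne
    have : r = 0 ∧ i = s ∧ j = t := by omega
    simp [this]
  refine ⟨fun n hn => ?_, ?_⟩
  · rw [coeff_mul]
    refine Finset.sum_eq_zero fun rs hrs => Finset.sum_eq_zero fun ij hij => ?_
    rw [mem_antidiagonal] at hrs hij
    refine key n hn.le _ _ _ (by omega) fun h => ?_
    simp only [Prod.mk.injEq] at h
    omega
  · rw [coeff_mul, Finset.sum_eq_single (0, s + t), Finset.sum_eq_single (s, t), S.zeroth]
    · rintro ⟨i, j⟩ hij hne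
      rw [mem_antidiagonal] at hij
      refine key (s + t) le_rfl _ _ _ (by simpa using hij) fun h => hne ?_
      simp only [Prod.mk.injEq] at h ⊢
      exact h.2
    · intro h
      simp at h
    · rintro ⟨r, l⟩ hrl hne
      rw [mem_antidiagonal] at hrl
      refine Finset.sum_eq_zero fun ij hij => ?_
      rw [mem_antidiagonal] at hij
      refine key (s + t) le_rfl _ _ _ (by simp only at hij hrl ⊢; omega) fun h => hne ?_
      simp only [Prod.mk.injEq] at h hrl hij ⊢
      exact ⟨h.1, by omega⟩
    · intro h
      simp at h

variable [T2Space M]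

/-- Nonzero series have a definite lowest order in `μ(conj f * f)`. -/
theorem exists_coeff_mul_conjS {μ : Functional m M} {k : ℕ} {z : ℂ} (h : HasLowestPhase m μ k z)
    {f : Compact m M} (hf : f ≠ 0) : ∃ n, (∀ i < n, coeff i (μ (S.mulRight (conjS f.1) f)) = 0) ∧
      ∃ κ : ℝ, 0 < κ ∧ coeff n (μ (S.mulRight (conjS f.1) f)) = κ * z := by
  classical
  have hex : ∃ s, coeff s f.1 ≠ 0 := by
    by_contra! h0
    exact hf (Subtype.ext (PowerSeries.ext h0))
  have h0 : ∀ i < Nat.find hex, coeff i f.1 = 0 := fun i hi => by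
    by_contra hne
    exact Nat.find_min hex hi hne
  have h0' : ∀ i < Nat.find hex, coeff i (conjS f.1) = 0 := fun i hi => by
    rw [coeff_conjS, h0 i hi, map_zero]
  obtain ⟨h1, h2⟩ := S.coeff_mul_of_order h0' h0
  rw [coeff_conjS] at h2
  exact ⟨_, h (Nat.find hex + Nat.find hex) (S.mulRight (conjS f.1) f) (coeff (Nat.find hex) f.1)
    (Nat.find_spec hex) (f.2 _) h1 h2⟩

theorem gelfandIdeal_eq {μ : Functional m M} {k : ℕ} {z : ℂ} (h : HasLowestPhase m μ k z)
    (hz : z ≠ 0) : S.gelfandIdeal μ = {0} := by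
  ext f
  refine ⟨fun hf => ?_, ?_⟩
  · by_contra hne
    obtain ⟨n, -, κ, hκ, h1⟩ := S.exists_coeff_mul_conjS h hne
    have hf' : μ (S.mulRight (conjS f.1) f) = 0 := hf
    rw [hf', map_zero] at h1
    exact mul_ne_zero (by exact_mod_cast hκ.ne') hz h1.symm
  · rintro rfl
    change μ (S.mulRight (conjS 0) 0) = 0
    have : S.mulRight (conjS 0) (0 : Compact m M) = 0 := by
      apply Subtype.ext
      ext n : 1
      change coeff n (S.mul (conjS 0) 0) = 0
      rw [coeff_mul]
      simp
    rw [this, map_zero]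

theorem isPositive_of_hasLowestPhase (hS : S.IsHermitian) {μ : Functional m M} (hμ : IsReal μ)
    {k : ℕ} {z : ℝ} (hz : 0 < z) (h : HasLowestPhase m μ k z) : S.IsPositive μ := by
  intro f
  set F := S.mulRight (conjS f.1) f
  have hF : (⟨conjS F.1, conjS_mem F.2⟩ : Compact m M) = F := by
    apply Subtype.ext
    change conjS (S.mul (conjS f.1) f.1) = S.mul (conjS f.1) f.1
    rw [hS, conjS_conjS]
  have hre : ∀ n, ((coeff n (μ F)).re : ℂ) = coeff n (μ F) := by
    intro n
    have h1 := hμ F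
    rw [hF] at h1
    have h2 := congrArg (coeff n) h1
    rw [conjC, PowerSeries.coeff_map] at h2
    exact Complex.conj_eq_iff_re.1 h2.symm
  refine ⟨PowerSeries.mk fun n => (coeff n (μ F)).re, ?_, ?_⟩
  · ext n : 1
    rw [PowerSeries.coeff_map, coeff_mk]
    exact (hre n).symm
  · by_cases hf : f = 0
    · left
      have h0 : F = 0 := by
        apply Subtype.ext
        ext n : 1
        change coeff n (S.mul (conjS f.1) f.1) = 0
        rw [hf, coeff_mul]
        simp
      ext n
      simp [h0]
    · right
      obtain ⟨n, h0, κ, hκ, h1⟩ := S.exists_coeff_mul_conjS h hf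
      refine ⟨n, fun i hi => ?_, ?_⟩
      · rw [coeff_mk, h0 i hi, Complex.zero_re]
      · rw [coeff_mk, h1, ← Complex.ofReal_mul, Complex.ofReal_re]
        exact mul_pos hκ hz

end StarProduct

end Lowest

/-! ### Traces and KMS functionals -/

section KMS

open Finset.HasAntidiagonal PowerSeries

variable {m : ℕ} {M : Type*} [TopologicalSpace M] [ChartedSpace (EuclideanSpace ℝ (Fin m)) M]

theorem conjC_conjC (a : ℂ⟦X⟧) : conjC (conjC a) = a := by
  ext n : 1
  rw [conjC, PowerSeries.coeff_map, PowerSeries.coeff_map, Complex.conj_conj]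

theorem conjS_smul (a : ℂ⟦X⟧) (f : Series m M) : conjS (a • f) = conjC a • conjS f := by
  have h : ∀ b : ℂ⟦X⟧, algebraMap ℂ⟦X⟧ (Series m M) b =
      PowerSeries.map (algebraMap ℂ (Smooth m M)) b := fun _ => rfl
  have h2 : conjS (algebraMap ℂ⟦X⟧ (Series m M) a) =
      algebraMap ℂ⟦X⟧ (Series m M) (conjC a) := by
    ext n : 1
    rw [coeff_conjS, h, h, PowerSeries.coeff_map, PowerSeries.coeff_map, conjC,
      PowerSeries.coeff_map]
    ext q
    rfl
  rw [Algebra.smul_def, Algebra.smul_def, map_mul, h2]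

/-- The conjugate functional `f ↦ conj μ(conj f)`. -/
def Functional.star (μ : Functional m M) : Functional m M where
  toFun f := conjC (μ ⟨conjS f.1, conjS_mem f.2⟩)
  map_add' f g := by
    rw [← map_add, ← map_add]
    congr 2
    exact Subtype.ext (map_add conjS f.1 g.1)
  map_smul' a f := by
    have : (⟨conjS (a • f).1, conjS_mem (a • f).2⟩ : Compact m M) =
        conjC a • ⟨conjS f.1, conjS_mem f.2⟩ := Subtype.ext (conjS_smul a f.1)
    rw [this, map_smul, smul_eq_mul, map_mul, conjC_conjC]
    rfl

theorem Functional.star_apply (μ : Functional m M) (f : Compact m M) :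
    Functional.star μ f = conjC (μ ⟨conjS f.1, conjS_mem f.2⟩) := rfl

theorem isReal_of_star_eq {μ : Functional m M} (h : Functional.star μ = μ) : IsReal μ := by
  intro f
  have h1 := congrArg conjC (LinearMap.congr_fun h f)
  rwa [Functional.star_apply, conjC_conjC] at h1

namespace StarProduct

variable {Ω : SymplecticForm m M} (S : StarProduct Ω)

theorem coeff_zero_mul (f g : Series m M) : coeff 0 (S.mul f g) = coeff 0 f * coeff 0 g := by
  rw [coeff_mul]
  simp [S.zeroth]

theorem coeff_one_mul (f g : Series m M) : coeff 1 (S.mul f g) =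
    coeff 0 f * coeff 1 g + coeff 1 f * coeff 0 g + S.B 1 (coeff 0 f) (coeff 0 g) := by
  rw [coeff_mul, Finset.Nat.antidiagonal_succ]
  simp [Finset.Nat.antidiagonal_succ, S.zeroth]

/-- The default value of `timeDev`, the identity, satisfies this as well. -/
theorem timeDev_zero (X : ∀ q : M, TangentSpace (𝓡 m) q) (f : Series m M) :
    S.timeDev X 0 f = f := by
  rw [timeDev]
  split_ifs with h
  · exact h.choose_spec.initial
  · rfl

variable [T2Space M]

theorem IsTrace.annihilatesTwisted {S : StarProduct Ω} {tr : Functional m M} (h : S.IsTrace tr) :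
    S.AnnihilatesTwisted (fun _ => 0) tr := by
  intro f g hf hg
  refine ⟨_, h ⟨C f, C_mem_compact hf⟩ ⟨C g, C_mem_compact hg⟩, ?_, ?_⟩
  · change coeff 0 (S.mul (C f) (C g) - S.mul (C g) (C f)) = 0
    rw [map_sub, coeff_zero_mul, coeff_zero_mul, mul_comm, sub_self]
  · change coeff 1 (S.mul (C f) (C g) - S.mul (C g) (C f)) = _
    rw [map_sub, coeff_one_mul, coeff_one_mul, br]
    simp [coeff_C, smul_smul]

theorem StaticKMS.smul {S : StarProduct Ω} {X : ∀ q : M, TangentSpace (𝓡 m) q} {β : ℝ}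
    {μ : Functional m M} (h : S.StaticKMS X β μ) (c : ℂ⟦X⟧) : S.StaticKMS X β (c • μ) := by
  intro f g
  rw [LinearMap.smul_apply, LinearMap.smul_apply, h f g]

theorem StaticKMS.sub {S : StarProduct Ω} {X : ∀ q : M, TangentSpace (𝓡 m) q} {β : ℝ}
    {μ ρ : Functional m M} (h : S.StaticKMS X β μ) (h' : S.StaticKMS X β ρ) :
    S.StaticKMS X β (μ - ρ) := by
  intro f g
  rw [LinearMap.sub_apply, LinearMap.sub_apply, h f g, h' f g]

theorem DynamicKMS.smul {S : StarProduct Ω} {X : ∀ q : M, TangentSpace (𝓡 m) q} {β : ℝ}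
    {μ : Functional m M} (h : S.DynamicKMS X β μ) (c : ℂ⟦X⟧) : S.DynamicKMS X β (c • μ) := by
  intro t f g
  rw [LinearMap.smul_apply, LinearMap.smul_apply, h t f g]

/-- The dynamic condition at time zero is the static one. -/
theorem DynamicKMS.staticKMS {S : StarProduct Ω} {X : ∀ q : M, TangentSpace (𝓡 m) q} {β : ℝ}
    {μ : Functional m M} (h : S.DynamicKMS X β μ) : S.StaticKMS X β μ := by
  intro f g
  have h0 := h 0 f g
  rw [timeDev_zero] at h0
  have e : S.mulRight f.1 g = S.mulLeft f g.1 := rfl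
  rw [← e, h0, timeDev_zero]

/-- The first order part of `δ_X` on functions, normalized such that it maps real functions to
real functions. -/
def firstDelta (X : ∀ q : M, TangentSpace (𝓡 m) q) (β : ℝ) (f : Smooth m M) : Smooth m M :=
  (Complex.I * β) • coeff 1 (S.delta X (C f))

theorem StaticKMS.annihilatesTwisted {S : StarProduct Ω} {X : ∀ q : M, TangentSpace (𝓡 m) q}
    {β : ℝ} {μ : Functional m M} (h : S.StaticKMS X β μ) :
    S.AnnihilatesTwisted (S.firstDelta X β) μ := by
  intro f g hf hg
  set f' : Compact m M := ⟨C f, C_mem_compact hf⟩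
  set g' : Compact m M := ⟨C g, C_mem_compact hg⟩
  have e0 : coeff 0 (S.expDelta X β (C f)) = f := by
    rw [expDelta, coeff_mk]
    simp
  have e1 : coeff 1 (S.expDelta X β (C f)) = (β : ℂ) • coeff 1 (S.delta X (C f)) := by
    rw [expDelta, coeff_mk]
    simp [Finset.sum_range_succ]
  refine ⟨S.mulLeft f' g'.1 - S.mulLeft g' (S.expDelta X β f'.1), ?_, ?_, ?_⟩
  · exact (map_sub μ _ _).trans (by rw [h f' g', sub_self])
  · change coeff 0 (S.mul (C f) (C g) - S.mul (C g) (S.expDelta X β (C f))) = 0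
    rw [map_sub, coeff_zero_mul, coeff_zero_mul, e0, coeff_zero_C, coeff_zero_C, mul_comm, sub_self]
  · change coeff 1 (S.mul (C f) (C g) - S.mul (C g) (S.expDelta X β (C f))) = _
    rw [map_sub, coeff_one_mul, coeff_one_mul, e0, e1, br, firstDelta]
    have hC : ∀ f : Smooth m M, coeff 1 (C f : Series m M) = 0 := fun f => by simp
    simp only [hC, coeff_zero_C, mul_zero, zero_mul, add_zero]
    rw [smul_add, smul_smul, mul_smul_comm, mul_smul_comm, smul_smul, mul_neg, Complex.I_mul_I,
      neg_neg, one_smul, ← mul_assoc, Complex.I_mul_I]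
    module

variable [IsManifold (𝓡 m) ∞ M] {X : ∀ q : M, TangentSpace (𝓡 m) q}

theorem firstDelta_ofReal_im (hX : Ω.IsSymplecticVectorField X) (β : ℝ) {f : M → ℝ}
    (hf : ContMDiff (𝓡 m) 𝓘(ℝ, ℝ) ∞ f) (q : M) :
    ((S.firstDelta X β (ofReal f hf)).1 q).im = 0 := by
  obtain ⟨H, hH, h⟩ := S.exists_val_delta_eq hX q
  have h1 := h (C (ofReal f hf)) 1
  rw [val, val, coeff_one_ad_C] at h1
  have h2 : (S.br (ofReal H hH) (ofReal f hf)).1 q = -Complex.I *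
      (S.B 1 (ofReal H hH) (ofReal f hf) - S.B 1 (ofReal f hf) (ofReal H hH)).1 q := rfl
  have h3 : (S.firstDelta X β (ofReal f hf)).1 q =
      ((-β : ℝ) : ℂ) * (S.br (ofReal H hH) (ofReal f hf)).1 q := by
    change Complex.I * β * (coeff 1 (S.delta X (C (ofReal f hf)))).1 q = _
    rw [h1, h2]
    push_cast
    ring
  rw [h3, Complex.im_ofReal_mul, S.br_ofReal_im, mul_zero]

/-- The KMS condition is invariant under conjugation of the functional. -/
theorem StaticKMS.star {S : StarProduct Ω} (hS : S.IsHermitian) (hX : Ω.IsSymplecticVectorField X)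
    {β : ℝ} {μ : Functional m M} (h : S.StaticKMS X β μ) :
    S.StaticKMS X β (Functional.star μ) := by
  intro f g
  rw [Functional.star_apply, Functional.star_apply]
  congr 1
  set f' : Compact m M := ⟨conjS f.1, conjS_mem f.2⟩
  set g' : Compact m M := ⟨conjS g.1, conjS_mem g.2⟩
  have e1 : (⟨conjS (S.mulLeft f g.1).1, conjS_mem (S.mulLeft f g.1).2⟩ : Compact m M) =
      S.mulLeft g' f'.1 := Subtype.ext (hS f.1 g.1)
  let a : Compact m M := ⟨S.expDelta X (-β) f'.1, S.expDelta_mem_compact hX _ f'.2⟩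
  have ha : a.1 = conjS (S.expDelta X β f.1) := by
    change S.expDelta X (-β) (conjS f.1) = _
    rw [S.expDelta_conjS hX hS, neg_neg]
  have e2 : (⟨conjS (S.mulLeft g (S.expDelta X β f.1)).1,
      conjS_mem (S.mulLeft g (S.expDelta X β f.1)).2⟩ : Compact m M) = S.mulLeft a g'.1 := by
    apply Subtype.ext
    refine (hS g.1 _).trans ?_
    rw [← ha]
    rfl
  rw [e1, e2, h a g', S.expDelta_expDelta_neg hX]

variable [SecondCountableTopology M] [ConnectedSpace M]

theorem exists_isPositive_of_staticKMS (hS : S.IsHermitian) (hX : Ω.IsSymplecticVectorField X)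
    {β : ℝ} {μ : Functional m M} (h : S.StaticKMS X β μ) :
    ∃ c : (ℂ⟦X⟧)ˣ, S.IsPositive ((c : ℂ⟦X⟧) • μ) := by
  have hD := fun f hf q => S.firstDelta_ofReal_im hX β (f := f) hf q
  by_cases hμ : μ = 0
  · refine ⟨1, fun f => ⟨0, ?_, Or.inl rfl⟩⟩
    simp [hμ]
  obtain ⟨k, z, hz, hkz⟩ := S.exists_hasLowestPhase hD h.annihilatesTwisted hμ
  obtain ⟨f₁, hf₁c, hf₁⟩ := exists_ne_zero_of_ne_zero hμ
  set F : Compact m M := ⟨C (conj f₁ * f₁), C_mem_compact (hasCompactSupport_conj_mul hf₁c)⟩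
  have hlow : ∀ {ρ : Functional m M} {k : ℕ} {z : ℂ}, HasLowestPhase m ρ k z →
      (∀ i < k, coeff i (ρ F) = 0) ∧ ∃ κ : ℝ, 0 < κ ∧ coeff k (ρ F) = κ * z := fun hρ =>
    hρ 0 F f₁ hf₁ hf₁c (by simp) (coeff_zero_C _)
  -- Rescale such that the value at the real series `F` becomes real.
  obtain ⟨h0, κ, hκ, h1⟩ := hlow hkz
  obtain ⟨u, hu⟩ := X_pow_dvd_iff.2 h0
  have hunit : IsUnit u := by
    rw [PowerSeries.isUnit_iff_constantCoeff, isUnit_iff_ne_zero,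
      ← coeff_zero_eq_constantCoeff_apply]
    have h2 : coeff k (μ F) = coeff 0 u := by
      rw [hu]
      simpa using coeff_X_pow_mul u k 0
    rw [← h2, h1]
    exact mul_ne_zero (by exact_mod_cast hκ.ne') hz
  obtain ⟨u, rfl⟩ := hunit
  refine ⟨u⁻¹, ?_⟩
  set ρ : Functional m M := ((u⁻¹ : (ℂ⟦X⟧)ˣ) : ℂ⟦X⟧) • μ
  have hρ : S.StaticKMS X β ρ := h.smul _
  have hρF : ρ F = PowerSeries.X ^ k := by
    change ((u⁻¹ : (ℂ⟦X⟧)ˣ) : ℂ⟦X⟧) * μ F = _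
    rw [hu, mul_comm, mul_assoc, Units.mul_inv, mul_one]
  -- The imaginary part of the rescaled functional vanishes at `F`, hence everywhere.
  have hreal : Functional.star ρ = ρ := by
    by_contra hne
    have hσ : Functional.star ρ - ρ ≠ 0 := sub_ne_zero.2 hne
    obtain ⟨l, w, hw, hlw⟩ := S.exists_hasLowestPhase hD
      (((hρ.star hS hX).sub hρ).annihilatesTwisted) hσ
    obtain ⟨-, τ, hτ, h2⟩ := hlow hlw
    have hFF : (⟨conjS F.1, conjS_mem F.2⟩ : Compact m M) = F := by
      apply Subtype.ext
      change conjS (C (conj f₁ * f₁)) = C (conj f₁ * f₁)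
      rw [conjS_C, map_mul, conj_conj, mul_comm]
    have h3 : (Functional.star ρ - ρ) F = 0 := by
      rw [LinearMap.sub_apply, Functional.star_apply, hFF, hρF, conjC, map_pow, PowerSeries.map_X,
        sub_self]
    rw [h3, map_zero] at h2
    exact mul_ne_zero (by exact_mod_cast hτ.ne') hw h2.symm
  have hρ0 : ρ ≠ 0 := by
    intro h0
    rw [h0, LinearMap.zero_apply] at hρF
    exact pow_ne_zero k X_ne_zero hρF.symm
  obtain ⟨l, w, hw, hlw⟩ := S.exists_hasLowestPhase hD hρ.annihilatesTwisted hρ0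
  obtain ⟨-, τ, hτ, h2⟩ := hlow hlw
  have hτ' : (τ : ℂ) ≠ 0 := by exact_mod_cast hτ.ne'
  rw [hρF, coeff_X_pow] at h2
  have hlk : l = k := by
    by_contra hne
    rw [if_neg hne] at h2
    exact mul_ne_zero hτ' hw h2.symm
  rw [if_pos hlk] at h2
  have hwτ : w = ((τ⁻¹ : ℝ) : ℂ) := by
    push_cast
    rw [eq_comm, inv_eq_of_mul_eq_one_right h2.symm]
  exact S.isPositive_of_hasLowestPhase hS (isReal_of_star_eq hreal) (inv_pos.2 hτ) (hwτ ▸ hlw)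

theorem isPositive_or_of_isTrace (hS : S.IsHermitian) {tr : Functional m M} (h : S.IsTrace tr)
    (hr : IsReal tr) (hne : tr ≠ 0) :
    (S.IsPositive tr ∨ S.IsPositive (-tr)) ∧ S.gelfandIdeal tr = {0} := by
  obtain ⟨k, z, hz, hkz⟩ := S.exists_hasLowestPhase (fun _ _ _ => rfl) h.annihilatesTwisted hne
  refine ⟨?_, S.gelfandIdeal_eq hkz hz⟩
  obtain ⟨f₁, hf₁c, hf₁⟩ := exists_ne_zero_of_ne_zero hne
  set F : Compact m M := ⟨C (conj f₁ * f₁), C_mem_compact (hasCompactSupport_conj_mul hf₁c)⟩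
  obtain ⟨-, κ, hκ, h1⟩ := hkz 0 F f₁ hf₁ hf₁c (by simp) (coeff_zero_C _)
  have hFF : (⟨conjS F.1, conjS_mem F.2⟩ : Compact m M) = F := by
    apply Subtype.ext
    change conjS (C (conj f₁ * f₁)) = C (conj f₁ * f₁)
    rw [conjS_C, map_mul, conj_conj, mul_comm]
  have h2 := congrArg (coeff k) (hr F)
  rw [add_zero] at h1
  rw [hFF, conjC, PowerSeries.coeff_map, h1, map_mul, Complex.conj_ofReal] at h2
  have h3 : starRingEnd ℂ z = z := (mul_left_cancel₀ (by exact_mod_cast hκ.ne') h2).symm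
  obtain ⟨x, rfl⟩ := Complex.conj_eq_iff_real.1 h3
  rcases lt_trichotomy x 0 with hx | rfl | hx
  · right
    have hr' : IsReal (-tr) := fun f => by
      rw [LinearMap.neg_apply, LinearMap.neg_apply, hr f, map_neg]
    have := hkz.neg
    rw [← Complex.ofReal_neg] at this
    exact S.isPositive_of_hasLowestPhase hS hr' (neg_pos.2 hx) this
  · exact absurd rfl hz
  · exact Or.inl (S.isPositive_of_hasLowestPhase hS hr hx hkz)

end StarProduct

end KMS

end DQ

end

theorem lemma4p3 {m : ℕ} {M : Type*} [TopologicalSpace M]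
    [ChartedSpace (EuclideanSpace ℝ (Fin m)) M] [IsManifold (𝓡 m) ∞ M]
    [T2Space M] [SecondCountableTopology M] [ConnectedSpace M]
    (Ω : DQ.SymplecticForm m M) (S : DQ.StarProduct Ω) (hS : S.IsHermitian) :
    (∀ tr : DQ.Functional m M, S.IsTrace tr → DQ.IsReal tr → tr ≠ 0 →
      (S.IsPositive tr ∨ S.IsPositive (-tr)) ∧ S.gelfandIdeal tr = {0}) ∧
    (∀ X : (∀ q : M, TangentSpace (𝓡 m) q), Ω.IsSymplecticVectorField X →
      ∀ (β : ℝ) (μ : DQ.Functional m M), S.StaticKMS X β μ →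
        ∃ c : (PowerSeries ℂ)ˣ,
          S.StaticKMS X β ((c : PowerSeries ℂ) • μ) ∧
          S.IsPositive ((c : PowerSeries ℂ) • μ)) ∧
    (∀ X : (∀ q : M, TangentSpace (𝓡 m) q), Ω.IsSymplecticVectorField X →
      DQ.IsCompleteVectorField X →
      ∀ (β : ℝ) (μ : DQ.Functional m M), S.DynamicKMS X β μ →
        ∃ c : (PowerSeries ℂ)ˣ,
          S.DynamicKMS X β ((c : PowerSeries ℂ) • μ) ∧
          S.IsPositive ((c : PowerSeries ℂ) • μ)) := by
  refine ⟨fun tr h hr hne => S.isPositive_or_of_isTrace hS h hr hne, fun X hX β μ h => ?_,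
    fun X hX _ β μ h => ?_⟩
  · obtain ⟨c, hc⟩ := S.exists_isPositive_of_staticKMS hS hX h
    exact ⟨c, h.smul _, hc⟩
  · obtain ⟨c, hc⟩ := S.exists_isPositive_of_staticKMS hS hX h.staticKMS
    exact ⟨c, h.smul _, hc⟩
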